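/- **Setting.** Fix $\gamma<0$ and a rational density $\rho\in(0,1)$; throughout $N\to\infty$ along integers for which $p:=\rho N$ is an integer. For $C\in\mathbb C\setminus[0,\infty)$ and $1\le j\le N$ let $u_j(C)$ be the unique root of $(1-u)^p(1+u)^{N-p}=C$ for which $$F(u)=\tfrac p\pi\arg(u-1)+\tfrac{N-p}{\pi}\arg(u+1)$$ lies, modulo $2N$, in $(-p+2(j-1),-p+2j]$; for $C>0$ put $u_j(C)=\lim_{\delta\uparrow0}u_j(Ce^{i\delta})$. Arguments and logarithms are principal, $\arg\in(-\pi,\pi]$. Let $$G_N(C)=\frac1p\sum_{j=1}^p\log(1+u_j(C))-\log2 ,\qquad \lambda_A(C)=\frac12\sum_{j\in A}(u_j(C)-1).$$ For $C\ne0$ let $\theta(C)=p^{-1}(\arg(-C)-\pi)\in(-2\pi/p,0]$, so that $C=(|C|^{1/p}e^{i\theta(C)})^p$. **Statement.** For all sufficiently large $N$ the consistency equation of the largest eigenvalue (index set $A_1=\{1,\dots,p-1,N\}$, momentum $0$), $$\frac1p\log\frac{u_N(C)+1}{u_p(C)+1}+G_N(C)=\gamma ,$$ has a unique solution $C^*_{N,\gamma}$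 in $\mathbb C\setminus\{0\}$, and the consistency equation of the second eigenvalue (index set $A_2=\{1,\dots,p-1,p+1\}$, momentum $1$), $$\frac1p\log\frac{u_{p+1}(\tilde C)+1}{u_p(\tilde C)+1}+G_N(\tilde C)=\gamma+\frac{2\pi i}{Np},$$ has a unique solution $\tilde C^*_{N,\gamma}$ in $\mathbb C\setminus\{0\}$. Both have the same leading modulus, and the argument of the second is determined to leading order: $$|C^*_{N,\gamma}|,\ |\tilde C^*_{N,\gamma}| = 2^Ne^{N^2\gamma\rho(1-\rho)}(1+o(1)),\qquad \theta(\tilde C^*_{N,\gamma})=-\frac{2\pi}{N}+o(N^{-1}).$$ Moreover the difference $\Delta_N=\lambda_{A_1}(C^*_{N,\gamma})-\lambda_{A_2}(\tilde C^*_{N,\gamma})$ is exponentially small and satisfies $$\Delta_N=e^{N\gamma\rho}\bigl(1-e^{2\pi i/N}\bigr)+e^{N\gamma(1-\rho)}\bigl(1-e^{-2\pi i/N}\bigr)+O\bigl(e^{2N\gamma\rho}+e^{2N\gamma(1-\rho)}\bigr),$$ $$\Delta_N=\frac{2\pi i}{N}\bigl(e^{N\gamma(1-\rho)}-e^{N\gamma\rho}\bigr)+O(N^{-2})\bigl(e^{N\gamma\rho}+e^{N\gamma(1-\rho)}\bigr).$$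 Consequently, let $M_\gamma$ be the matrix of the tilted generator $L_\gamma g(\eta)=\sum_{x}\eta_{x+1}(1-\eta_x)\bigl(e^\gamma g(\eta^{x,x+1})-g(\eta)\bigr)$ of the TASEP with $p$ particles on the ring $\mathbb Z/N\mathbb Z$, where $\eta^{x,x+1}$ is $\eta$ with the occupation numbers at $x$ and $x+1$ exchanged. Let $\lambda_1(\gamma)$ be its eigenvalue of largest real part and $\lambda_2(\gamma)$ one of second-largest real part. Suppose that, for all large $N$, these eigenvalues are achieved by the choices $A_1$ and $A_2$ of Bethe roots respectively, i.e. for $i=1,2$ we have $\lambda_i(\gamma)=\lambda_{A_i}(C)$ for some $C\neq0$ with $2^Ne^{\gamma N}\prod_{j\in A_i}\frac{u_j(C)-1}{u_j(C)+1}+C=0$. Then the spectral gap $\lambda_1(\gamma)-\lambda_2(\gamma)$ has the same two expansions. -/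

import Mathlib

open Filter Topology Asymptotics

noncomputable section

namespace TASEP

/-! ### The tilted generator -/

/-- Configurations of `p` particles on the ring with `N` sites (at most one particle per site).
The right neighbour of the site `x` is `finRotate N x`. -/
abbrev Config (N p : ℕ) : Type :=
  {η : Fin N → Bool // (Finset.univ.filter (fun x => η x = true)).card = p}

/-- The matrix `M_γ` of the tilted generator
`L_γ g(η) = ∑ₓ η_{x+1} (1 - η_x) (e^γ g(η^{x,x+1}) - g(η))`. -/
def tiltedGenerator (N p : ℕ) (γ : ℝ) : Matrix (Config N p) (Config N p) ℂ :=
  fun η η' => ∑ x : Fin N,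
    if η.1 (finRotate N x) = true ∧ η.1 x = false then
      (if η'.1 = η.1 ∘ Equiv.swap x (finRotate N x) then (Real.exp γ : ℂ) else 0)
        - (if η' = η then 1 else 0)
    else 0

/-- The eigenvalues of `M_γ`, with algebraic multiplicity. -/
def eigenvalues (N p : ℕ) (γ : ℝ) : Multiset ℂ :=
  (tiltedGenerator N p γ).charpoly.roots

/-- `lam` is an eigenvalue of `M_γ` with the largest real part. -/
def IsLargestEigenvalue (N p : ℕ) (γ : ℝ) (lam : ℂ) : Prop :=
  lam ∈ eigenvalues N p γ ∧ ∀ μ ∈ eigenvalues N p γ, μ.re ≤ lam.re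

/-- After removing one copy of `lam₁`, `lam₂` is an eigenvalue of `M_γ` with the largest real
part. -/
def IsSecondEigenvalue (N p : ℕ) (γ : ℝ) (lam₁ lam₂ : ℂ) : Prop :=
  lam₂ ∈ (eigenvalues N p γ).erase lam₁ ∧
    ∀ μ ∈ (eigenvalues N p γ).erase lam₁, μ.re ≤ lam₂.re

/-! ### The labelled roots of `(1 - u)^p (1 + u)^(N - p) = C` -/

/-- `F(u) = (p/π) arg(u - 1) + ((N - p)/π) arg(u + 1)`. -/
def labelF (N p : ℕ) (u : ℂ) : ℝ :=
  (p : ℝ) / Real.pi * Complex.arg (u - 1) + ((N : ℝ) - p) / Real.pi * Complex.arg (u + 1)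

/-- `u` solves `(1 - u)^p (1 + u)^(N - p) = C`, and `F(u)` lies modulo `2N` in the interval
`(-p + 2(j - 1), -p + 2j]`. -/
def IsLabelledRoot (N p j : ℕ) (C u : ℂ) : Prop :=
  (1 - u) ^ p * (1 + u) ^ (N - p) = C ∧
    ∃ m : ℤ, labelF N p u + 2 * (N : ℝ) * m ∈
      Set.Ioc (-(p : ℝ) + 2 * ((j : ℝ) - 1)) (-(p : ℝ) + 2 * (j : ℝ))

/-- The root with label `j`, for `C` off the half-line `[0, ∞)`, where for `0 < p < N` and
`1 ≤ j ≤ N` it exists and is unique. -/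
def rootOffCut (N p j : ℕ) (C : ℂ) : ℂ :=
  Classical.epsilon (fun u => IsLabelledRoot N p j C u)

open Classical in
/-- The root map `u_j(C)`, `C ≠ 0`: the root with label `j` if `C` is not a positive real, and
its limit from the side `Im C < 0` if `C` is a positive real. -/
def betheRoot (N p j : ℕ) (C : ℂ) : ℂ :=
  if 0 < C.re ∧ C.im = 0 then
    limUnder (𝓝[<] (0 : ℝ)) (fun δ : ℝ => rootOffCut N p j (C * Complex.exp (δ * Complex.I)))
  else rootOffCut N p j C

/-! ### Consistency conditions and Bethe eigenvalues -/

/-- `G_N(C) = (1/p) ∑_{j=1}^p log(1 + u_j(C)) - log 2`. -/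
def bigG (N p : ℕ) (C : ℂ) : ℂ :=
  1 / (p : ℂ) * ∑ j ∈ Finset.Icc 1 p, Complex.log (1 + betheRoot N p j C) - Real.log 2

/-- The logarithmic consistency equation for the index set `{1, …, p - 1, s}`, with momentum `m`:
`(1/p) log((u_s(C) + 1)/(u_p(C) + 1)) + G_N(C) = γ + 2πi m/(N p)`, for `C ≠ 0`. -/
def LogConsistency (N p s m : ℕ) (γ : ℝ) (C : ℂ) : Prop :=
  C ≠ 0 ∧
    1 / (p : ℂ) * Complex.log ((betheRoot N p s C + 1) / (betheRoot N p p C + 1)) + bigG N p C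
      = γ + 2 * Real.pi * Complex.I * m / ((N : ℂ) * p)

/-- `C` is the only solution of the logarithmic consistency equation in `ℂ \ {0}`. -/
def IsUniqueSolution (N p s m : ℕ) (γ : ℝ) (C : ℂ) : Prop :=
  LogConsistency N p s m γ C ∧ ∀ C' : ℂ, LogConsistency N p s m γ C' → C' = C

/-- The index set `{1, …, p - 1, s}`. -/
def choiceSet (p s : ℕ) : Finset ℕ := insert s (Finset.Icc 1 (p - 1))

/-- The Bethe expression `(1/2) ∑_{j ∈ A} (u_j(C) - 1)` for an eigenvalue. -/
def betheEigenvalue (N p : ℕ) (A : Finset ℕ) (C : ℂ) : ℂ :=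
  1 / 2 * ∑ j ∈ A, (betheRoot N p j C - 1)

/-- `lam` is given by the Bethe roots selected by `A`: for some `C ≠ 0` with
`2^N e^{γN} ∏_{j ∈ A} (u_j(C) - 1)/(u_j(C) + 1) + C = 0`,
`lam = (1/2) ∑_{j ∈ A} (u_j(C) - 1)`. -/
def IsAchievedBy (N p : ℕ) (γ : ℝ) (A : Finset ℕ) (lam : ℂ) : Prop :=
  ∃ C : ℂ, C ≠ 0 ∧
    2 ^ N * (Real.exp (γ * N) : ℂ)
      * ∏ j ∈ A, ((betheRoot N p j C - 1) / (betheRoot N p j C + 1)) + C = 0 ∧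
    lam = betheEigenvalue N p A C

/-- The argument `θ ∈ (-2π/p, 0]` of the focal parameter: `C = (|C|^{1/p} e^{iθ})^p`. It vanishes
exactly for `C > 0`, and it is continuous off that half-line and up to it from the side
`Im C < 0`, as the root maps are. -/
def focalAngle (p : ℕ) (C : ℂ) : ℝ := (Complex.arg (-C) - Real.pi) / p

/-- The leading modulus `2^N e^{N² γ ρ (1 - ρ)}`. -/
def leadingModulus (N : ℕ) (ρ γ : ℝ) : ℝ :=
  2 ^ N * Real.exp ((N : ℝ) ^ 2 * γ * ρ * (1 - ρ))

/-- The two expansions of a sequence `gap`, along sizes `N k → ∞`: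
`gap = e^{Nγρ}(1 - e^{2πi/N}) + e^{Nγ(1-ρ)}(1 - e^{-2πi/N}) + O(e^{2Nγρ} + e^{2Nγ(1-ρ)})` and
`gap = (2πi/N)(e^{Nγ(1-ρ)} - e^{Nγρ}) + O(N⁻²)(e^{Nγρ} + e^{Nγ(1-ρ)})`. -/
def HasGapExpansion (N : ℕ → ℕ) (ρ γ : ℝ) (gap : ℕ → ℂ) : Prop :=
  (fun k => gap k -
      ((Real.exp (N k * γ * ρ) : ℂ) * (1 - Complex.exp (2 * Real.pi * Complex.I / N k))
        + (Real.exp (N k * γ * (1 - ρ)) : ℂ)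
          * (1 - Complex.exp (-(2 * Real.pi * Complex.I / N k)))))
    =O[atTop] (fun k => Real.exp (2 * N k * γ * ρ) + Real.exp (2 * N k * γ * (1 - ρ))) ∧
  (fun k => gap k -
      2 * Real.pi * Complex.I / N k
        * ((Real.exp (N k * γ * (1 - ρ)) : ℂ) - (Real.exp (N k * γ * ρ) : ℂ)))
    =O[atTop] (fun k => ((N k : ℝ) ^ 2)⁻¹
      * (Real.exp (N k * γ * ρ) + Real.exp (N k * γ * (1 - ρ))))

end TASEP

end

/-! All roots lie on the level curve `|1 - u|^p |1 + u|^(N - p) = |C|`, and the label records the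
position on it. For very small `|C|` the curve is a pair of small ovals, with `p` roots around `1`
and `N - p` around `-1`. Both index sets take `p - 1` of the roots near `1` and one root near `-1`.
The proof has an asymptotic half, which treats small `C`, and an a priori half, which shows that
every solution is small.

Small `C`. Near `1` the `p`-th root of the equation reads `z (1 + z/2)^κ = w` with `z = u - 1` and
`κ = (N - p)/p`; near `-1` it has the same shape with `κ' = p/(N - p)`. Both exponents depend on the
density only, so one pair of analytic inverses serves all `N` (`exists_inverseBranch`). Put `log C =
baseLog + ε`. The consistency equation becomes `ε = fixMap ε` (`logConsistency_iff`), where `fixMap`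
is exponentially small and contracts the unit disc. The product form of the Bethe equation gives the
same equation up to an integer multiple of `2πi p(N - p)/N` (`exists_int_of_prod`); that spacing
grows with `N` while `Im ε` is bounded, so the integer is `0`. Hence both forms have the same unique
solution. The roots near `1` are values of an analytic function at the vertices of a regular
`p`-gon, so sums over all of them lose their linear and quadratic terms. What remains of the
eigenvalue is `-1 + e^{(N-p)γ} e^{-2πim/N} + e^{pγ} e^{2πim/N}` with a quadratic error
(`eventually_eigenvalue`); the gap is the difference between `m = 0` and `m = 1`.

A priori bound. In modulus, either equation says that the product of `|1 + u_j|` over the index set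
is `2^p e^{pγ}`. If the product over `j ≤ p` is at least `2^p` up to a small exponential loss, then
exchanging `u_p` for `u_s` forces `|1 + u_s|` to be about `e^{pγ}` or less, and the root equation
makes `|C|` of order `e^{-cN²}` (`eventually_log_norm_le`).

The lower bound on the product comes from averaging over the phase of `C`. Multiply the polynomials
with roots `(1 + u_j)^m` over a set of `m + 1` equally spaced phases of `C` into a sum: the
dependence on `C` is polynomial of degree at most `m`, so the average is the value at `C = 0`, whose
relevant coefficient is `2^{mp}` (`exists_rotation_norm_coeff_ge`). Some phase therefore has a large
`p`-th symmetric function, which is at most `2^N` times the `m`-th power of the product of the `p`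
largest `|1 + u_j|`. These are the ones with `j ≤ p`, because `|1 + u|` decreases with `|F|` along a
level curve (`labelF_lt_of_norm_lt`). Interlacing of the labels transfers the bound to every phase
at the cost of one bounded factor (`prod_le_of_interlaced`). -/

noncomputable section

namespace TASEP

/-! ### The potential and the label along its level curves -/

/-- The complement of the closed segment `[-1, 1]`. -/
def OffSegment (u : ℂ) : Prop := u.im ≠ 0 ∨ 1 < |u.re|

/-- The logarithmic potential `p log (u - 1) + (N - p) log (u + 1)`. -/
def logPot (N p : ℕ) (u : ℂ) : ℂ :=
  p * Complex.log (u - 1) + ((N : ℂ) - p) * Complex.log (u + 1)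

theorem logPot_im (N p : ℕ) (u : ℂ) : (logPot N p u).im = Real.pi * labelF N p u := by
  have : (((N : ℂ) - p)) = (((N : ℝ) - p : ℝ) : ℂ) := by push_cast; rfl
  have h2 : (p : ℂ) = ((p : ℝ) : ℂ) := by push_cast; rfl
  rw [logPot, this, h2, Complex.add_im, Complex.im_ofReal_mul, Complex.im_ofReal_mul,
    Complex.log_im, Complex.log_im, labelF]
  field_simp

theorem logPot_re (N p : ℕ) (u : ℂ) :
    (logPot N p u).re = p * Real.log ‖u - 1‖ + ((N : ℝ) - p) * Real.log ‖u + 1‖ := by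
  have : (((N : ℂ) - p)) = (((N : ℝ) - p : ℝ) : ℂ) := by push_cast; rfl
  have h2 : (p : ℂ) = ((p : ℝ) : ℂ) := by push_cast; rfl
  rw [logPot, this, h2, Complex.add_re, Complex.re_ofReal_mul, Complex.re_ofReal_mul,
    Complex.log_re, Complex.log_re]

theorem OffSegment.sub_ne_zero {u : ℂ} (h : OffSegment u) : u - 1 ≠ 0 := by
  rintro h'
  have : u = 1 := by linear_combination h'
  subst this
  simp [OffSegment] at h

theorem OffSegment.add_ne_zero {u : ℂ} (h : OffSegment u) : u + 1 ≠ 0 := by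
  rintro h'
  have : u = -1 := by linear_combination h'
  subst this
  simp [OffSegment] at h

theorem exp_logPot {N p : ℕ} (hpN : p ≤ N) {u : ℂ} (h1 : u - 1 ≠ 0) (h2 : u + 1 ≠ 0) :
    Complex.exp (logPot N p u) = (u - 1) ^ p * (u + 1) ^ (N - p) := by
  have : ((N : ℂ) - p) = ((N - p : ℕ) : ℂ) := by push_cast [hpN]; rfl
  rw [logPot, this, Complex.exp_add, Complex.exp_nat_mul, Complex.exp_nat_mul,
    Complex.exp_log h1, Complex.exp_log h2]

/-- The principal argument is `π` on the negative axis, which is its limit from above. This admits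
endpoints on the real axis in the monotonicity argument below. -/
theorem continuousOn_log_closedUpper :
    ContinuousOn Complex.log {z : ℂ | 0 ≤ z.im ∧ z ≠ 0} := by
  rintro z ⟨hz, hz0⟩
  by_cases hs : z ∈ Complex.slitPlane
  · exact (continuousAt_clog hs).continuousWithinAt
  · have h1 : z.re ≤ 0 ∧ z.im = 0 := by
      simpa [Complex.mem_slitPlane_iff, not_or] using hs
    have h2 : z.re < 0 := lt_of_le_of_ne h1.1 fun h => hz0 (Complex.ext h h1.2)
    exact (Complex.continuousWithinAt_log_of_re_neg_of_im_zero h2 h1.2).mono fun w hw => hw.1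

/-- Along a segment in the variable `log (1 + u)` whose interior lies over the upper half-plane,
the difference quotient of the potential has negative imaginary part. -/
theorem im_potential_div_lt {N p : ℕ} (hp : 0 < p) {z0 Δ : ℂ} (hΔ : Δ ≠ 0)
    (him : ∀ t ∈ Set.Ioo (0 : ℝ) 1, 0 < (Complex.exp (z0 + t * Δ)).im)
    (hcl : ∀ t ∈ Set.Icc (0 : ℝ) 1, 0 ≤ (Complex.exp (z0 + t * Δ)).im ∧
      Complex.exp (z0 + t * Δ) - 2 ≠ 0) :
    ((p * Complex.log (Complex.exp (z0 + Δ) - 2) + ((N : ℂ) - p) * (z0 + Δ)) / Δ).im <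
      ((p * Complex.log (Complex.exp z0 - 2) + ((N : ℂ) - p) * z0) / Δ).im := by
  set K : ℝ → ℂ := fun t =>
    (p * Complex.log (Complex.exp (z0 + t * Δ) - 2) + ((N : ℂ) - p) * (z0 + t * Δ)) / Δ with hK
  have hcont : ContinuousOn K (Set.Icc 0 1) := by
    have h1 : ContinuousOn (fun t : ℝ => Complex.log (Complex.exp (z0 + t * Δ) - 2))
        (Set.Icc 0 1) := by
      refine continuousOn_log_closedUpper.comp (by fun_prop) ?_
      intro t ht
      refine ⟨?_, (hcl t ht).2⟩
      simpa using (hcl t ht).1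
    simp only [hK]
    fun_prop
  -- With `v = 1 + u = e^z`, the derivative of `p log (v - 2) + (N - p) log v` in `z` is `p v/(v -
  -- 2) + N - p = N + 2p/(v - 2)`. Its imaginary part is negative when `Im v > 0`.
  have hder : ∀ t ∈ Set.Ioo (0 : ℝ) 1,
      HasDerivAt K (N + 2 * p / (Complex.exp (z0 + t * Δ) - 2)) t := by
    intro t ht
    have hne := (hcl t ⟨ht.1.le, ht.2.le⟩).2
    have hs : Complex.exp (z0 + t * Δ) - 2 ∈ Complex.slitPlane := by
      rw [Complex.mem_slitPlane_iff]; right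
      have := him t ht
      simp only [Complex.sub_im, Complex.im_ofNat, sub_zero]
      exact this.ne'
    have h0 : HasDerivAt (fun t : ℝ => z0 + t * Δ) Δ t := by
      simpa using ((Complex.ofRealCLM.hasDerivAt (x := t)).mul_const Δ).const_add z0
    have h1 := (h0.cexp.sub_const 2).clog_real hs
    have h2 := ((h1.const_mul (p : ℂ)).add (h0.const_mul ((N : ℂ) - p))).div_const Δ
    refine h2.congr_deriv ?_
    field_simp
    ring
  have hanti : StrictAntiOn (fun t => (K t).im) (Set.Icc 0 1) := by
    refine strictAntiOn_of_deriv_neg (convex_Icc 0 1)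
      (Complex.continuous_im.comp_continuousOn hcont) ?_
    intro t ht
    rw [interior_Icc] at ht
    have h1 : HasDerivAt (fun t => (K t).im)
        ((N + 2 * p / (Complex.exp (z0 + t * Δ) - 2)) : ℂ).im t :=
      (Complex.imCLM.hasFDerivAt.comp_hasDerivAt t (hder t ht))
    rw [h1.deriv]
    have hne := (hcl t ⟨ht.1.le, ht.2.le⟩).2
    have hpos := him t ht
    set v := Complex.exp (z0 + t * Δ)
    have : ((N + 2 * p / (v - 2)) : ℂ).im = - (2 * p * v.im / Complex.normSq (v - 2)) := by
      have e : (2 * p / (v - 2) : ℂ) = ((2 * p : ℝ) : ℂ) * (v - 2)⁻¹ := by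
        push_cast; rw [div_eq_mul_inv]
      rw [Complex.add_im, e, Complex.im_ofReal_mul, Complex.inv_im]
      simp
      ring
    rw [this]
    have : 0 < Complex.normSq (v - 2) := Complex.normSq_pos.2 hne
    have hp' : (0 : ℝ) < p := by exact_mod_cast hp
    have : 0 < 2 * p * v.im / Complex.normSq (v - 2) := by positivity
    linarith
  have := hanti (Set.left_mem_Icc.2 zero_le_one) (Set.right_mem_Icc.2 zero_le_one) zero_lt_one
  simpa [hK] using this

theorem logPot_re_lt_of_lt {N p : ℕ} (hp : 0 < p) (hpN : p < N) {u u' : ℂ}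
    (h1 : u - 1 ≠ 0) (h2 : u + 1 ≠ 0)
    (h : ‖u - 1‖ < ‖u' - 1‖) (h' : ‖u + 1‖ < ‖u' + 1‖) :
    (logPot N p u).re < (logPot N p u').re := by
  rw [logPot_re, logPot_re]
  have hp' : (0 : ℝ) < p := by exact_mod_cast hp
  have hq : (0 : ℝ) < N - p := by rw [sub_pos]; exact_mod_cast hpN
  have a1 := Real.log_lt_log (norm_pos_iff.2 h1) h
  have a2 := Real.log_lt_log (norm_pos_iff.2 h2) h'
  nlinarith

/-- On a level curve of the potential in the closed upper half-plane, `F` decreases as `‖1 + u‖`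
increases. -/
theorem labelF_lt_of_norm_lt {N p : ℕ} (hp : 0 < p) (hpN : p < N) {u u' : ℂ}
    (hu : 0 ≤ u.im) (hu' : 0 ≤ u'.im) (ho : OffSegment u) (ho' : OffSegment u')
    (hP : (logPot N p u).re = (logPot N p u').re) (h : ‖u + 1‖ < ‖u' + 1‖) :
    labelF N p u' < labelF N p u := by
  set z0 := Complex.log (u + 1) with hz0
  set z1 := Complex.log (u' + 1) with hz1
  have e0 : Complex.exp z0 = u + 1 := Complex.exp_log ho.add_ne_zero
  have e1 : Complex.exp z1 = u' + 1 := Complex.exp_log ho'.add_ne_zero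
  have hre : 0 < (z1 - z0).re := by
    rw [Complex.sub_re, hz0, hz1, Complex.log_re, Complex.log_re, sub_pos]
    exact Real.log_lt_log (norm_pos_iff.2 ho.add_ne_zero) h
  have hΔ : z1 - z0 ≠ 0 := fun h0 => by rw [h0] at hre; simp at hre
  have i0 : 0 ≤ z0.im ∧ z0.im ≤ Real.pi := by
    rw [hz0, Complex.log_im]
    exact ⟨Complex.arg_nonneg_iff.2 (by simpa using hu), Complex.arg_le_pi _⟩
  have i1 : 0 ≤ z1.im ∧ z1.im ≤ Real.pi := by
    rw [hz1, Complex.log_im]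
    exact ⟨Complex.arg_nonneg_iff.2 (by simpa using hu'), Complex.arg_le_pi _⟩
  -- If both points lie on the same real ray, the segment is not interior to the upper half-plane.
  -- On such a ray both moduli increase together, so two distinct points cannot have the same level.
  have nb0 : ¬ (z0.im = 0 ∧ z1.im = 0) := by
    rintro ⟨a, b⟩
    rw [hz0, Complex.log_im, Complex.arg_eq_zero_iff] at a
    rw [hz1, Complex.log_im, Complex.arg_eq_zero_iff] at b
    simp only [Complex.add_re, Complex.one_re, Complex.add_im, Complex.one_im, add_zero] at a b
    have r0 : u = (u.re : ℂ) := Complex.ext (by simp) (by simp [a.2])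
    have r1 : u' = (u'.re : ℂ) := Complex.ext (by simp) (by simp [b.2])
    have g0 : 1 < u.re := by
      rcases ho with ho | ho
      · exact absurd a.2 ho
      · rcases lt_abs.1 ho with h | h <;> linarith
    have g1 : 1 < u'.re := by
      rcases ho' with ho | ho
      · exact absurd b.2 ho
      · rcases lt_abs.1 ho with h | h <;> linarith
    have n0 : ‖u + 1‖ = u.re + 1 := by
      rw [r0]; norm_cast; simp; linarith
    have n1 : ‖u' + 1‖ = u'.re + 1 := by
      rw [r1]; norm_cast; simp; linarith
    have m0 : ‖u - 1‖ = u.re - 1 := by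
      rw [r0]; norm_cast; simp; linarith
    have m1 : ‖u' - 1‖ = u'.re - 1 := by
      rw [r1]; norm_cast; simp; linarith
    have := logPot_re_lt_of_lt hp hpN ho.sub_ne_zero ho.add_ne_zero
      (u' := u') (by rw [m0, m1]; linarith) h
    linarith
  have nb1 : ¬ (z0.im = Real.pi ∧ z1.im = Real.pi) := by
    rintro ⟨a, b⟩
    rw [hz0, Complex.log_im, Complex.arg_eq_pi_iff] at a
    rw [hz1, Complex.log_im, Complex.arg_eq_pi_iff] at b
    simp only [Complex.add_re, Complex.one_re, Complex.add_im, Complex.one_im, add_zero] at a b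
    have r0 : u = (u.re : ℂ) := Complex.ext (by simp) (by simp [a.2])
    have r1 : u' = (u'.re : ℂ) := Complex.ext (by simp) (by simp [b.2])
    have n0 : ‖u + 1‖ = -(u.re + 1) := by
      rw [r0]; norm_cast; rw [Real.norm_eq_abs, abs_of_neg a.1]
    have n1 : ‖u' + 1‖ = -(u'.re + 1) := by
      rw [r1]; norm_cast; rw [Real.norm_eq_abs, abs_of_neg b.1]
    have m0 : ‖u - 1‖ = -(u.re - 1) := by
      rw [r0]; norm_cast; rw [Real.norm_eq_abs, abs_of_neg (by linarith)]
    have m1 : ‖u' - 1‖ = -(u'.re - 1) := by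
      rw [r1]; norm_cast; rw [Real.norm_eq_abs, abs_of_neg (by linarith)]
    have := logPot_re_lt_of_lt hp hpN ho.sub_ne_zero ho.add_ne_zero
      (u' := u') (by rw [m0, m1]; linarith) h
    linarith
  have him : ∀ t ∈ Set.Ioo (0 : ℝ) 1, 0 < (Complex.exp (z0 + t * (z1 - z0))).im := by
    intro t ht
    rw [Complex.exp_im]
    have e : (z0 + t * (z1 - z0)).im = (1 - t) * z0.im + t * z1.im := by
      rw [Complex.add_im, Complex.im_ofReal_mul, Complex.sub_im]; ring
    have hs : 0 < Real.sin (z0 + t * (z1 - z0)).im := by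
      rw [e]
      have t0 := ht.1
      have t1 : 0 < 1 - t := by linarith [ht.2]
      apply Real.sin_pos_of_pos_of_lt_pi
      · by_contra hcon
        have a1 := mul_nonneg t1.le i0.1
        have a2 := mul_nonneg t0.le i1.1
        have b1 : (1 - t) * z0.im = 0 := by linarith
        have b2 : t * z1.im = 0 := by linarith
        exact nb0 ⟨(mul_eq_zero.1 b1).resolve_left t1.ne', (mul_eq_zero.1 b2).resolve_left t0.ne'⟩
      · by_contra hcon
        have a1 := mul_nonneg t1.le (sub_nonneg.2 i0.2)
        have a2 := mul_nonneg t0.le (sub_nonneg.2 i1.2)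
        have b1 : (1 - t) * (Real.pi - z0.im) = 0 := by nlinarith
        have b2 : t * (Real.pi - z1.im) = 0 := by nlinarith
        have c1 := (mul_eq_zero.1 b1).resolve_left t1.ne'
        have c2 := (mul_eq_zero.1 b2).resolve_left t0.ne'
        exact nb1 ⟨by linarith, by linarith⟩
    positivity
  have hcl : ∀ t ∈ Set.Icc (0 : ℝ) 1, 0 ≤ (Complex.exp (z0 + t * (z1 - z0))).im ∧
      Complex.exp (z0 + t * (z1 - z0)) - 2 ≠ 0 := by
    rintro t ⟨ht0, ht1⟩
    rcases ht0.eq_or_lt with rfl | ht0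
    · simp only [Complex.ofReal_zero, zero_mul, add_zero, e0]
      refine ⟨by simpa using hu, ?_⟩
      have := ho.sub_ne_zero
      convert this using 1; ring
    rcases ht1.eq_or_lt with rfl | ht1
    · simp only [Complex.ofReal_one, one_mul, add_sub_cancel, e1]
      refine ⟨by simpa using hu', ?_⟩
      have := ho'.sub_ne_zero
      convert this using 1; ring
    have := him t ⟨ht0, ht1⟩
    refine ⟨this.le, fun h0 => ?_⟩
    have h2 : Complex.exp (z0 + t * (z1 - z0)) = 2 := by linear_combination h0
    rw [h2] at this
    simp at this
  have key := im_potential_div_lt (N := N) hp hΔ him hcl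
  rw [add_sub_cancel, e0, e1] at key
  have k0 : (p * Complex.log (u + 1 - 2) + ((N : ℂ) - p) * z0) = logPot N p u := by
    rw [logPot]; congr 3; ring
  have k1 : (p * Complex.log (u' + 1 - 2) + ((N : ℂ) - p) * z1) = logPot N p u' := by
    rw [logPot]; congr 3; ring
  rw [k0, k1, ← sub_neg, ← Complex.sub_im, ← sub_div] at key
  -- On a level curve the increment of the potential is `iπ` times the increment of `F`. Dividing it
  -- by `Δ` gives imaginary part `π (F' - F) Re Δ / |Δ|²`, and `Re Δ > 0`, so the sign of `F' - F`
  -- can be read off.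
  have hd : logPot N p u' - logPot N p u
      = ((Real.pi * (labelF N p u' - labelF N p u) : ℝ) : ℂ) * Complex.I := by
    apply Complex.ext
    · simp [hP]
    · simp [logPot_im]; ring
  rw [hd, mul_div_assoc, Complex.im_ofReal_mul, Complex.div_im] at key
  simp only [Complex.I_im, Complex.I_re, one_mul, zero_mul, zero_div, sub_zero] at key
  have hn : 0 < Complex.normSq (z1 - z0) := Complex.normSq_pos.2 hΔ
  by_contra hcon
  push Not at hcon
  have : 0 ≤ Real.pi * (labelF N p u' - labelF N p u) *
      ((z1 - z0).re / Complex.normSq (z1 - z0)) := by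
    have := sub_nonneg.2 hcon
    have := Real.pi_pos
    positivity
  linarith

theorem labelF_mem_of_im_pos {N p : ℕ} (hp : 0 < p) (hpN : p < N) {u : ℂ} (hu : 0 < u.im) :
    0 < labelF N p u ∧ labelF N p u < N := by
  have hp' : (0 : ℝ) < p := by exact_mod_cast hp
  have hq : (0 : ℝ) < N - p := by rw [sub_pos]; exact_mod_cast hpN
  have hpi := Real.pi_pos
  have a : ∀ w : ℂ, 0 < w.im → 0 < w.arg ∧ w.arg < Real.pi := by
    intro w hw
    refine ⟨lt_of_le_of_ne (Complex.arg_nonneg_iff.2 hw.le) fun h => ?_,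
      lt_of_le_of_ne (Complex.arg_le_pi _) fun h => ?_⟩
    · exact hw.ne' (Complex.arg_eq_zero_iff.1 h.symm).2
    · exact hw.ne' (Complex.arg_eq_pi_iff.1 h).2
  obtain ⟨h1, h2⟩ := a (u - 1) (by simpa using hu)
  obtain ⟨h3, h4⟩ := a (u + 1) (by simpa using hu)
  have e : labelF N p u = (p * (u - 1).arg + (N - p) * (u + 1).arg) / Real.pi := by
    rw [labelF]; field_simp
  rw [e]
  constructor
  · positivity
  · rw [div_lt_iff₀ hpi]
    nlinarith

theorem labelF_conj {N p : ℕ} {u : ℂ} (hu : u.im ≠ 0) :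
    labelF N p ((starRingEnd ℂ) u) = - labelF N p u := by
  have a : ∀ w : ℂ, w.im ≠ 0 → ((starRingEnd ℂ) w).arg = - w.arg := by
    intro w hw
    rw [Complex.arg_conj, if_neg]
    intro h
    exact hw (Complex.arg_eq_pi_iff.1 h).2
  have h1 := a (u - 1) (by simpa using hu)
  have h2 := a (u + 1) (by simpa using hu)
  rw [map_sub, map_one] at h1
  rw [map_add, map_one] at h2
  rw [labelF, h1, h2, labelF]
  ring

theorem labelF_mem_of_im_neg {N p : ℕ} (hp : 0 < p) (hpN : p < N) {u : ℂ} (hu : u.im < 0) :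
    -(N : ℝ) < labelF N p u ∧ labelF N p u < 0 := by
  have h := labelF_mem_of_im_pos hp hpN (u := (starRingEnd ℂ) u) (by simpa using hu)
  rw [labelF_conj hu.ne] at h
  constructor <;> linarith [h.1, h.2]

theorem labelF_of_real {N p : ℕ} {u : ℂ} (ho : OffSegment u) (hu : u.im = 0) :
    1 < u.re ∧ labelF N p u = 0 ∨ u.re < -1 ∧ labelF N p u = N := by
  have hpi := Real.pi_pos
  have h : 1 < |u.re| := ho.resolve_left (by simp [hu])
  rcases lt_abs.1 h with h | h
  · refine Or.inl ⟨h, ?_⟩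
    have h1 : (u - 1).arg = 0 := Complex.arg_eq_zero_iff.2 ⟨by simp; linarith, by simp [hu]⟩
    have h2 : (u + 1).arg = 0 := Complex.arg_eq_zero_iff.2 ⟨by simp; linarith, by simp [hu]⟩
    simp [labelF, h1, h2]
  · refine Or.inr ⟨by linarith, ?_⟩
    have h1 : (u - 1).arg = Real.pi := Complex.arg_eq_pi_iff.2 ⟨by simp; linarith, by simp [hu]⟩
    have h2 : (u + 1).arg = Real.pi := Complex.arg_eq_pi_iff.2 ⟨by simp; linarith, by simp [hu]⟩
    rw [labelF, h1, h2]
    field_simp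
    ring

theorem labelF_mem {N p : ℕ} (hp : 0 < p) (hpN : p < N) {u : ℂ} (ho : OffSegment u) :
    -(N : ℝ) < labelF N p u ∧ labelF N p u ≤ N := by
  have hN : (0 : ℝ) < N := by exact_mod_cast hp.trans hpN
  rcases lt_trichotomy u.im 0 with h | h | h
  · have := labelF_mem_of_im_neg hp hpN h
    exact ⟨this.1, by linarith [this.2]⟩
  · rcases labelF_of_real (N := N) (p := p) ho h with ⟨-, h⟩ | ⟨-, h⟩ <;> rw [h] <;> constructor <;> linarith
  · have := labelF_mem_of_im_pos hp hpN h
    exact ⟨by linarith [this.1], this.2.le⟩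

theorem im_neg_iff_labelF_neg {N p : ℕ} (hp : 0 < p) (hpN : p < N) {u : ℂ} (ho : OffSegment u) :
    u.im < 0 ↔ labelF N p u < 0 := by
  refine ⟨fun h => (labelF_mem_of_im_neg hp hpN h).2, fun h => ?_⟩
  rcases lt_trichotomy u.im 0 with h' | h' | h'
  · exact h'
  · have hN : (0 : ℝ) < N := by exact_mod_cast hp.trans hpN
    rcases labelF_of_real (N := N) (p := p) ho h' with ⟨-, h⟩ | ⟨-, h⟩ <;> linarith
  · linarith [(labelF_mem_of_im_pos hp hpN h').1]

/-- Conjugation keeps both moduli and negates `F` off the real axis, so comparisons in terms of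
`|F|` reduce to the closed upper half-plane. -/
theorem exists_upper_reflection {N p : ℕ} (hp : 0 < p) (hpN : p < N) {u : ℂ}
    (ho : OffSegment u) : ∃ v : ℂ, 0 ≤ v.im ∧ OffSegment v ∧ ‖v + 1‖ = ‖u + 1‖ ∧
      (logPot N p v).re = (logPot N p u).re ∧ labelF N p v = |labelF N p u| := by
  by_cases h : u.im < 0
  · have n1 : ‖(starRingEnd ℂ) u + 1‖ = ‖u + 1‖ := by
      rw [← Complex.norm_conj (u + 1)]; simp
    have n2 : ‖(starRingEnd ℂ) u - 1‖ = ‖u - 1‖ := by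
      rw [← Complex.norm_conj (u - 1)]; simp
    refine ⟨(starRingEnd ℂ) u, by simpa using h.le, Or.inl (by simpa using h.ne), n1, ?_, ?_⟩
    · rw [logPot_re, logPot_re, n1, n2]
    · rw [labelF_conj h.ne, abs_of_neg (labelF_mem_of_im_neg hp hpN h).2]
  · refine ⟨u, not_lt.1 h, ho, rfl, rfl, ?_⟩
    rw [abs_of_nonneg]
    exact not_lt.1 fun h' => h ((im_neg_iff_labelF_neg hp hpN ho).2 h')

theorem norm_le_of_abs_labelF_le {N p : ℕ} (hp : 0 < p) (hpN : p < N) {u u' : ℂ}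
    (ho : OffSegment u) (ho' : OffSegment u')
    (hP : (logPot N p u).re = (logPot N p u').re) (h : |labelF N p u| ≤ |labelF N p u'|) :
    ‖u' + 1‖ ≤ ‖u + 1‖ := by
  obtain ⟨v, h1, h2, h3, h4, h5⟩ := exists_upper_reflection hp hpN ho
  obtain ⟨v', h1', h2', h3', h4', h5'⟩ := exists_upper_reflection hp hpN ho'
  by_contra hcon
  push Not at hcon
  have := labelF_lt_of_norm_lt hp hpN h1 h1' h2 h2' (by rw [h4, h4', hP]) (by rw [h3, h3']; exact hcon)
  linarith

theorem norm_sub_eq_of_norm_add_eq {N p : ℕ} (hp : 0 < p) {u u' : ℂ}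
    (ho : u - 1 ≠ 0) (ho' : u' - 1 ≠ 0)
    (hP : (logPot N p u).re = (logPot N p u').re) (h : ‖u + 1‖ = ‖u' + 1‖) :
    ‖u - 1‖ = ‖u' - 1‖ := by
  rw [logPot_re, logPot_re, h] at hP
  have hp' : (p : ℝ) ≠ 0 := by positivity
  have : Real.log ‖u - 1‖ = Real.log ‖u' - 1‖ := mul_left_cancel₀ hp' (by linarith)
  exact Real.log_injOn_pos (Set.mem_Ioi.2 (norm_pos_iff.2 ho)) (Set.mem_Ioi.2 (norm_pos_iff.2 ho')) this

theorem re_eq_of_norms (u : ℂ) : u.re = (‖u + 1‖ ^ 2 - ‖u - 1‖ ^ 2) / 4 := by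
  rw [← Complex.normSq_eq_norm_sq, ← Complex.normSq_eq_norm_sq, Complex.normSq_apply,
    Complex.normSq_apply]
  simp
  ring

theorem im_sq_eq_of_norms (u : ℂ) : u.im ^ 2 = ‖u + 1‖ ^ 2 - (u.re + 1) ^ 2 := by
  rw [← Complex.normSq_eq_norm_sq, Complex.normSq_apply]
  simp
  ring

/-- Monotonicity gives equal distances to `-1`, the level then gives equal distances to `1`, and
these two distances determine a point up to conjugation. The sign of `F` picks the half-plane. -/
theorem eq_of_labelF_eq {N p : ℕ} (hp : 0 < p) (hpN : p < N) {u u' : ℂ}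
    (ho : OffSegment u) (ho' : OffSegment u')
    (hP : (logPot N p u).re = (logPot N p u').re) (h : labelF N p u = labelF N p u') : u = u' := by
  have n1 : ‖u + 1‖ = ‖u' + 1‖ := le_antisymm
    (norm_le_of_abs_labelF_le hp hpN ho' ho hP.symm (by rw [h]))
    (norm_le_of_abs_labelF_le hp hpN ho ho' hP (by rw [h]))
  have n2 := norm_sub_eq_of_norm_add_eq hp ho.sub_ne_zero ho'.sub_ne_zero hP n1
  have r : u.re = u'.re := by rw [re_eq_of_norms u, re_eq_of_norms u', n1, n2]
  have i : u.im ^ 2 = u'.im ^ 2 := by rw [im_sq_eq_of_norms, im_sq_eq_of_norms, n1, r]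
  refine Complex.ext r ?_
  rcases sq_eq_sq_iff_eq_or_eq_neg.1 i with i | i
  · exact i
  · have a := im_neg_iff_labelF_neg hp hpN ho
    have b := im_neg_iff_labelF_neg hp hpN ho'
    rw [h, ← b, i] at a
    rcases lt_trichotomy u'.im 0 with h' | h' | h'
    · have := a.2 h'; linarith
    · rw [i, h']; simp
    · have := a.1 (by linarith); linarith

/-! ### Existence and uniqueness of the labelled roots off the cut -/

/-- The complement of the half-line `[0, ∞)`. -/
def OffCut (C : ℂ) : Prop := ¬ (0 ≤ C.re ∧ C.im = 0)

/-- The argument of `C` in `(0, 2π]`. -/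
def phase (C : ℂ) : ℝ := Complex.arg (-C) + Real.pi

/-- The logarithm of `C` with imaginary part in `(0, 2π]`. -/
def cutLog (C : ℂ) : ℂ := Complex.log (-C) + Real.pi * Complex.I

theorem cutLog_im (C : ℂ) : (cutLog C).im = phase C := by
  simp [cutLog, phase, Complex.log_im]

theorem cutLog_re (C : ℂ) : (cutLog C).re = Real.log ‖C‖ := by
  simp [cutLog, Complex.log_re]

theorem exp_cutLog {C : ℂ} (hC : C ≠ 0) : Complex.exp (cutLog C) = C := by
  rw [cutLog, Complex.exp_add, Complex.exp_log (neg_ne_zero.2 hC), Complex.exp_pi_mul_I]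
  ring

theorem phase_pos (C : ℂ) : 0 < phase C := by
  have := Complex.neg_pi_lt_arg (-C); rw [phase]; linarith

theorem phase_le (C : ℂ) : phase C ≤ 2 * Real.pi := by
  have := Complex.arg_le_pi (-C); rw [phase]; linarith

theorem OffCut.ne_zero {C : ℂ} (h : OffCut C) : C ≠ 0 := by
  rintro rfl; simp [OffCut] at h

theorem OffCut.phase_lt {C : ℂ} (h : OffCut C) : phase C < 2 * Real.pi := by
  refine lt_of_le_of_ne (phase_le C) fun h' => h ?_
  have : Complex.arg (-C) = Real.pi := by rw [phase] at h'; linarith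
  have := Complex.arg_eq_pi_iff.1 this
  simp at this
  exact ⟨this.1.le, this.2⟩

theorem offSegment_of_root {N p : ℕ} {C u : ℂ} (hC : OffCut C)
    (h : (1 - u) ^ p * (1 + u) ^ (N - p) = C) : OffSegment u := by
  by_contra ho
  simp only [OffSegment, not_or, not_not, not_lt] at ho
  apply hC
  have r : u = (u.re : ℂ) := Complex.ext (by simp) (by simp [ho.1])
  have a := abs_le.1 ho.2
  have : C = (((1 - u.re) ^ p * (1 + u.re) ^ (N - p) : ℝ) : ℂ) := by
    rw [← h]; push_cast; rw [← r]
  rw [this, Complex.ofReal_re, Complex.ofReal_im]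
  refine ⟨?_, rfl⟩
  have h1 : 0 ≤ 1 - u.re := by linarith
  have h2 : 0 ≤ 1 + u.re := by linarith
  positivity

/-- The shift by `-p` is the factor `(-1)^p` between `(1 - u)^p` and `(u - 1)^p`. -/
theorem logPot_eq_of_root {N p : ℕ} (hpN : p < N) {C u : ℂ} (hC : C ≠ 0)
    (h1 : u - 1 ≠ 0) (h2 : u + 1 ≠ 0) (h : (1 - u) ^ p * (1 + u) ^ (N - p) = C) :
    ∃ n : ℤ, logPot N p u = cutLog C + (-(p : ℝ) + 2 * n : ℝ) * (Real.pi * Complex.I) := by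
  have e : Complex.exp (logPot N p u + p * (Real.pi * Complex.I)) = Complex.exp (cutLog C) := by
    rw [exp_cutLog hC, Complex.exp_add, exp_logPot hpN.le h1 h2, Complex.exp_nat_mul,
      Complex.exp_pi_mul_I, ← h, mul_comm, ← mul_assoc, ← mul_pow]
    congr 1 <;> ring
  obtain ⟨n, hn⟩ := Complex.exp_eq_exp_iff_exists_int.1 e
  refine ⟨n, ?_⟩
  push_cast
  linear_combination hn

theorem logPot_re_of_root {N p : ℕ} (hpN : p < N) {C u : ℂ} (hC : C ≠ 0)
    (h1 : u - 1 ≠ 0) (h2 : u + 1 ≠ 0) (h : (1 - u) ^ p * (1 + u) ^ (N - p) = C) :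
    (logPot N p u).re = Real.log ‖C‖ := by
  obtain ⟨n, hn⟩ := logPot_eq_of_root hpN hC h1 h2 h
  rw [hn, Complex.add_re, cutLog_re, Complex.re_ofReal_mul]
  simp

theorem labelF_eq_of_root {N p : ℕ} (hpN : p < N) {C u : ℂ} (hC : C ≠ 0)
    (h1 : u - 1 ≠ 0) (h2 : u + 1 ≠ 0) (h : (1 - u) ^ p * (1 + u) ^ (N - p) = C) :
    ∃ n : ℤ, labelF N p u = -(p : ℝ) + 2 * n + phase C / Real.pi := by
  obtain ⟨n, hn⟩ := logPot_eq_of_root hpN hC h1 h2 h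
  refine ⟨n, ?_⟩
  have := congrArg Complex.im hn
  rw [logPot_im, Complex.add_im, cutLog_im, Complex.im_ofReal_mul] at this
  simp at this
  have hpi := Real.pi_pos.ne'
  field_simp
  linarith

/-- The polynomial `(1 - X)^p (1 + X)^(N - p) - C`. -/
def rootPoly (N p : ℕ) (C : ℂ) : Polynomial ℂ :=
  (1 - Polynomial.X) ^ p * (1 + Polynomial.X) ^ (N - p) - Polynomial.C C

theorem rootPoly_eval (N p : ℕ) (C u : ℂ) :
    (rootPoly N p C).eval u = (1 - u) ^ p * (1 + u) ^ (N - p) - C := by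
  simp [rootPoly]

theorem rootPoly_eq (N p : ℕ) (C : ℂ) : rootPoly N p C =
    Polynomial.C ((-1) ^ p) * ((Polynomial.X - Polynomial.C 1) ^ p *
      (Polynomial.X + Polynomial.C 1) ^ (N - p)) - Polynomial.C C := by
  have : (1 - Polynomial.X : Polynomial ℂ) = Polynomial.C (-1) * (Polynomial.X - Polynomial.C 1) := by
    simp
  rw [rootPoly, this, mul_pow, Polynomial.C_pow, mul_assoc, add_comm 1 Polynomial.X, map_one]

theorem rootPoly_degree {N p : ℕ} (hpN : p < N) (C : ℂ) :
    (rootPoly N p C).natDegree = N ∧ (rootPoly N p C).leadingCoeff = (-1) ^ p := by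
  have m : ((Polynomial.X - Polynomial.C (1 : ℂ)) ^ p *
      (Polynomial.X + Polynomial.C 1) ^ (N - p)).Monic :=
    ((Polynomial.monic_X_sub_C 1).pow p).mul ((Polynomial.monic_X_add_C 1).pow _)
  have hd : ((Polynomial.X - Polynomial.C (1 : ℂ)) ^ p *
      (Polynomial.X + Polynomial.C 1) ^ (N - p)).natDegree = N := by
    rw [Polynomial.Monic.natDegree_mul ((Polynomial.monic_X_sub_C 1).pow p)
      ((Polynomial.monic_X_add_C 1).pow _), Polynomial.natDegree_pow, Polynomial.natDegree_pow,
      Polynomial.natDegree_X_sub_C, Polynomial.natDegree_X_add_C]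
    omega
  have h0 : ((-1) ^ p : ℂ) ≠ 0 := pow_ne_zero _ (by norm_num)
  set Q := Polynomial.C ((-1 : ℂ) ^ p) * ((Polynomial.X - Polynomial.C (1 : ℂ)) ^ p *
      (Polynomial.X + Polynomial.C 1) ^ (N - p)) with hQ
  have hQd : Q.natDegree = N := by rw [hQ, Polynomial.natDegree_C_mul h0, hd]
  have hQl : Q.leadingCoeff = (-1) ^ p := by
    rw [hQ, Polynomial.leadingCoeff_mul, m.leadingCoeff, Polynomial.leadingCoeff_C, mul_one]
  have hdeg : (Polynomial.C C).degree < Q.degree := by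
    have : Q ≠ 0 := fun h => by rw [h] at hQl; simp at hQl; exact h0 hQl.symm
    rw [Polynomial.degree_eq_natDegree this, hQd]
    refine lt_of_le_of_lt Polynomial.degree_C_le ?_
    exact_mod_cast (Nat.zero_le p).trans_lt hpN
  rw [rootPoly_eq, ← hQ]
  refine ⟨?_, ?_⟩
  · rw [Polynomial.natDegree_sub_C, hQd]
  · rw [Polynomial.leadingCoeff_sub_of_degree_lt hdeg, hQl]

theorem rootPoly_derivative_eval {N p : ℕ} (hp : 0 < p) (hpN : p < N) (C u : ℂ) :
    (rootPoly N p C).derivative.eval u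
      = (1 - u) ^ (p - 1) * (1 + u) ^ (N - p - 1) * (N - 2 * p - N * u) := by
  obtain ⟨a, rfl⟩ := Nat.exists_eq_succ_of_ne_zero hp.ne'
  obtain ⟨b, rfl⟩ := Nat.exists_eq_add_of_lt hpN
  have : a + 1 + b + 1 - (a + 1) = b + 1 := by omega
  simp only [rootPoly, Nat.succ_eq_add_one, this, add_tsub_cancel_right]
  simp [Polynomial.derivative_mul, Polynomial.derivative_pow]
  ring

/-- All critical points, `±1` and `(N - 2p)/N`, lie in `[-1, 1]`, where the polynomial takes values
in `[0, ∞)`. A multiple root would put `C` on the cut. -/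
theorem rootPoly_nodup {N p : ℕ} (hp : 0 < p) (hpN : p < N) {C : ℂ} (hC : OffCut C) :
    (rootPoly N p C).roots.Nodup := by
  rw [Multiset.nodup_iff_count_le_one]
  intro u
  rw [Polynomial.count_roots]
  by_contra hcon
  push Not at hcon
  have h0 : rootPoly N p C ≠ 0 := fun h => by
    have := (rootPoly_degree hpN C).1
    rw [h] at this; simp at this; omega
  obtain ⟨h1, h2⟩ := (Polynomial.one_lt_rootMultiplicity_iff_isRoot h0).1 hcon
  rw [Polynomial.IsRoot, rootPoly_eval, sub_eq_zero] at h1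
  rw [Polynomial.IsRoot, rootPoly_derivative_eval hp hpN] at h2
  have ho := offSegment_of_root hC h1
  have e1 : 1 - u ≠ 0 := fun h => ho.sub_ne_zero (by linear_combination -h)
  have e2 : 1 + u ≠ 0 := fun h => ho.add_ne_zero (by linear_combination h)
  have e3 : (N - 2 * p - N * u : ℂ) = 0 := by
    rcases mul_eq_zero.1 h2 with h | h
    · exact absurd h (mul_ne_zero (pow_ne_zero _ e1) (pow_ne_zero _ e2))
    · exact h
  have hN : (0 : ℝ) < N := by exact_mod_cast hp.trans hpN
  have hp' : (0 : ℝ) < p := by exact_mod_cast hp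
  have hq : (p : ℝ) < N := by exact_mod_cast hpN
  have hu : u = (((N - 2 * p) / N : ℝ) : ℂ) := by
    have : (N : ℂ) ≠ 0 := by exact_mod_cast hN.ne'
    push_cast; field_simp; linear_combination -e3
  rw [hu, OffSegment, Complex.ofReal_im, Complex.ofReal_re] at ho
  have : |((N - 2 * p) / N : ℝ)| ≤ 1 := by
    rw [abs_le]
    constructor
    · rw [le_div_iff₀ hN]; linarith
    · rw [div_le_iff₀ hN]; linarith
  rcases ho with h | h
  · exact h rfl
  · linarith

/-- Off the cut `phase C / π` lies strictly between `0` and `2`, so membership in an interval of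
length `2` fixes the integer part of the label. -/
theorem isLabelledRoot_iff {N p j : ℕ} {C u : ℂ} (hC : OffCut C)
    {n : ℤ} (hn : labelF N p u = -(p : ℝ) + 2 * n + phase C / Real.pi) :
    IsLabelledRoot N p j C u ↔ (1 - u) ^ p * (1 + u) ^ (N - p) = C ∧
      ∃ m : ℤ, n + N * m = (j : ℤ) - 1 := by
  have hpi := Real.pi_pos
  have f0 : 0 < phase C / Real.pi := div_pos (phase_pos C) hpi
  have f1 : phase C / Real.pi < 2 := by rw [div_lt_iff₀ hpi]; exact hC.phase_lt
  refine and_congr_right fun _ => exists_congr fun m => ?_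
  rw [hn, Set.mem_Ioc]
  constructor
  · rintro ⟨h1, h2⟩
    have a1 : ((j : ℤ) - 1 - 1 : ℤ) < (n + N * m : ℤ) := by
      have : ((j : ℝ) - 1 - 1) < n + N * m := by linarith
      exact_mod_cast this
    have a2 : (n + N * m : ℤ) < (j : ℤ) := by
      have : (n : ℝ) + N * m < j := by linarith
      exact_mod_cast this
    omega
  · intro h
    have : (n : ℝ) + N * m = j - 1 := by exact_mod_cast h
    constructor <;> linarith

theorem card_roots_rootPoly {N p : ℕ} (hpN : p < N) (C : ℂ) :
    Multiset.card (rootPoly N p C).roots = N := by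
  rw [IsAlgClosed.card_roots_eq_natDegree, (rootPoly_degree hpN C).1]

/-- `F` takes values in `(-N, N]`, an interval of length `2N`. Two roots with labels congruent
modulo `2N` therefore have the same `F`, and they lie on the same level curve. -/
theorem labelledRoot_unique {N p j : ℕ} (hp : 0 < p) (hpN : p < N) {C : ℂ} (hC : OffCut C)
    {u u' : ℂ} (h : IsLabelledRoot N p j C u) (h' : IsLabelledRoot N p j C u') : u = u' := by
  have ho := offSegment_of_root hC h.1
  have ho' := offSegment_of_root hC h'.1
  obtain ⟨n, hn⟩ := labelF_eq_of_root hpN hC.ne_zero ho.sub_ne_zero ho.add_ne_zero h.1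
  obtain ⟨n', hn'⟩ := labelF_eq_of_root hpN hC.ne_zero ho'.sub_ne_zero ho'.add_ne_zero h'.1
  obtain ⟨-, m, hm⟩ := (isLabelledRoot_iff hC hn).1 h
  obtain ⟨-, m', hm'⟩ := (isLabelledRoot_iff hC hn').1 h'
  refine eq_of_labelF_eq hp hpN ho ho' ?_ ?_
  · rw [logPot_re_of_root hpN hC.ne_zero ho.sub_ne_zero ho.add_ne_zero h.1,
      logPot_re_of_root hpN hC.ne_zero ho'.sub_ne_zero ho'.add_ne_zero h'.1]
  · have b := labelF_mem hp hpN ho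
    have b' := labelF_mem hp hpN ho'
    rw [hn] at b ⊢
    rw [hn'] at b' ⊢
    have c1 : (n : ℝ) - n' < N := by linarith [b.1, b.2, b'.1, b'.2]
    have c2 : -(N : ℝ) < (n : ℝ) - n' := by linarith [b.1, b.2, b'.1, b'.2]
    have d1 : n - n' < (N : ℤ) := by exact_mod_cast c1
    have d2 : -(N : ℤ) < n - n' := by exact_mod_cast c2
    have e : n - n' = N * (m' - m) := by linarith
    have : n = n' := by
      have : (m' - m) = 0 := by
        rw [e] at d1 d2
        have hN : (0 : ℤ) < N := by exact_mod_cast hp.trans hpN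
        have : m' - m < 1 := by nlinarith
        have : -1 < m' - m := by nlinarith
        omega
      rw [this] at e; linarith
    rw [this]

/-- The polynomial has `N` distinct roots, and the label map from them to the `N` residues modulo
`N` is injective by uniqueness, hence onto. -/
theorem exists_labelledRoot {N p j : ℕ} (hp : 0 < p) (hpN : p < N) {C : ℂ} (hC : OffCut C) :
    ∃ u, IsLabelledRoot N p j C u := by
  classical
  have : NeZero N := ⟨by omega⟩
  set S := (rootPoly N p C).roots.toFinset with hS
  have hcard : S.card = N := by
    rw [hS, Multiset.toFinset_card_of_nodup (rootPoly_nodup hp hpN hC), card_roots_rootPoly hpN]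
  have h0 : rootPoly N p C ≠ 0 := fun h => by
    have := (rootPoly_degree hpN C).1
    rw [h] at this; simp at this; omega
  have hroot : ∀ u ∈ S, (1 - u) ^ p * (1 + u) ^ (N - p) = C := by
    intro u hu
    rw [hS, Multiset.mem_toFinset, Polynomial.mem_roots h0, Polynomial.IsRoot, rootPoly_eval,
      sub_eq_zero] at hu
    exact hu
  have hex : ∀ u : S, ∃ n : ℤ, labelF N p u = -(p : ℝ) + 2 * n + phase C / Real.pi := fun u =>
    have ho := offSegment_of_root hC (hroot u u.2)
    labelF_eq_of_root hpN hC.ne_zero ho.sub_ne_zero ho.add_ne_zero (hroot u u.2)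
  choose n hn using hex
  have hlab : ∀ (u : S) (j : ℕ), ((n u : ℤ) : ZMod N) = (((j : ℤ) - 1 : ℤ) : ZMod N) →
      IsLabelledRoot N p j C u := by
    intro u j hj
    refine (isLabelledRoot_iff hC (hn u)).2 ⟨hroot u u.2, ?_⟩
    rw [ZMod.intCast_eq_intCast_iff_dvd_sub] at hj
    obtain ⟨m, hm⟩ := hj
    exact ⟨m, by linarith⟩
  have hinj : Function.Injective (fun u : S => ((n u : ℤ) : ZMod N)) := by
    intro u u' h
    -- `IsLabelledRoot` takes a natural label `j` standing for the residue `j - 1`, hence the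
    -- representative `n mod N` plus one.
    have e : ((n u : ℤ) : ZMod N) = ((((n u % N).toNat + 1 : ℕ) : ℤ) - 1 : ℤ) := by
      have : ((((n u % N).toNat + 1 : ℕ) : ℤ) - 1 : ℤ) = n u % N := by
        have := Int.emod_nonneg (n u) (b := N) (by exact_mod_cast NeZero.ne N)
        push_cast; omega
      rw [this]
      simp
    exact Subtype.ext (labelledRoot_unique hp hpN hC (hlab u _ e) (hlab u' _ (h.symm.trans e)))
  have hbij := (Fintype.bijective_iff_injective_and_card _).2
    ⟨hinj, by rw [Fintype.card_coe, hcard, ZMod.card]⟩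
  obtain ⟨u, hu⟩ := hbij.2 (((j : ℤ) - 1 : ℤ) : ZMod N)
  exact ⟨u, hlab u j hu⟩

theorem rootOffCut_spec {N p j : ℕ} (hp : 0 < p) (hpN : p < N) {C : ℂ} (hC : OffCut C) :
    IsLabelledRoot N p j C (rootOffCut N p j C) :=
  Classical.epsilon_spec (exists_labelledRoot hp hpN hC)

/-! ### Averaging over the phase of `C` -/

/-- Orthogonality of characters: every monomial of positive degree below `K` sums to zero over a
rotated set of `K`-th roots of unity. -/
theorem sum_eval_rotate {R : Type*} [CommRing R] [Algebra ℂ R] (f : Polynomial R) {K : ℕ}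
    (hf : f.natDegree < K) {ξ : ℂ} (hξ : IsPrimitiveRoot ξ K) (c : ℂ) :
    ∑ i ∈ Finset.range K, f.eval (algebraMap ℂ R (c * ξ ^ i)) = K * f.eval 0 := by
  have hK : 0 < K := (Nat.zero_le _).trans_lt hf
  have h1 : ∀ i, f.eval (algebraMap ℂ R (c * ξ ^ i)) =
      ∑ n ∈ Finset.range K, f.coeff n * algebraMap ℂ R (c ^ n * (ξ ^ n) ^ i) := by
    intro i
    rw [Polynomial.eval_eq_sum_range' hf]
    refine Finset.sum_congr rfl fun n _ => ?_
    rw [← map_pow, mul_pow, ← pow_mul, ← pow_mul, mul_comm i n]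
  simp_rw [h1]
  rw [Finset.sum_comm, Finset.sum_eq_single_of_mem 0 (Finset.mem_range.2 hK)]
  · simp [Polynomial.coeff_zero_eq_eval_zero, mul_comm]
  · intro n hn hn0
    rw [← Finset.mul_sum, ← map_sum, ← Finset.mul_sum]
    have hne : ξ ^ n ≠ 1 := hξ.pow_ne_one_of_pos_of_lt hn0 (Finset.mem_range.1 hn)
    have : ∑ i ∈ Finset.range K, (ξ ^ n) ^ i = 0 := by
      rw [geom_sum_eq hne, ← pow_mul, mul_comm, pow_mul, hξ.pow_eq_one]
      simp
    simp [this]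

theorem prod_le_prod_of_card_eq {ι : Type*} [DecidableEq ι] {S S0 : Finset ι} {a : ι → ℝ}
    (hcard : S.card = S0.card) (ha : ∀ i ∈ S ∪ S0, 0 ≤ a i)
    (h : ∀ i ∈ S0, ∀ j ∈ S \ S0, a j ≤ a i) : ∏ i ∈ S, a i ≤ ∏ i ∈ S0, a i := by
  have hc : (S \ S0).card = (S0 \ S).card := Finset.card_sdiff_comm hcard
  rw [← Finset.prod_inter_mul_prod_sdiff S S0, ← Finset.prod_inter_mul_prod_sdiff S0 S,
    Finset.inter_comm S0 S]
  refine mul_le_mul_of_nonneg_left ?_ (Finset.prod_nonneg fun i hi =>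
    ha i (Finset.mem_union_left _ (Finset.mem_inter.1 hi).1))
  rcases (S \ S0).eq_empty_or_nonempty with he | hne
  · have : S0 \ S = ∅ := by rw [← Finset.card_eq_zero, ← hc, he, Finset.card_empty]
    rw [he, this]
  obtain ⟨j0, hj0, hmax⟩ := Finset.exists_max_image (S \ S0) a hne
  calc ∏ i ∈ S \ S0, a i ≤ ∏ i ∈ S \ S0, a j0 := Finset.prod_le_prod
        (fun i hi => ha i (Finset.mem_union_left _ (Finset.mem_sdiff.1 hi).1)) hmax
    _ = ∏ i ∈ S0 \ S, a j0 := by rw [Finset.prod_const, Finset.prod_const, hc]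
    _ ≤ ∏ i ∈ S0 \ S, a i := Finset.prod_le_prod
        (fun _ _ => ha j0 (Finset.mem_union_left _ (Finset.mem_sdiff.1 hj0).1))
        (fun i hi => h i (Finset.mem_sdiff.1 hi).1 j0 hj0)

/-- Up to sign the coefficient is the `p`-th elementary symmetric function. It has at most `2^N`
terms, each dominated by the product of the `p` largest moduli. -/
theorem norm_coeff_prod_le {N p : ℕ} (hpN : p ≤ N) {a : ℕ → ℂ}
    (h : ∀ i ∈ Finset.Icc 1 p, ∀ j ∈ Finset.Icc (p + 1) N, ‖a j‖ ≤ ‖a i‖) :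
    ‖(∏ j ∈ Finset.Icc 1 N, (Polynomial.C (a j) - Polynomial.X)).coeff (N - p)‖
      ≤ 2 ^ N * ∏ j ∈ Finset.Icc 1 p, ‖a j‖ := by
  classical
  have hN : (Finset.Icc 1 N).card = N := by simp
  simp_rw [sub_eq_add_neg]
  rw [Finset.prod_add, Polynomial.finsetSum_coeff]
  have hterm : ∀ t ∈ (Finset.Icc 1 N).powerset,
      ‖((∏ i ∈ t, Polynomial.C (a i)) * ∏ i ∈ Finset.Icc 1 N \ t, -Polynomial.X : Polynomial ℂ).coeff
        (N - p)‖ ≤ ∏ j ∈ Finset.Icc 1 p, ‖a j‖ := by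
    intro t ht
    rw [Finset.mem_powerset] at ht
    rw [Finset.prod_const, neg_pow, ← map_prod, ← mul_assoc, ← map_one Polynomial.C,
      ← map_neg, ← map_pow, ← Polynomial.C_mul, Polynomial.coeff_C_mul_X_pow,
      Finset.card_sdiff_of_subset ht, hN]
    have hct := Finset.card_le_card ht
    rw [hN] at hct
    split_ifs with hc
    · rw [norm_mul, norm_pow, norm_neg, norm_one, one_pow, mul_one, norm_prod]
      refine prod_le_prod_of_card_eq (by simp; omega) (fun _ _ => norm_nonneg _) ?_
      intro i hi j hj
      refine h i hi j ?_
      rw [Finset.mem_sdiff] at hj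
      have := Finset.mem_Icc.1 (ht hj.1)
      have h2 := hj.2
      simp only [Finset.mem_Icc] at h2 ⊢
      omega
    · rw [norm_zero]
      exact Finset.prod_nonneg fun _ _ => norm_nonneg _
  refine (norm_sum_le _ _).trans ((Finset.sum_le_sum hterm).trans ?_)
  rw [Finset.sum_const, Finset.card_powerset, hN]
  simp

/-- Averaging over the phase of the constant term: some phase has a large `p`-th symmetric
function of the `m`-th powers of the roots. -/
theorem exists_rotation_norm_coeff_ge {N p m : ℕ} (hm : 0 < m) {ξ : ℂ}
    (hξ : IsPrimitiveRoot ξ (m + 1)) (c : ℂ) (v : ℕ → ℕ → ℂ)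
    (hv : ∀ i x, (2 - x) ^ p * x ^ (N - p) - c * ξ ^ i
      = (-1) ^ p * ∏ j ∈ Finset.Icc 1 N, (x - v i j)) :
    ∃ i, (2 : ℝ) ^ (m * p) ≤
      ‖(∏ j ∈ Finset.Icc 1 N, (Polynomial.C (v i j ^ m) - Polynomial.X)).coeff (N - p)‖ := by
  classical
  have : NeZero m := ⟨hm.ne'⟩
  obtain ⟨ω, hω⟩ : ∃ ω : ℂ, IsPrimitiveRoot ω m := ⟨_, Complex.isPrimitiveRoot_exp m hm.ne'⟩
  set E : ℕ → Polynomial ℂ := fun i =>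
    ∏ j ∈ Finset.Icc 1 N, (Polynomial.C (v i j ^ m) - Polynomial.X) with hE
  set Z : ℂ → ℂ := fun x => (2 - x) ^ p * x ^ (N - p) with hZ
  set ν := Polynomial.nthRootsFinset m (1 : ℂ) with hν
  have hνc : ν.card = m := hω.card_nthRootsFinset
  have hpow : ∀ a x : ℂ, ∏ z ∈ ν, (a - z * x) = a ^ m - x ^ m := fun a x =>
    (hω.pow_sub_pow_eq_prod_sub_mul a x hm).symm
  -- By `∏ (a - z x) = a^m - x^m` over the `m`-th roots of unity `z`, the polynomial with roots
  -- `v_j^m` factors into copies of the original polynomial evaluated at the points `z x`.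
  have hEe : ∀ i x, (E i).eval (x ^ m) = ((-1) ^ (N + p)) ^ m * ∏ z ∈ ν, (Z (z * x) - c * ξ ^ i) := by
    intro i x
    simp only [hE, Polynomial.eval_prod, Polynomial.eval_sub, Polynomial.eval_C, Polynomial.eval_X]
    simp_rw [← hpow]
    rw [Finset.prod_comm, ← hνc, ← Finset.prod_const, ← Finset.prod_mul_distrib]
    refine Finset.prod_congr rfl fun z _ => ?_
    rw [hZ, hv i (z * x), pow_add]
    have h1 : ((-1 : ℂ) ^ p) * (-1) ^ p = 1 := by rw [← mul_pow]; simp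
    have h2 : ∏ j ∈ Finset.Icc 1 N, (v i j - z * x)
        = (-1) ^ N * ∏ j ∈ Finset.Icc 1 N, (z * x - v i j) := by
      have : (-1 : ℂ) ^ N = ∏ j ∈ Finset.Icc 1 N, (-1) := by simp
      rw [this, ← Finset.prod_mul_distrib]
      exact Finset.prod_congr rfl fun _ _ => by ring
    rw [h2]
    linear_combination -((-1) ^ N * ∏ j ∈ Finset.Icc 1 N, (z * x - v i j)) * h1
  have hsum : ∀ x, ∑ i ∈ Finset.range (m + 1), (E i).eval (x ^ m)
      = ((-1) ^ (N + p)) ^ m * ((m + 1 : ℕ) *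
        ((2 ^ m - x ^ m) ^ p * ((-1) ^ (m + 1) * x ^ m) ^ (N - p))) := by
    intro x
    simp_rw [hEe]
    rw [← Finset.mul_sum]
    congr 1
    -- As a function of the constant term the product has degree at most `m`, so averaging over `m +
    -- 1` equally spaced phases replaces that term by `0`.
    set f : Polynomial ℂ := ∏ z ∈ ν, (Polynomial.C (Z (z * x)) - Polynomial.X) with hf
    have hfd : f.natDegree < m + 1 := by
      refine Nat.lt_succ_of_le ((Polynomial.natDegree_prod_le _ _).trans ?_)
      refine (Finset.sum_le_card_nsmul _ _ 1 fun z _ => ?_).trans (by simp [hνc])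
      exact (Polynomial.natDegree_sub_le _ _).trans (by simp)
    have hs := sum_eval_rotate f hfd hξ c
    have hfe : ∀ t, f.eval t = ∏ z ∈ ν, (Z (z * x) - t) := fun t => by
      simp [hf, Polynomial.eval_prod]
    simp only [hfe, Algebra.algebraMap_self, RingHom.id_apply, sub_zero] at hs
    rw [hs]
    congr 1
    simp only [hZ]
    rw [Finset.prod_mul_distrib, Finset.prod_pow, Finset.prod_pow, hpow]
    congr 2
    have h0 := hpow 0 x
    simp only [zero_sub, zero_pow hm.ne'] at h0
    rw [Finset.prod_neg, hνc] at h0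
    have h1 : ((-1 : ℂ) ^ m) * (-1) ^ m = 1 := by rw [← mul_pow]; simp
    rw [pow_succ]
    linear_combination (-1) ^ m * h0 - (∏ z ∈ ν, z * x) * h1
  -- The identity is known at points `x^m`, and over `ℂ` every point is of that form.
  have hpoly : ∑ i ∈ Finset.range (m + 1), E i = Polynomial.C ((((-1) ^ (N + p)) ^ m * ((m + 1 : ℕ) : ℂ) *
      ((-1) ^ (m + 1)) ^ (N - p) : ℂ)) *
      ((Polynomial.C (2 ^ m) - Polynomial.X) ^ p * Polynomial.X ^ (N - p)) := by
    apply Polynomial.funext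
    intro y
    obtain ⟨x, rfl⟩ := IsAlgClosed.exists_pow_nat_eq y hm
    rw [Polynomial.eval_finsetSum, hsum]
    simp only [Polynomial.eval_mul, Polynomial.eval_C, Polynomial.eval_pow, Polynomial.eval_sub,
      Polynomial.eval_X]
    ring
  have hcoef := congrArg (fun q => ‖q.coeff (N - p)‖) hpoly
  simp only [Polynomial.finsetSum_coeff, Polynomial.coeff_C_mul] at hcoef
  rw [Polynomial.coeff_mul_X_pow', if_pos le_rfl, Nat.sub_self, Polynomial.coeff_zero_eq_eval_zero]
    at hcoef
  simp only [Polynomial.eval_pow, Polynomial.eval_sub, Polynomial.eval_C, Polynomial.eval_X,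
    sub_zero, norm_mul, norm_pow, norm_neg, norm_one, one_pow, one_mul, mul_one, Complex.norm_natCast,
    Complex.norm_ofNat] at hcoef
  -- The `m + 1` coefficients have a sum of modulus `(m + 1) 2^{mp}`, so they cannot all be smaller
  -- than `2^{mp}`.
  by_contra hcon
  push Not at hcon
  have hlt : ∑ i ∈ Finset.range (m + 1), ‖(E i).coeff (N - p)‖
      < ∑ i ∈ Finset.range (m + 1), (2 : ℝ) ^ (m * p) :=
    Finset.sum_lt_sum_of_nonempty ⟨0, by simp⟩ fun i _ => hcon i
  rw [Finset.sum_const, Finset.card_range, nsmul_eq_mul, pow_mul, ← hcoef] at hlt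
  exact absurd (norm_sum_le _ _) (not_le.2 hlt)

/-! ### Ordering of the roots by label -/

theorem rootOffCut_offSegment {N p : ℕ} (j : ℕ) (hp : 0 < p) (hpN : p < N) {C : ℂ}
    (hC : OffCut C) : OffSegment (rootOffCut N p j C) :=
  offSegment_of_root hC (rootOffCut_spec hp hpN hC).1

theorem labelF_rootOffCut {N p j : ℕ} (hp : 0 < p) (hpN : p < N) {C : ℂ} (hC : OffCut C) :
    ∃ m : ℤ, labelF N p (rootOffCut N p j C)
      = -(p : ℝ) + 2 * ((j : ℝ) - 1) + phase C / Real.pi - 2 * N * m := by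
  have h := rootOffCut_spec (j := j) hp hpN hC
  have ho := offSegment_of_root hC h.1
  obtain ⟨n, hn⟩ := labelF_eq_of_root hpN hC.ne_zero ho.sub_ne_zero ho.add_ne_zero h.1
  obtain ⟨-, m, hm⟩ := (isLabelledRoot_iff hC hn).1 h
  refine ⟨m, ?_⟩
  have : (n : ℝ) + N * m = j - 1 := by exact_mod_cast hm
  rw [hn]; linarith

theorem labelF_rootOffCut_of_mem {N p j : ℕ} (hp : 0 < p) (hpN : p < N) {C : ℂ} (hC : OffCut C)
    (m : ℤ) (h1 : -(N : ℝ) < -(p : ℝ) + 2 * ((j : ℝ) - 1) + phase C / Real.pi - 2 * N * m)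
    (h2 : -(p : ℝ) + 2 * ((j : ℝ) - 1) + phase C / Real.pi - 2 * N * m ≤ N) :
    labelF N p (rootOffCut N p j C)
      = -(p : ℝ) + 2 * ((j : ℝ) - 1) + phase C / Real.pi - 2 * N * m := by
  obtain ⟨m', hm'⟩ := labelF_rootOffCut (j := j) hp hpN hC
  have h := labelF_mem hp hpN (rootOffCut_offSegment j hp hpN hC)
  rw [hm'] at h ⊢
  have hN : (0 : ℝ) < N := by exact_mod_cast hp.trans hpN
  have : m' = m := by
    have a1 : (m' : ℝ) - m < 1 := by nlinarith [h.1, h.2]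
    have a2 : -1 < (m' : ℝ) - m := by nlinarith [h.1, h.2]
    have b1 : m' - m < 1 := by exact_mod_cast a1
    have b2 : -1 < m' - m := by exact_mod_cast a2
    omega
  rw [this]

theorem phase_div_pi_pos (C : ℂ) : 0 < phase C / Real.pi := div_pos (phase_pos C) Real.pi_pos

theorem OffCut.phase_div_pi_lt {C : ℂ} (hC : OffCut C) : phase C / Real.pi < 2 := by
  rw [div_lt_iff₀ Real.pi_pos]; exact hC.phase_lt

theorem labelF_rootOffCut_of_le {N p j : ℕ} (hp : 0 < p) (hpN : p < N) {C : ℂ} (hC : OffCut C)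
    (h1 : 1 ≤ j) (hj : j ≤ p) : labelF N p (rootOffCut N p j C)
      = -(p : ℝ) + 2 * ((j : ℝ) - 1) + phase C / Real.pi := by
  have f0 := phase_div_pi_pos C
  have f1 := hC.phase_div_pi_lt
  have a1 : (1 : ℝ) ≤ j := by exact_mod_cast h1
  have a2 : (j : ℝ) ≤ p := by exact_mod_cast hj
  have a3 : (p : ℝ) < N := by exact_mod_cast hpN
  have := labelF_rootOffCut_of_mem (j := j) hp hpN hC 0 (by push_cast; linarith)
    (by push_cast; linarith)
  rw [this]; push_cast; ring

theorem abs_labelF_rootOffCut_lt {N p j : ℕ} (hp : 0 < p) (hpN : p < N) {C : ℂ} (hC : OffCut C)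
    (h1 : 1 ≤ j) (hj : j ≤ p) : |labelF N p (rootOffCut N p j C)| < p := by
  have f0 := phase_div_pi_pos C
  have f1 := hC.phase_div_pi_lt
  have a1 : (1 : ℝ) ≤ j := by exact_mod_cast h1
  have a2 : (j : ℝ) ≤ p := by exact_mod_cast hj
  rw [labelF_rootOffCut_of_le hp hpN hC h1 hj, abs_lt]
  constructor <;> linarith

/-- Together with the bound `|F| < p` for `j ≤ p`, this says that the first `p` labels are the `p`
smallest in `|F|`, hence the `p` largest in `‖1 + u‖`. -/
theorem lt_abs_labelF_rootOffCut {N p j : ℕ} (hp : 0 < p) (hpN : p < N) {C : ℂ} (hC : OffCut C)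
    (h1 : p < j) (hj : j ≤ N) : p < |labelF N p (rootOffCut N p j C)| := by
  have f0 := phase_div_pi_pos C
  have f1 := hC.phase_div_pi_lt
  have a1 : (p : ℝ) + 1 ≤ j := by exact_mod_cast h1
  have a2 : (j : ℝ) ≤ N := by exact_mod_cast hj
  have a3 : (p : ℝ) < N := by exact_mod_cast hpN
  by_cases h : -(p : ℝ) + 2 * ((j : ℝ) - 1) + phase C / Real.pi ≤ N
  · have := labelF_rootOffCut_of_mem (j := j) hp hpN hC 0 (by push_cast; linarith)
      (by push_cast; linarith)
    rw [this, lt_abs]; left; push_cast; linarith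
  · have := labelF_rootOffCut_of_mem (j := j) hp hpN hC 1 (by push_cast; linarith)
      (by push_cast; linarith)
    rw [this, lt_abs]; right; push_cast; linarith

theorem logPot_re_rootOffCut {N p : ℕ} (j : ℕ) (hp : 0 < p) (hpN : p < N) {C : ℂ} (hC : OffCut C) :
    (logPot N p (rootOffCut N p j C)).re = Real.log ‖C‖ :=
  have ho := rootOffCut_offSegment j hp hpN hC
  logPot_re_of_root hpN hC.ne_zero ho.sub_ne_zero ho.add_ne_zero (rootOffCut_spec hp hpN hC).1

/-- For equal `‖C‖`, the moduli `‖1 + u_j(C)‖` are ordered by `|F(u_j(C))|`. -/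
theorem norm_rootOffCut_le {N p i j : ℕ} (hp : 0 < p) (hpN : p < N) {C C' : ℂ} (hC : OffCut C)
    (hC' : OffCut C') (hn : ‖C‖ = ‖C'‖)
    (h : |labelF N p (rootOffCut N p i C)| ≤ |labelF N p (rootOffCut N p j C')|) :
    ‖1 + rootOffCut N p j C'‖ ≤ ‖1 + rootOffCut N p i C‖ := by
  rw [add_comm 1, add_comm 1]
  exact norm_le_of_abs_labelF_le hp hpN (rootOffCut_offSegment i hp hpN hC)
    (rootOffCut_offSegment j hp hpN hC')
    (by rw [logPot_re_rootOffCut i hp hpN hC, logPot_re_rootOffCut j hp hpN hC', hn]) h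

theorem rootOffCut_injOn {N p : ℕ} (hp : 0 < p) (hpN : p < N) {C : ℂ} (hC : OffCut C) :
    Set.InjOn (fun j => rootOffCut N p j C) (Finset.Icc 1 N) := by
  intro i hi j hj h
  obtain ⟨m, hm⟩ := labelF_rootOffCut (j := i) hp hpN hC
  obtain ⟨m', hm'⟩ := labelF_rootOffCut (j := j) hp hpN hC
  simp only at h
  rw [h, hm'] at hm
  have e : (j : ℝ) - i = N * (m' - m) := by linarith
  have e' : (j : ℤ) - i = N * (m' - m) := by exact_mod_cast e
  simp only [Finset.coe_Icc, Set.mem_Icc] at hi hj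
  have : m' - m = 0 := by
    have hN : (0 : ℤ) < N := by exact_mod_cast hp.trans hpN
    have : m' - m < 1 := by nlinarith
    have : -1 < m' - m := by nlinarith
    omega
  rw [this] at e'
  omega

theorem rootPoly_eq_prod {N p : ℕ} (hp : 0 < p) (hpN : p < N) {C : ℂ} (hC : OffCut C) (x : ℂ) :
    (1 - x) ^ p * (1 + x) ^ (N - p) - C
      = (-1) ^ p * ∏ j ∈ Finset.Icc 1 N, (x - rootOffCut N p j C) := by
  classical
  have h0 : rootPoly N p C ≠ 0 := fun h => by
    have := (rootPoly_degree hpN C).1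
    rw [h] at this; simp at this; omega
  have hval : Multiset.map (fun j => rootOffCut N p j C) (Finset.Icc 1 N).val
      = (rootPoly N p C).roots := by
    refine Multiset.eq_of_le_of_card_le ?_ ?_
    · rw [Multiset.le_iff_subset]
      · intro u hu
        obtain ⟨j, -, rfl⟩ := Multiset.mem_map.1 hu
        rw [Polynomial.mem_roots h0, Polynomial.IsRoot, rootPoly_eval,
          (rootOffCut_spec hp hpN hC).1, sub_self]
      · exact Multiset.Nodup.map_on (fun i hi j hj h => rootOffCut_injOn hp hpN hC
          (by exact_mod_cast hi) (by exact_mod_cast hj) h) (Finset.Icc 1 N).nodup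
    · rw [card_roots_rootPoly hpN, Multiset.card_map]
      simp
  have hfac := (IsAlgClosed.splits (rootPoly N p C)).eq_prod_roots
  rw [(rootPoly_degree hpN C).2, ← hval, Multiset.map_map] at hfac
  have := congrArg (Polynomial.eval x) hfac
  rw [rootPoly_eval] at this
  rw [this, Polynomial.eval_mul, Polynomial.eval_C]
  congr 1
  change Polynomial.eval x (∏ j ∈ Finset.Icc 1 N, _) = _
  rw [Polynomial.eval_prod]
  simp

/-- On every circle there is a point off the cut where the product of the `‖1 + u_j‖`, `j ≤ p`, is
almost at least `2 ^ p`. -/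
theorem exists_prod_norm_ge {N p m : ℕ} (hp : 0 < p) (hpN : p < N) (hm : 0 < m) {R : ℝ}
    (hR : 0 < R) : ∃ C : ℂ, OffCut C ∧ ‖C‖ = R ∧ (2 : ℝ) ^ (m * p) ≤
      2 ^ N * (∏ j ∈ Finset.Icc 1 p, ‖1 + rootOffCut N p j C‖) ^ m := by
  set ξ := Complex.exp (2 * Real.pi * Complex.I / (m + 1 : ℕ)) with hξdef
  have hξ : IsPrimitiveRoot ξ (m + 1) := Complex.isPrimitiveRoot_exp _ (by omega)
  -- `α^(m+1) = -1`, so every rotated point has negative `(m+1)`-th power and none of them falls on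
  -- the cut.
  set α := Complex.exp (Real.pi * Complex.I / (m + 1 : ℕ)) with hα
  set c : ℂ := R * α
  have hm1 : ((m + 1 : ℕ) : ℂ) ≠ 0 := by exact_mod_cast (by omega : m + 1 ≠ 0)
  have hαpow : α ^ (m + 1) = -1 := by
    rw [hα, ← Complex.exp_nat_mul, mul_div_cancel₀ _ hm1, Complex.exp_pi_mul_I]
  have hnorm : ∀ i : ℕ, ‖c * ξ ^ i‖ = R := by
    intro i
    have : ‖α‖ = 1 := by
      have := congrArg norm hαpow
      rw [norm_pow, norm_neg, norm_one] at this
      exact (pow_eq_one_iff_of_nonneg (norm_nonneg _) (by omega)).1 this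
    rw [norm_mul, norm_pow, hξ.norm'_eq_one (by omega), one_pow, mul_one, norm_mul, this, mul_one,
      Complex.norm_real, Real.norm_of_nonneg hR.le]
  have hoff : ∀ i : ℕ, OffCut (c * ξ ^ i) := by
    rintro i ⟨h1, h2⟩
    have hreal : c * ξ ^ i = (R : ℂ) := by
      have e : c * ξ ^ i = (((c * ξ ^ i).re : ℝ) : ℂ) := Complex.ext (by simp) (by simp [h2])
      have := hnorm i
      rw [e, Complex.norm_real, Real.norm_of_nonneg h1] at this
      rw [e, this]
    have : (c * ξ ^ i) ^ (m + 1) = -(R : ℂ) ^ (m + 1) := by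
      rw [mul_pow, mul_pow, hαpow, ← pow_mul, mul_comm i, pow_mul, hξ.pow_eq_one]; simp
    rw [hreal] at this
    have h3 : ((R : ℂ) ^ (m + 1)) ≠ 0 := pow_ne_zero _ (by exact_mod_cast hR.ne')
    have h4 : (2 : ℂ) * (R : ℂ) ^ (m + 1) = 0 := by linear_combination this
    exact h3 ((mul_eq_zero.1 h4).resolve_left two_ne_zero)
  obtain ⟨i, hi⟩ := exists_rotation_norm_coeff_ge hm hξ c
    (fun i j => 1 + rootOffCut N p j (c * ξ ^ i)) (by
      intro i x
      have := rootPoly_eq_prod hp hpN (hoff i) (x - 1)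
      rw [← sub_eq_zero] at this ⊢
      rw [← this]
      have e : ∀ j, x - 1 - rootOffCut N p j (c * ξ ^ i)
          = x - (1 + rootOffCut N p j (c * ξ ^ i)) := fun j => by ring
      simp_rw [e]
      ring)
  refine ⟨c * ξ ^ i, hoff i, hnorm i, hi.trans ?_⟩
  rw [← Finset.prod_pow]
  simp_rw [← norm_pow]
  refine norm_coeff_prod_le hpN.le ?_
  intro k hk j hj
  rw [Finset.mem_Icc] at hk hj
  rw [norm_pow, norm_pow]
  refine pow_le_pow_left₀ (norm_nonneg _) ?_ m
  refine norm_rootOffCut_le hp hpN (hoff i) (hoff i) rfl ?_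
  exact (abs_labelF_rootOffCut_lt hp hpN (hoff i) hk.1 hk.2).le.trans
    (lt_abs_labelF_rootOffCut hp hpN (hoff i) (by omega) hj.2).le

/-! ### Products over interlaced sequences -/

/-- To the right of the sign change `b j` is compared with `a j`, to the left with `a (j + 1)`. One
term of `b` and the term `a 0` stay unmatched; their ratio is at most `hi / lo`. -/
theorem prod_le_of_interlaced_of_le {p : ℕ} {x x' lo hi : ℝ} (h0 : x ≤ x') (h2 : x' < x + 2)
    {a b : ℕ → ℝ} (hlo : 0 < lo) (hlohi : lo ≤ hi) (ha : ∀ j < p, lo ≤ a j)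
    (hb0 : ∀ j < p, 0 ≤ b j) (hb : ∀ j < p, b j ≤ hi)
    (h : ∀ i < p, ∀ j < p, |x + 2 * i| ≤ |x' + 2 * j| → b j ≤ a i) :
    ∏ j ∈ Finset.range p, b j ≤ hi / lo * ∏ j ∈ Finset.range p, a j := by
  have hpos : ∀ j < p, 0 < a j := fun j hj => hlo.trans_le (ha j hj)
  have h1 : 1 ≤ hi / lo := (one_le_div hlo).2 hlohi
  obtain ⟨q, hqp, hqneg, hqpos⟩ : ∃ q ≤ p, (∀ j : ℕ, j < q → x + 2 * j < 0) ∧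
      ∀ j : ℕ, q ≤ j → j < p → 0 ≤ x + 2 * j := by
    refine ⟨min ⌈-x / 2⌉₊ p, min_le_right _ _, fun j hj => ?_, fun j hj hjp => ?_⟩
    · have := Nat.lt_ceil.1 (lt_of_lt_of_le hj (min_le_left _ _))
      linarith
    · have : ⌈-x / 2⌉₊ ≤ j := by
        rcases min_le_iff.1 hj with h | h
        · exact h
        · omega
      have := Nat.ceil_le.1 this
      linarith
  have hright : ∀ j, q ≤ j → j < p → b j ≤ a j := by
    intro j hj hjp
    have := hqpos j hj hjp
    refine h j hjp j hjp ?_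
    rw [abs_of_nonneg this, abs_of_nonneg (by linarith)]
    linarith
  rcases Nat.eq_zero_or_pos q with rfl | hq
  · calc ∏ j ∈ Finset.range p, b j ≤ ∏ j ∈ Finset.range p, a j :=
          Finset.prod_le_prod (fun j hj => hb0 j (Finset.mem_range.1 hj))
            fun j hj => hright j (Nat.zero_le _) (Finset.mem_range.1 hj)
      _ ≤ _ := le_mul_of_one_le_left
          (Finset.prod_nonneg fun j hj => (hpos j (Finset.mem_range.1 hj)).le) h1
  obtain ⟨r, rfl⟩ := Nat.exists_eq_succ_of_ne_zero hq.ne'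
  simp only [Nat.succ_eq_add_one] at *
  rw [← Finset.prod_range_mul_prod_Ico b hqp, ← Finset.prod_range_mul_prod_Ico a hqp,
    Finset.prod_range_succ, Finset.prod_range_succ']
  have hleft : ∏ j ∈ Finset.range r, b j ≤ ∏ j ∈ Finset.range r, a (j + 1) := by
    refine Finset.prod_le_prod (fun j hj => hb0 j ?_) fun j hj => ?_
    · have := Finset.mem_range.1 hj; omega
    · have hj := Finset.mem_range.1 hj
      have hneg := hqneg (j + 1) (by omega)
      push_cast at hneg
      refine h (j + 1) (by omega) j (by omega) ?_
      push_cast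
      rw [abs_of_neg hneg, abs_of_neg (by linarith)]
      linarith
  have hI : ∏ j ∈ Finset.Ico (r + 1) p, b j ≤ ∏ j ∈ Finset.Ico (r + 1) p, a j := by
    refine Finset.prod_le_prod (fun j hj => hb0 j (Finset.mem_Ico.1 hj).2) fun j hj => ?_
    exact hright j (Finset.mem_Ico.1 hj).1 (Finset.mem_Ico.1 hj).2
  have hbr : b r ≤ hi / lo * a 0 := by
    have := ha 0 (by omega)
    calc b r ≤ hi := hb r (by omega)
      _ = hi / lo * lo := by field_simp
      _ ≤ hi / lo * a 0 := mul_le_mul_of_nonneg_left this (by linarith)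
  have n1 : 0 ≤ ∏ j ∈ Finset.range r, a (j + 1) := Finset.prod_nonneg fun j hj =>
    (hpos (j + 1) (by have := Finset.mem_range.1 hj; omega)).le
  have n2 : 0 ≤ ∏ j ∈ Finset.Ico (r + 1) p, b j := Finset.prod_nonneg fun j hj =>
    hb0 j (Finset.mem_Ico.1 hj).2
  have n3 : 0 ≤ hi / lo * a 0 := mul_nonneg (by linarith) (hpos 0 (by omega)).le
  calc (∏ j ∈ Finset.range r, b j) * b r * ∏ j ∈ Finset.Ico (r + 1) p, b j
      ≤ (∏ j ∈ Finset.range r, a (j + 1)) * (hi / lo * a 0) * ∏ j ∈ Finset.Ico (r + 1) p, a j :=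
        mul_le_mul (mul_le_mul hleft hbr (hb0 r (by omega)) n1) hI n2 (mul_nonneg n1 n3)
    _ = _ := by ring

/-- Two interlaced sequences that decrease with the distance to the origin have comparable
products. -/
theorem prod_le_of_interlaced {p : ℕ} {x x' lo hi : ℝ} (hx : |x - x'| < 2)
    {a b : ℕ → ℝ} (hlo : 0 < lo) (hlohi : lo ≤ hi) (ha : ∀ j < p, lo ≤ a j)
    (hb0 : ∀ j < p, 0 ≤ b j) (hb : ∀ j < p, b j ≤ hi)
    (h : ∀ i < p, ∀ j < p, |x + 2 * i| ≤ |x' + 2 * j| → b j ≤ a i) :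
    ∏ j ∈ Finset.range p, b j ≤ hi / lo * ∏ j ∈ Finset.range p, a j := by
  obtain ⟨l1, l2⟩ := abs_lt.1 hx
  rcases le_total x x' with h0 | h0
  · exact prod_le_of_interlaced_of_le h0 (by linarith) hlo hlohi ha hb0 hb h
  -- Reflecting the indices and the sign of the positions exchanges the two orders of `x` and `x'`.
  · rw [← Finset.prod_range_reflect b, ← Finset.prod_range_reflect a]
    refine prod_le_of_interlaced_of_le (x := -(x + 2 * (p - 1))) (x' := -(x' + 2 * (p - 1)))
      (by linarith) (by linarith) hlo hlohi (fun j hj => ha _ (by omega))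
      (fun j hj => hb0 _ (by omega)) (fun j hj => hb _ (by omega)) fun i hi j hj hij => ?_
    refine h _ (by omega) _ (by omega) ?_
    have e : ∀ i < p, ((p - 1 - i : ℕ) : ℝ) = p - 1 - i := by
      intro i hi
      rw [Nat.cast_sub (by omega), Nat.cast_sub (by omega)]; simp
    rw [e i hi, e j hj, ← abs_neg (x + _), ← abs_neg (x' + _)]
    convert hij using 2 <;> ring

/-! ### Distances to `±1` and the uniform lower bound for the product -/

theorem angle_le_of_sin_le {A B η : ℝ} (hA : 0 ≤ A) (hB : 0 ≤ B) (hB2 : B ≤ Real.pi / 2)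
    (hη : 0 ≤ η) (h : Real.sin B ≤ η * Real.sin A) : B ≤ Real.pi / 2 * η * A := by
  have h1 := Real.mul_le_sin hB hB2
  have h2 := Real.sin_le hA
  have hpi := Real.pi_pos
  have h3 : 2 / Real.pi * B ≤ η * A := h1.trans (h.trans (mul_le_mul_of_nonneg_left h2 hη))
  calc B = Real.pi / 2 * (2 / Real.pi * B) := by field_simp
    _ ≤ Real.pi / 2 * (η * A) := mul_le_mul_of_nonneg_left h3 (by positivity)
    _ = _ := by ring

theorem norm_add_sq_sub_norm_sub_sq (u : ℂ) : ‖u + 1‖ ^ 2 - ‖u - 1‖ ^ 2 = 4 * u.re := by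
  rw [re_eq_of_norms u]; ring

/-- The law of sines in the triangle with vertices `-1`, `1`, `u`. -/
theorem angles_of_im_pos {u : ℂ} (hu : 0 < u.im) :
    0 < (u + 1).arg ∧ 0 < Real.pi - (u - 1).arg ∧
      Real.sin (u + 1).arg * ‖u + 1‖ = Real.sin (Real.pi - (u - 1).arg) * ‖u - 1‖ := by
  have h1 : (0 : ℝ) < (u + 1).im := by simpa using hu
  have h2 : (0 : ℝ) < (u - 1).im := by simpa using hu
  have n1 : ‖u + 1‖ ≠ 0 := fun h => by rw [norm_eq_zero.1 h] at h1; simp at h1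
  have n2 : ‖u - 1‖ ≠ 0 := fun h => by rw [norm_eq_zero.1 h] at h2; simp at h2
  refine ⟨lt_of_le_of_ne (Complex.arg_nonneg_iff.2 h1.le) fun h => ?_, sub_pos.2
      (lt_of_le_of_ne (Complex.arg_le_pi _) fun h => ?_), ?_⟩
  · exact h1.ne' (Complex.arg_eq_zero_iff.1 h.symm).2
  · exact h2.ne' (Complex.arg_eq_pi_iff.1 h).2
  · rw [Real.sin_pi_sub, Complex.sin_arg, Complex.sin_arg, div_mul_cancel₀ _ n1,
      div_mul_cancel₀ _ n2]
    simp

theorem pi_mul_labelF (N p : ℕ) (u : ℂ) :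
    Real.pi * labelF N p u = p * (u - 1).arg + (N - p) * (u + 1).arg := by
  have := Real.pi_pos.ne'
  rw [labelF]; field_simp

/-- Let `A` and `B` be the angles at `-1` and `1` of the triangle with third vertex `u`. In the
upper half-plane `F < p` means `(N - p) A < p B`. If `‖u + 1‖` were much smaller than `‖u - 1‖`, the
law of sines would make `B` small compared with `A`. The `2` in the denominator leaves the factor
`π/4 < 1` after Jordan's inequality. -/
theorem norm_add_gt_of_abs_labelF_lt {N p : ℕ} (hp : 0 < p) (hpN : p < N) {u : ℂ}
    (ho : OffSegment u) (h : |labelF N p u| < p) :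
    ((N : ℝ) - p) / (2 * N) * ‖u - 1‖ < ‖u + 1‖ := by
  obtain ⟨v, hv, hov, n1, hP, hF⟩ := exists_upper_reflection hp hpN ho
  have n2 := norm_sub_eq_of_norm_add_eq hp hov.sub_ne_zero ho.sub_ne_zero hP n1
  rw [← n1, ← n2]
  rw [← hF] at h
  have hp' : (0 : ℝ) < p := by exact_mod_cast hp
  have hq : (p : ℝ) < N := by exact_mod_cast hpN
  have hN : (0 : ℝ) < N := by linarith
  set η := ((N : ℝ) - p) / (2 * N) with hη
  have hη0 : 0 < η := div_pos (by linarith) (by linarith)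
  have hη1 : η < 1 := by rw [hη, div_lt_one (by linarith)]; linarith
  by_contra hcon
  push Not at hcon
  have hpos : 0 < ‖v - 1‖ := norm_pos_iff.2 hov.sub_ne_zero
  have hlt : ‖v + 1‖ < ‖v - 1‖ := hcon.trans_lt (mul_lt_of_lt_one_left hpos hη1)
  have hre : v.re < 0 := by
    have := norm_add_sq_sub_norm_sub_sq v
    nlinarith [norm_nonneg (v + 1)]
  rcases hv.eq_or_lt with h0 | h0
  · rcases labelF_of_real (N := N) (p := p) hov h0.symm with ⟨h1, -⟩ | ⟨-, h1⟩ <;> linarith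
  obtain ⟨hA, hB, hs⟩ := angles_of_im_pos h0
  have hB2 : Real.pi - (v - 1).arg ≤ Real.pi / 2 := by
    by_contra h2
    push Not at h2
    have : |(v - 1).arg| ≤ Real.pi / 2 := by
      rw [abs_of_nonneg (Complex.arg_nonneg_iff.2 (by simpa using hv))]; linarith
    have := Complex.abs_arg_le_pi_div_two_iff.1 this
    simp at this; linarith
  have hsA : 0 ≤ Real.sin (v + 1).arg := by
    rw [Complex.sin_arg]; exact div_nonneg (by simpa using hv) (norm_nonneg _)
  have hsin : Real.sin (Real.pi - (v - 1).arg) ≤ η * Real.sin (v + 1).arg := by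
    refine le_of_mul_le_mul_right ?_ hpos
    rw [← hs]
    nlinarith
  have := angle_le_of_sin_le hA.le hB.le hB2 hη0.le hsin
  have hpi := Real.pi_pos
  have hpi4 := Real.pi_lt_four
  have e := pi_mul_labelF N p v
  have key : p * (Real.pi - (v - 1).arg) < (N - p) * (v + 1).arg := by
    calc p * (Real.pi - (v - 1).arg) ≤ p * (Real.pi / 2 * η * (v + 1).arg) :=
          mul_le_mul_of_nonneg_left this hp'.le
      _ = (Real.pi / 4 * (p / N)) * ((N - p) * (v + 1).arg) := by rw [hη]; field_simp; ring
      _ < 1 * ((N - p) * (v + 1).arg) := by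
          refine mul_lt_mul_of_pos_right ?_ (mul_pos (by linarith) hA)
          have : (p : ℝ) / N < 1 := (div_lt_one hN).2 hq
          have : 0 < (p : ℝ) / N := by positivity
          nlinarith
      _ = _ := one_mul _
  nlinarith

/-- The mirror image of the preceding estimate, with the two vertices and the weights `p` and `N -
p` exchanged. -/
theorem norm_sub_gt_of_lt_abs_labelF {N p : ℕ} (hp : 0 < p) (hpN : p < N) {u : ℂ}
    (ho : OffSegment u) (h : p < |labelF N p u|) :
    (p : ℝ) / (2 * N) * ‖u + 1‖ < ‖u - 1‖ := by
  obtain ⟨v, hv, hov, n1, hP, hF⟩ := exists_upper_reflection hp hpN ho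
  have n2 := norm_sub_eq_of_norm_add_eq hp hov.sub_ne_zero ho.sub_ne_zero hP n1
  rw [← n1, ← n2]
  rw [← hF] at h
  have hp' : (0 : ℝ) < p := by exact_mod_cast hp
  have hq : (p : ℝ) < N := by exact_mod_cast hpN
  have hN : (0 : ℝ) < N := by linarith
  set η := (p : ℝ) / (2 * N) with hη
  have hη0 : 0 < η := div_pos (by linarith) (by linarith)
  have hη1 : η < 1 := by rw [hη, div_lt_one (by linarith)]; linarith
  by_contra hcon
  push Not at hcon
  have hpos : 0 < ‖v + 1‖ := norm_pos_iff.2 hov.add_ne_zero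
  have hlt : ‖v - 1‖ < ‖v + 1‖ := hcon.trans_lt (mul_lt_of_lt_one_left hpos hη1)
  have hre : 0 < v.re := by
    have := norm_add_sq_sub_norm_sub_sq v
    nlinarith [norm_nonneg (v - 1)]
  rcases hv.eq_or_lt with h0 | h0
  · rcases labelF_of_real (N := N) (p := p) hov h0.symm with ⟨-, h1⟩ | ⟨h1, -⟩ <;> linarith
  obtain ⟨hA, hB, hs⟩ := angles_of_im_pos h0
  have hA2 : (v + 1).arg ≤ Real.pi / 2 := by
    have : |(v + 1).arg| ≤ Real.pi / 2 :=
      Complex.abs_arg_le_pi_div_two_iff.2 (by simp; linarith)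
    rwa [abs_of_nonneg (Complex.arg_nonneg_iff.2 (by simpa using hv))] at this
  have hsB : 0 ≤ Real.sin (Real.pi - (v - 1).arg) := by
    rw [Real.sin_pi_sub, Complex.sin_arg]; exact div_nonneg (by simpa using hv) (norm_nonneg _)
  have hsin : Real.sin (v + 1).arg ≤ η * Real.sin (Real.pi - (v - 1).arg) := by
    refine le_of_mul_le_mul_right ?_ hpos
    rw [hs]
    nlinarith
  have := angle_le_of_sin_le hB.le hA.le hA2 hη0.le hsin
  have hpi := Real.pi_pos
  have hpi4 := Real.pi_lt_four
  have e := pi_mul_labelF N p v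
  have key : (N - p) * (v + 1).arg < p * (Real.pi - (v - 1).arg) := by
    calc ((N : ℝ) - p) * (v + 1).arg ≤ (N - p) * (Real.pi / 2 * η * (Real.pi - (v - 1).arg)) :=
          mul_le_mul_of_nonneg_left this (by linarith)
      _ = (Real.pi / 4 * ((N - p) / N)) * (p * (Real.pi - (v - 1).arg)) := by
          rw [hη]; field_simp; ring
      _ < 1 * (p * (Real.pi - (v - 1).arg)) := by
          refine mul_lt_mul_of_pos_right ?_ (mul_pos hp' hB)
          have : ((N : ℝ) - p) / N < 1 := (div_lt_one hN).2 (by linarith)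
          have : 0 < ((N : ℝ) - p) / N := div_pos (by linarith) hN
          nlinarith
      _ = _ := one_mul _
  nlinarith

theorem two_le_norm_add_norm (u : ℂ) : 2 ≤ ‖u + 1‖ + ‖u - 1‖ := by
  have := norm_sub_le (u + 1) (u - 1)
  have e : u + 1 - (u - 1) = 2 := by ring
  rw [e] at this
  simpa using this

theorem norm_sub_le_norm_add (u : ℂ) : ‖u - 1‖ ≤ ‖u + 1‖ + 2 := by
  have := norm_sub_le (u + 1) 2
  have e : u + 1 - 2 = u - 1 := by ring
  rw [e] at this
  simpa using this

theorem norm_add_le_norm_sub (u : ℂ) : ‖u + 1‖ ≤ ‖u - 1‖ + 2 := by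
  have := norm_add_le (u - 1) 2
  have e : u - 1 + 2 = u + 1 := by ring
  rw [e] at this
  simpa using this

theorem norm_root {N p : ℕ} {C u : ℂ} (h : (1 - u) ^ p * (1 + u) ^ (N - p) = C) :
    ‖u - 1‖ ^ p * ‖u + 1‖ ^ (N - p) = ‖C‖ := by
  rw [← h, norm_mul, norm_pow, norm_pow, norm_sub_rev, add_comm]

theorem norm_root_le {N p : ℕ} (hpN : p < N) {C u : ℂ} {M : ℝ} (hM : 0 ≤ M)
    (h : (1 - u) ^ p * (1 + u) ^ (N - p) = C) (hC : ‖C‖ ≤ M ^ N) : ‖u + 1‖ ≤ M + 2 := by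
  by_contra hcon
  push Not at hcon
  have h1 : M ≤ ‖u - 1‖ := by linarith [norm_add_le_norm_sub u]
  have h2 := norm_root h
  have : M ^ N < ‖u - 1‖ ^ p * ‖u + 1‖ ^ (N - p) := by
    rcases hM.eq_or_lt with rfl | hM'
    · rw [zero_pow (by omega)]
      have : 0 < ‖u - 1‖ := by linarith [norm_add_le_norm_sub u]
      have : 0 < ‖u + 1‖ := by linarith
      positivity
    calc M ^ N = M ^ p * M ^ (N - p) := by rw [← pow_add]; congr 1; omega
      _ < _ := mul_lt_mul' (pow_le_pow_left₀ hM h1 p)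
          (pow_lt_pow_left₀ (by linarith) hM (by omega)) (by positivity)
          (pow_pos (hM'.trans_le h1) p)
  linarith

theorem two_le_norm_root {N p : ℕ} (hpN : p < N) {C u : ℂ}
    (h : (1 - u) ^ p * (1 + u) ^ (N - p) = C) (hC : (4 : ℝ) ^ N < ‖C‖) : 2 < ‖u + 1‖ := by
  by_contra hcon
  push Not at hcon
  have h1 : ‖u - 1‖ ≤ 4 := by linarith [norm_sub_le_norm_add u]
  have h2 := norm_root h
  have : ‖u - 1‖ ^ p * ‖u + 1‖ ^ (N - p) ≤ 4 ^ N := by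
    calc ‖u - 1‖ ^ p * ‖u + 1‖ ^ (N - p) ≤ 4 ^ p * 4 ^ (N - p) :=
          mul_le_mul (pow_le_pow_left₀ (norm_nonneg _) h1 p)
            (pow_le_pow_left₀ (norm_nonneg _) (by linarith) _) (by positivity) (by positivity)
      _ = 4 ^ N := by rw [← pow_add]; congr 1; omega
  linarith

theorem norm_add_ge_of_le {N p j : ℕ} (hp : 0 < p) (hpN : p < N) {C : ℂ} (hC : OffCut C)
    (h1 : 1 ≤ j) (hj : j ≤ p) : ((N : ℝ) - p) / (2 * N) ≤ ‖1 + rootOffCut N p j C‖ := by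
  have h := norm_add_gt_of_abs_labelF_lt hp hpN (rootOffCut_offSegment j hp hpN hC)
    (abs_labelF_rootOffCut_lt hp hpN hC h1 hj)
  have h2 := two_le_norm_add_norm (rootOffCut N p j C)
  rw [add_comm 1]
  have hp' : (0 : ℝ) < p := by exact_mod_cast hp
  have hq : (p : ℝ) < N := by exact_mod_cast hpN
  have hN : (0 : ℝ) < N := by linarith
  set η := ((N : ℝ) - p) / (2 * N) with hη
  have hη0 : 0 < η := div_pos (by linarith) (by linarith)
  have hη1 : η < 1 := by rw [hη, div_lt_one (by linarith)]; linarith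
  nlinarith [norm_nonneg (rootOffCut N p j C + 1)]

theorem norm_sub_ge_of_lt {N p j : ℕ} (hp : 0 < p) (hpN : p < N) {C : ℂ} (hC : OffCut C)
    (h1 : p < j) (hj : j ≤ N) : (p : ℝ) / (2 * N) ≤ ‖rootOffCut N p j C - 1‖ := by
  have h := norm_sub_gt_of_lt_abs_labelF hp hpN (rootOffCut_offSegment j hp hpN hC)
    (lt_abs_labelF_rootOffCut hp hpN hC h1 hj)
  have h2 := two_le_norm_add_norm (rootOffCut N p j C)
  have hp' : (0 : ℝ) < p := by exact_mod_cast hp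
  have hq : (p : ℝ) < N := by exact_mod_cast hpN
  have hN : (0 : ℝ) < N := by linarith
  set η := (p : ℝ) / (2 * N) with hη
  have hη0 : 0 < η := div_pos (by linarith) (by linarith)
  have hη1 : η < 1 := by rw [hη, div_lt_one (by linarith)]; linarith
  nlinarith [norm_nonneg (rootOffCut N p j C - 1)]

/-- A lower bound, uniform in `C`, for the product of the `‖1 + u_j(C)‖` over `j ≤ p`. -/
theorem prod_norm_rootOffCut_ge {N p m : ℕ} (hp : 0 < p) (hpN : p < N) (hm : 0 < m) {C : ℂ}
    (hC : OffCut C) (h4 : ‖C‖ ≤ 4 ^ N) : (2 : ℝ) ^ (m * p) ≤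
      2 ^ N * (6 / (((N : ℝ) - p) / (2 * N)) *
        ∏ j ∈ Finset.Icc 1 p, ‖1 + rootOffCut N p j C‖) ^ m := by
  obtain ⟨C', hC', hn, hle⟩ := exists_prod_norm_ge hp hpN hm (norm_pos_iff.2 hC.ne_zero)
  refine hle.trans ?_
  have hp' : (0 : ℝ) < p := by exact_mod_cast hp
  have hq : (p : ℝ) < N := by exact_mod_cast hpN
  have hN : (0 : ℝ) < N := by linarith
  set η := ((N : ℝ) - p) / (2 * N) with hη
  have hη0 : 0 < η := div_pos (by linarith) (by linarith)
  have hη1 : η < 1 := by rw [hη, div_lt_one (by linarith)]; linarith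
  refine mul_le_mul_of_nonneg_left (pow_le_pow_left₀
    (Finset.prod_nonneg fun _ _ => norm_nonneg _) ?_ m) (by positivity)
  have hshift : ∀ f : ℕ → ℝ, ∏ j ∈ Finset.Icc 1 p, f j = ∏ j ∈ Finset.range p, f (j + 1) := by
    intro f
    rw [Finset.range_eq_Ico, Finset.prod_Ico_add' f 0 p 1]
    rfl
  rw [hshift, hshift]
  have f0 := phase_div_pi_pos C
  have f1 := hC.phase_div_pi_lt
  have f0' := phase_div_pi_pos C'
  have f1' := hC'.phase_div_pi_lt
  -- Both phases, divided by `π`, lie in `(0, 2)`, so the labels of `C` and `C'` interlace. The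
  -- upper value `6 = 4 + 2` comes from `‖C'‖ ≤ 4^N`, the lower one from the triangle estimate.
  refine prod_le_of_interlaced (x := -(p : ℝ) + phase C / Real.pi)
    (x' := -(p : ℝ) + phase C' / Real.pi) (by rw [abs_lt]; constructor <;> linarith) hη0
    (by linarith) (fun j hj => norm_add_ge_of_le hp hpN hC (by omega) (by omega))
    (fun _ _ => norm_nonneg _) (fun j hj => ?_) (fun i hi j hj hij => ?_)
  · rw [add_comm 1]
    have := norm_root_le (M := 4) hpN (by norm_num)
      (rootOffCut_spec (j := j + 1) hp hpN hC').1 (by rw [hn]; exact h4)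
    linarith
  · refine norm_rootOffCut_le hp hpN hC hC' hn.symm ?_
    rw [labelF_rootOffCut_of_le hp hpN hC (by omega) (by omega),
      labelF_rootOffCut_of_le hp hpN hC' (by omega) (by omega)]
    push_cast
    convert hij using 2 <;> ring

/-! ### One-sided limits of the roots at the cut -/

theorem cutLog_exp {z : ℂ} (h0 : 0 < z.im) (h1 : z.im ≤ 2 * Real.pi) :
    cutLog (Complex.exp z) = z := by
  have : -Complex.exp z = Complex.exp (z - Real.pi * Complex.I) := by
    rw [Complex.exp_sub, Complex.exp_pi_mul_I, div_neg, div_one]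
  have hi : (z - Real.pi * Complex.I).im = z.im - Real.pi := by simp
  rw [cutLog, this, Complex.log_exp (by rw [hi]; linarith) (by rw [hi]; linarith)]
  ring

theorem offCut_of_phase_lt {C : ℂ} (hC : C ≠ 0) (h : phase C < 2 * Real.pi) : OffCut C := by
  rintro ⟨h1, h2⟩
  have : C.re ≠ 0 := fun h => hC (Complex.ext h h2)
  have : Complex.arg (-C) = Real.pi := Complex.arg_eq_pi_iff.2
    ⟨by simpa using lt_of_le_of_ne h1 this.symm, by simpa using h2⟩
  rw [phase, this] at h
  linarith

theorem phase_of_not_offCut {C : ℂ} (hC : C ≠ 0) (h : ¬ OffCut C) : phase C = 2 * Real.pi := by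
  by_contra hne
  exact h (offCut_of_phase_lt hC (lt_of_le_of_ne (phase_le C) hne))

/-- With imaginary parts in `(0, 2π]` the logarithm is continuous up to the cut from the side `Im C
< 0`, the side from which the roots are defined there. -/
theorem cutLog_rotate {C : ℂ} (hC : C ≠ 0) (h : ¬ OffCut C) {δ : ℝ}
    (h1 : -(2 * Real.pi) < δ) (h2 : δ ≤ 0) :
    cutLog (C * Complex.exp (δ * Complex.I)) = cutLog C + δ * Complex.I := by
  have e : C * Complex.exp (δ * Complex.I) = Complex.exp (cutLog C + δ * Complex.I) := by
    rw [Complex.exp_add, exp_cutLog hC]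
  have hi : (cutLog C + δ * Complex.I).im = 2 * Real.pi + δ := by
    rw [Complex.add_im, cutLog_im, phase_of_not_offCut hC h]; simp
  rw [e, cutLog_exp] <;> rw [hi] <;> linarith

theorem phase_rotate {C : ℂ} (hC : C ≠ 0) (h : ¬ OffCut C) {δ : ℝ}
    (h1 : -(2 * Real.pi) < δ) (h2 : δ ≤ 0) :
    phase (C * Complex.exp (δ * Complex.I)) = 2 * Real.pi + δ := by
  rw [← cutLog_im, cutLog_rotate hC h h1 h2, Complex.add_im, cutLog_im, phase_of_not_offCut hC h]
  simp

theorem offCut_rotate {C : ℂ} (hC : C ≠ 0) (h : ¬ OffCut C) {δ : ℝ}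
    (h1 : -(2 * Real.pi) < δ) (h2 : δ < 0) : OffCut (C * Complex.exp (δ * Complex.I)) :=
  offCut_of_phase_lt (mul_ne_zero hC (Complex.exp_ne_zero _))
    (by rw [phase_rotate hC h h1 h2.le]; linarith)

theorem norm_rotate (C : ℂ) (δ : ℝ) : ‖C * Complex.exp (δ * Complex.I)‖ = ‖C‖ := by
  rw [norm_mul, Complex.norm_exp_ofReal_mul_I, mul_one]

theorem eventually_offCut_rotate {C : ℂ} (hC : C ≠ 0) (h : ¬ OffCut C) :
    ∀ᶠ δ : ℝ in 𝓝[<] 0, (-(2 * Real.pi) < δ ∧ δ < 0) ∧ OffCut (C * Complex.exp (δ * Complex.I)) := by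
  have : Set.Ioo (-(2 * Real.pi)) 0 ∈ 𝓝[<] (0 : ℝ) :=
    Ioo_mem_nhdsLT (by linarith [Real.pi_pos])
  filter_upwards [this] with δ hδ
  exact ⟨hδ, offCut_rotate hC h hδ.1 hδ.2⟩

theorem norm_root_ge {N p : ℕ} (hpN : p < N) {C u : ℂ}
    (h : (1 - u) ^ p * (1 + u) ^ (N - p) = C) : min 1 (‖C‖ / 3 ^ p) ≤ ‖u + 1‖ := by
  by_contra hcon
  push Not at hcon
  rw [lt_min_iff] at hcon
  have h1 : ‖u - 1‖ ≤ 3 := by linarith [norm_sub_le_norm_add u]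
  have h2 := norm_root h
  have h3 : ‖u + 1‖ ^ (N - p) ≤ ‖u + 1‖ :=
    pow_le_of_le_one (norm_nonneg _) hcon.1.le (by omega)
  have h4 : ‖C‖ ≤ 3 ^ p * ‖u + 1‖ := by
    rw [← h2]
    exact mul_le_mul (pow_le_pow_left₀ (norm_nonneg _) h1 p) h3 (by positivity) (by positivity)
  have h5 := hcon.2
  rw [lt_div_iff₀ (by positivity)] at h5
  linarith

/-- A family of roots with convergent `‖u + 1‖` and imaginary parts of constant sign
converges. -/
theorem exists_tendsto_of_norm_add {N p : ℕ} (hp : 0 < p) {l : Filter ℝ} [l.NeBot]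
    {R t s : ℝ} (hR : 0 < R) {r : ℝ → ℂ} (hroot : ∀ᶠ δ in l, r δ - 1 ≠ 0 ∧ r δ + 1 ≠ 0 ∧
      ‖r δ - 1‖ ^ p * ‖r δ + 1‖ ^ (N - p) = R ∧ min 1 (R / 3 ^ p) ≤ ‖r δ + 1‖)
    (ht : Tendsto (fun δ => ‖r δ + 1‖) l (𝓝 t))
    (hs : ∀ᶠ δ in l, (r δ).im = s * |(r δ).im|) : ∃ u, Tendsto r l (𝓝 u) := by
  have ht0 : 0 < t := lt_of_lt_of_le (lt_min one_pos (by positivity))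
    (ge_of_tendsto ht (hroot.mono fun δ h => h.2.2.2))
  have hp' : (0 : ℝ) < p := by exact_mod_cast hp
  have hsub : Tendsto (fun δ => ‖r δ - 1‖) l
      (𝓝 (Real.exp ((Real.log R - ((N - p : ℕ) : ℝ) * Real.log t) / p))) := by
    have h1 : Tendsto (fun δ => Real.exp ((Real.log R - ((N - p : ℕ) : ℝ) *
        Real.log ‖r δ + 1‖) / p)) l
        (𝓝 (Real.exp ((Real.log R - ((N - p : ℕ) : ℝ) * Real.log t) / p))) :=
      (Real.continuous_exp.tendsto _).comp
        ((((ht.log ht0.ne').const_mul _).const_sub _).div_const _)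
    refine h1.congr' (hroot.mono fun δ h => ?_)
    have n1 := norm_pos_iff.2 h.1
    have n2 := norm_pos_iff.2 h.2.1
    have hl := congrArg Real.log h.2.2.1
    rw [Real.log_mul (by positivity) (by positivity), Real.log_pow, Real.log_pow] at hl
    rw [← hl, add_sub_cancel_right, mul_div_cancel_left₀ _ hp'.ne', Real.exp_log n1]
  obtain ⟨x, hx⟩ : ∃ x, Tendsto (fun δ => (r δ).re) l (𝓝 x) :=
    ⟨_, (((ht.pow 2).sub (hsub.pow 2)).div_const 4).congr fun δ => (re_eq_of_norms _).symm⟩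
  obtain ⟨y, hy⟩ : ∃ y, Tendsto (fun δ => (r δ).im) l (𝓝 y) := by
    have h1 : Tendsto (fun δ => (r δ).im ^ 2) l (𝓝 (t ^ 2 - (x + 1) ^ 2)) :=
      ((ht.pow 2).sub ((hx.add_const 1).pow 2)).congr fun δ => (im_sq_eq_of_norms _).symm
    refine ⟨_, ((h1.sqrt).const_mul s).congr' (hs.mono fun δ h => ?_)⟩
    rw [Real.sqrt_sq_eq_abs, ← h]
  refine ⟨⟨x, y⟩, ?_⟩
  have := ((Complex.continuous_ofReal.tendsto x).comp hx).add
    (((Complex.continuous_ofReal.tendsto y).comp hy).mul_const Complex.I)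
  rw [Complex.mk_eq_add_mul_I]
  exact this.congr fun δ => by simp [Complex.re_add_im]

/-- As `δ ↑ 0` the label moves linearly and keeps its sign, so `‖u + 1‖` is monotone and bounded.
Its limit, the level and the sign of the imaginary part determine the limit of the root. -/
theorem exists_tendsto_rootOffCut {N p j : ℕ} (hp : 0 < p) (hpN : p < N) (hj1 : 1 ≤ j)
    (hjN : j ≤ N) {C : ℂ} (hC : C ≠ 0) (hcut : ¬ OffCut C) :
    ∃ u, Tendsto (fun δ : ℝ => rootOffCut N p j (C * Complex.exp (δ * Complex.I)))
      (𝓝[<] 0) (𝓝 u) := by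
  set r : ℝ → ℂ := fun δ => rootOffCut N p j (C * Complex.exp (δ * Complex.I)) with hr
  have hp' : (0 : ℝ) < p := by exact_mod_cast hp
  have hq : (p : ℝ) < N := by exact_mod_cast hpN
  have hj1' : (1 : ℝ) ≤ j := by exact_mod_cast hj1
  have hjN' : (j : ℝ) ≤ N := by exact_mod_cast hjN
  have hpi := Real.pi_pos
  -- `F0` is the limiting label, where the phase is `2π`; `m` brings it into `(-N, N]`.
  obtain ⟨m, hm1, hm2⟩ : ∃ m : ℤ, -(N : ℝ) < -(p : ℝ) + 2 * j - 2 * N * m ∧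
      -(p : ℝ) + 2 * j - 2 * N * m ≤ N := by
    by_cases h : -(p : ℝ) + 2 * j ≤ N
    · exact ⟨0, by push_cast; linarith, by push_cast; linarith⟩
    · exact ⟨1, by push_cast; linarith, by push_cast; linarith⟩
  set F0 : ℝ := -(p : ℝ) + 2 * j - 2 * N * m with hF0
  -- For `|δ| < ε` the label stays in the window, and it stays positive if `F0 > 0`. If `F0 ≤ 0` it
  -- is negative for every `δ < 0`.
  obtain ⟨ε, hε0, hε1, hε2, hε3⟩ : ∃ ε : ℝ, 0 < ε ∧ ε < 2 * Real.pi ∧ ε < Real.pi * (F0 + N) ∧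
      (0 < F0 → ε < Real.pi * F0) := by
    by_cases h : 0 < F0
    · obtain ⟨ε, h0, h1⟩ := exists_between (lt_min (lt_min (by positivity : 0 < 2 * Real.pi)
        (mul_pos hpi (by linarith : 0 < F0 + N))) (mul_pos hpi h))
      rw [lt_min_iff, lt_min_iff] at h1
      exact ⟨ε, h0, h1.1.1, h1.1.2, fun _ => h1.2⟩
    · obtain ⟨ε, h0, h1⟩ := exists_between (lt_min (by positivity : 0 < 2 * Real.pi)
        (mul_pos hpi (by linarith : 0 < F0 + N)))
      rw [lt_min_iff] at h1
      exact ⟨ε, h0, h1.1, h1.2, fun h' => absurd h' h⟩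
  have hI : ∀ δ ∈ Set.Ioo (-ε) 0, OffCut (C * Complex.exp (δ * Complex.I)) ∧
      labelF N p (r δ) = F0 + δ / Real.pi := by
    rintro δ ⟨h1, h2⟩
    have ho := offCut_rotate hC hcut (by linarith) h2
    refine ⟨ho, ?_⟩
    have e : -(p : ℝ) + 2 * ((j : ℝ) - 1) + phase (C * Complex.exp (δ * Complex.I)) / Real.pi
        - 2 * N * m = F0 + δ / Real.pi := by
      rw [phase_rotate hC hcut (by linarith) h2.le, hF0]; field_simp; ring
    rw [← e]
    apply labelF_rootOffCut_of_mem hp hpN ho <;> rw [e]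
    · have : -(F0 + N) < δ / Real.pi := by rw [lt_div_iff₀ hpi]; linarith
      linarith
    · have : δ / Real.pi < 0 := div_neg_of_neg_of_pos h2 hpi
      linarith
  have hmem : Set.Ioo (-ε) 0 ∈ 𝓝[<] (0 : ℝ) := Ioo_mem_nhdsLT (by linarith)
  have hroot : ∀ᶠ δ in 𝓝[<] (0 : ℝ), r δ - 1 ≠ 0 ∧ r δ + 1 ≠ 0 ∧
      ‖r δ - 1‖ ^ p * ‖r δ + 1‖ ^ (N - p) = ‖C‖ ∧ min 1 (‖C‖ / 3 ^ p) ≤ ‖r δ + 1‖ := by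
    filter_upwards [hmem] with δ hδ
    have ho := (hI δ hδ).1
    have hs := (rootOffCut_spec (j := j) hp hpN ho).1
    have hos := rootOffCut_offSegment j hp hpN ho
    refine ⟨hos.sub_ne_zero, hos.add_ne_zero, ?_, ?_⟩
    · rw [← norm_rotate C δ]; exact norm_root hs
    · rw [← norm_rotate C δ]; exact norm_root_ge hpN hs
  have hbdd : ∀ δ ∈ Set.Ioo (-ε) 0, ‖r δ + 1‖ ≤ 1 + ‖C‖ + 2 := by
    intro δ hδ
    refine norm_root_le hpN (by positivity) (rootOffCut_spec (j := j) hp hpN (hI δ hδ).1).1 ?_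
    rw [norm_rotate]
    have : 1 + ‖C‖ ≤ (1 + ‖C‖) ^ N := le_self_pow₀ (by linarith [norm_nonneg C]) (by omega)
    linarith
  have hle : ∀ δ ∈ Set.Ioo (-ε) 0, ∀ δ' ∈ Set.Ioo (-ε) 0,
      |F0 + δ / Real.pi| ≤ |F0 + δ' / Real.pi| → ‖r δ' + 1‖ ≤ ‖r δ + 1‖ := by
    intro δ hδ δ' hδ' h
    rw [add_comm, add_comm (r δ)]
    refine norm_rootOffCut_le hp hpN (hI δ hδ).1 (hI δ' hδ').1
      (by rw [norm_rotate, norm_rotate]) ?_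
    have a := (hI δ hδ).2
    have b := (hI δ' hδ').2
    simp only [hr] at a b
    rwa [a, b]
  by_cases hF : 0 < F0
  · have hpos : ∀ δ ∈ Set.Ioo (-ε) 0, 0 < F0 + δ / Real.pi := by
      rintro δ ⟨h1, h2⟩
      have : -F0 < δ / Real.pi := by rw [lt_div_iff₀ hpi]; linarith [hε3 hF]
      linarith
    have hanti : MonotoneOn (fun δ => -‖r δ + 1‖) (Set.Ioo (-ε) 0) := by
      intro δ hδ δ' hδ' h
      refine neg_le_neg (hle δ hδ δ' hδ' ?_)
      rw [abs_of_pos (hpos δ hδ), abs_of_pos (hpos δ' hδ')]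
      gcongr
    have ht := hanti.tendsto_nhdsWithin_Ioo_left (Set.nonempty_Ioo.2 (by linarith))
      ⟨0, by rintro _ ⟨δ, -, rfl⟩; simp⟩
    have ht' := ht.neg
    simp only [neg_neg] at ht'
    refine exists_tendsto_of_norm_add (s := 1) hp (norm_pos_iff.2 hC) hroot ht' ?_
    filter_upwards [hmem] with δ hδ
    have h1 := im_neg_iff_labelF_neg hp hpN (rootOffCut_offSegment j hp hpN (hI δ hδ).1)
    have h2 := (hI δ hδ).2
    simp only [hr] at h2 ⊢
    rw [h2] at h1
    have : ¬ (rootOffCut N p j (C * Complex.exp (δ * Complex.I))).im < 0 := fun h =>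
      absurd (h1.1 h) (not_lt.2 (hpos δ hδ).le)
    rw [abs_of_nonneg (not_lt.1 this), one_mul]
  · have hneg : ∀ δ ∈ Set.Ioo (-ε) 0, F0 + δ / Real.pi < 0 := by
      rintro δ ⟨h1, h2⟩
      have : δ / Real.pi < 0 := div_neg_of_neg_of_pos h2 hpi
      linarith
    have hmono : MonotoneOn (fun δ => ‖r δ + 1‖) (Set.Ioo (-ε) 0) := by
      intro δ hδ δ' hδ' h
      refine hle δ' hδ' δ hδ ?_
      rw [abs_of_neg (hneg δ hδ), abs_of_neg (hneg δ' hδ')]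
      gcongr
    have ht := hmono.tendsto_nhdsWithin_Ioo_left (Set.nonempty_Ioo.2 (by linarith))
      ⟨1 + ‖C‖ + 2, by rintro _ ⟨δ, hδ, rfl⟩; exact hbdd δ hδ⟩
    refine exists_tendsto_of_norm_add (s := -1) hp (norm_pos_iff.2 hC) hroot ht ?_
    filter_upwards [hmem] with δ hδ
    have h1 := im_neg_iff_labelF_neg hp hpN (rootOffCut_offSegment j hp hpN (hI δ hδ).1)
    have h2 := (hI δ hδ).2
    simp only [hr] at h2 ⊢
    rw [h2] at h1
    rw [abs_of_neg (h1.2 (hneg δ hδ))]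
    ring

theorem betheRoot_of_offCut {N p j : ℕ} {C : ℂ} (hC : OffCut C) :
    betheRoot N p j C = rootOffCut N p j C := by
  rw [betheRoot, if_neg fun h => hC ⟨h.1.le, h.2⟩]

theorem tendsto_betheRoot {N p j : ℕ} (hp : 0 < p) (hpN : p < N) (hj1 : 1 ≤ j)
    (hjN : j ≤ N) {C : ℂ} (hC : C ≠ 0) (hcut : ¬ OffCut C) :
    Tendsto (fun δ : ℝ => rootOffCut N p j (C * Complex.exp (δ * Complex.I)))
      (𝓝[<] 0) (𝓝 (betheRoot N p j C)) := by
  have h : 0 < C.re ∧ C.im = 0 := by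
    rw [OffCut, not_not] at hcut
    exact ⟨lt_of_le_of_ne hcut.1 fun h => hC (Complex.ext h.symm hcut.2), hcut.2⟩
  rw [betheRoot, if_pos h]
  exact tendsto_nhds_limUnder (exists_tendsto_rootOffCut hp hpN hj1 hjN hC hcut)

theorem betheRoot_root {N p j : ℕ} (hp : 0 < p) (hpN : p < N) (hj1 : 1 ≤ j)
    (hjN : j ≤ N) {C : ℂ} (hC : C ≠ 0) :
    (1 - betheRoot N p j C) ^ p * (1 + betheRoot N p j C) ^ (N - p) = C := by
  by_cases hcut : OffCut C
  · rw [betheRoot_of_offCut hcut]; exact (rootOffCut_spec hp hpN hcut).1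
  · have h := tendsto_betheRoot hp hpN hj1 hjN hC hcut
    have h1 := ((h.const_sub 1).pow p).mul ((h.const_add 1).pow (N - p))
    have h2 : Tendsto (fun δ : ℝ => C * Complex.exp (δ * Complex.I)) (𝓝[<] 0) (𝓝 C) := by
      have : ContinuousAt (fun δ : ℝ => C * Complex.exp (δ * Complex.I)) 0 := by fun_prop
      have h3 := this.tendsto
      simp only [Complex.ofReal_zero, zero_mul, Complex.exp_zero, mul_one] at h3
      exact h3.mono_left nhdsWithin_le_nhds
    refine tendsto_nhds_unique h1 (h2.congr' ?_)
    filter_upwards [eventually_offCut_rotate hC hcut] with δ hδ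
    exact (rootOffCut_spec (j := j) hp hpN hδ.2).1.symm

theorem prod_norm_betheRoot_ge {N p m : ℕ} (hp : 0 < p) (hpN : p < N) (hm : 0 < m) {C : ℂ}
    (hC : C ≠ 0) (h4 : ‖C‖ ≤ 4 ^ N) : (2 : ℝ) ^ (m * p) ≤
      2 ^ N * (6 / (((N : ℝ) - p) / (2 * N)) *
        ∏ j ∈ Finset.Icc 1 p, ‖1 + betheRoot N p j C‖) ^ m := by
  by_cases hcut : OffCut C
  · simp_rw [betheRoot_of_offCut hcut]
    exact prod_norm_rootOffCut_ge hp hpN hm hcut h4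
  · have h : Tendsto (fun δ : ℝ => (2 : ℝ) ^ N * (6 / (((N : ℝ) - p) / (2 * N)) *
        ∏ j ∈ Finset.Icc 1 p, ‖1 + rootOffCut N p j (C * Complex.exp (δ * Complex.I))‖) ^ m)
        (𝓝[<] 0) (𝓝 (2 ^ N * (6 / (((N : ℝ) - p) / (2 * N)) *
        ∏ j ∈ Finset.Icc 1 p, ‖1 + betheRoot N p j C‖) ^ m)) := by
      refine (((tendsto_finsetProd _ fun j hj => ?_).const_mul _).pow m).const_mul _
      rw [Finset.mem_Icc] at hj
      exact ((tendsto_betheRoot hp hpN hj.1 (hj.2.trans hpN.le) hC hcut).const_add 1).norm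
    refine ge_of_tendsto h ?_
    filter_upwards [eventually_offCut_rotate hC hcut] with δ hδ
    exact prod_norm_rootOffCut_ge hp hpN hm hδ.2 (by rwa [norm_rotate])

theorem norm_betheRoot_add_le {N p j : ℕ} (hp : 0 < p) (hpN : p < N) (hj1 : 1 ≤ j)
    (hjN : j ≤ N) {C : ℂ} (hC : C ≠ 0) (h4 : ‖C‖ ≤ 4 ^ N) : ‖1 + betheRoot N p j C‖ ≤ 6 := by
  have := norm_root_le (M := 4) hpN (by norm_num) (betheRoot_root hp hpN hj1 hjN hC) h4
  rw [add_comm]; linarith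

/-! ### Every solution is super-exponentially small -/

theorem sum_choiceSet {M : Type*} [AddCommMonoid M] {p s : ℕ} (hs : p < s) (f : ℕ → M) :
    ∑ j ∈ choiceSet p s, f j = f s + ∑ j ∈ Finset.Icc 1 (p - 1), f j := by
  rw [choiceSet, Finset.sum_insert]
  simp only [Finset.mem_Icc]; omega

theorem sum_Icc_pred {M : Type*} [AddCommMonoid M] {p : ℕ} (hp : 0 < p) (f : ℕ → M) :
    ∑ j ∈ Finset.Icc 1 p, f j = (∑ j ∈ Finset.Icc 1 (p - 1), f j) + f p := by
  obtain ⟨n, rfl⟩ := Nat.exists_eq_succ_of_ne_zero hp.ne'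
  simp only [Nat.succ_eq_add_one, add_tsub_cancel_right]
  rw [Finset.sum_Icc_succ_top (by omega)]

/-- The modulus of the consistency equation for the index set `{1, …, p - 1, s}`. -/
def ModulusConsistency (N p s : ℕ) (γ : ℝ) (C : ℂ) : Prop :=
  ∑ j ∈ choiceSet p s, Real.log ‖1 + betheRoot N p j C‖ = p * (Real.log 2 + γ)

theorem betheRoot_ne {N p j : ℕ} (hp : 0 < p) (hpN : p < N) (hj1 : 1 ≤ j) (hjN : j ≤ N) {C : ℂ}
    (hC : C ≠ 0) : betheRoot N p j C - 1 ≠ 0 ∧ 1 + betheRoot N p j C ≠ 0 := by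
  have h := betheRoot_root hp hpN hj1 hjN hC
  constructor
  · intro h'
    rw [show 1 - betheRoot N p j C = 0 by linear_combination -h', zero_pow hp.ne', zero_mul] at h
    exact hC h.symm
  · intro h'
    rw [h', zero_pow (by omega), mul_zero] at h
    exact hC h.symm

theorem log_norm_betheRoot {N p j : ℕ} (hp : 0 < p) (hpN : p < N) (hj1 : 1 ≤ j) (hjN : j ≤ N)
    {C : ℂ} (hC : C ≠ 0) : p * Real.log ‖betheRoot N p j C - 1‖
      + ((N : ℝ) - p) * Real.log ‖1 + betheRoot N p j C‖ = Real.log ‖C‖ := by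
  obtain ⟨h1, h2⟩ := betheRoot_ne hp hpN hj1 hjN hC
  have n1 := norm_pos_iff.2 h1
  have n2 := norm_pos_iff.2 h2
  have h := norm_root (betheRoot_root hp hpN hj1 hjN hC)
  rw [add_comm (betheRoot N p j C)] at h
  have hl := congrArg Real.log h
  rw [Real.log_mul (by positivity) (by positivity), Real.log_pow, Real.log_pow,
    Nat.cast_sub hpN.le] at hl
  exact hl

/-- Real parts remove the momentum, and the logarithm of the ratio replaces the index `p` by `s` in
the sum. -/
theorem modulusConsistency_of_logConsistency {N p s m : ℕ} (hp : 0 < p) (hpN : p < N)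
    (hs : p < s) (hsN : s ≤ N) {γ : ℝ} {C : ℂ} (h : LogConsistency N p s m γ C) :
    ModulusConsistency N p s γ C := by
  obtain ⟨hC, h⟩ := h
  have hp' : (p : ℂ) ≠ 0 := by exact_mod_cast hp.ne'
  have hN' : (N : ℂ) ≠ 0 := by exact_mod_cast (hp.trans hpN).ne'
  have e : Complex.log ((betheRoot N p s C + 1) / (betheRoot N p p C + 1))
      + ∑ j ∈ Finset.Icc 1 p, Complex.log (1 + betheRoot N p j C)
      = p * (Real.log 2 + γ) + ((2 * Real.pi * m / N : ℝ) : ℂ) * Complex.I := by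
    rw [bigG] at h
    push_cast
    field_simp at h ⊢
    linear_combination h
  have hre := congrArg Complex.re e
  have e2 : ((p : ℂ) * (Real.log 2 + γ)).re = p * (Real.log 2 + γ) := by
    have : (p : ℂ) * (Real.log 2 + γ) = ((p * (Real.log 2 + γ) : ℝ) : ℂ) := by push_cast; ring
    rw [this, Complex.ofReal_re]
  rw [Complex.add_re, Complex.add_re, e2, Complex.re_ofReal_mul, Complex.I_re, mul_zero, add_zero,
    Complex.re_sum, Complex.log_re, norm_div] at hre
  simp only [Complex.log_re] at hre
  have n1 := norm_pos_iff.2 (betheRoot_ne hp hpN (j := s) (by omega) hsN hC).2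
  have n2 := norm_pos_iff.2 (betheRoot_ne hp hpN (j := p) (by omega) hpN.le hC).2
  rw [add_comm (betheRoot N p s C), add_comm (betheRoot N p p C),
    Real.log_div n1.ne' n2.ne', sum_Icc_pred hp] at hre
  rw [ModulusConsistency, sum_choiceSet hs]
  linarith

theorem choiceSet_mem {N p s j : ℕ} (hpN : p < N) (hs : p < s) (hsN : s ≤ N)
    (hj : j ∈ choiceSet p s) : 1 ≤ j ∧ j ≤ N := by
  rw [choiceSet, Finset.mem_insert, Finset.mem_Icc] at hj
  omega

theorem card_choiceSet {p s : ℕ} (hp : 0 < p) (hs : p < s) : (choiceSet p s).card = p := by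
  rw [choiceSet, Finset.card_insert_of_notMem] <;> simp <;> omega

/-- By the root equation each factor has log-modulus `log ‖C‖ / p - (N/p) log ‖1 + u_j‖`. The `p`
copies of the first term cancel against `C`, and what remains is the modulus of the logarithmic
equation. -/
theorem modulusConsistency_of_prod {N p s : ℕ} (hp : 0 < p) (hpN : p < N)
    (hs : p < s) (hsN : s ≤ N) {γ : ℝ} {C : ℂ} (hC : C ≠ 0)
    (h : 2 ^ N * (Real.exp (γ * N) : ℂ) * ∏ j ∈ choiceSet p s,
      ((betheRoot N p j C - 1) / (betheRoot N p j C + 1)) + C = 0) :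
    ModulusConsistency N p s γ C := by
  have hp' : (0 : ℝ) < p := by exact_mod_cast hp
  have hN : (0 : ℝ) < N := by exact_mod_cast hp.trans hpN
  have hn := congrArg norm (eq_neg_of_add_eq_zero_left h)
  rw [norm_neg, norm_mul, norm_mul, norm_pow, norm_prod, Complex.norm_ofNat, Complex.norm_real,
    Real.norm_of_nonneg (Real.exp_pos _).le] at hn
  have hl := congrArg Real.log hn
  have hne : ∀ j ∈ choiceSet p s,
      ‖(betheRoot N p j C - 1) / (betheRoot N p j C + 1)‖ ≠ 0 := by
    intro j hj
    obtain ⟨j1, j2⟩ := choiceSet_mem hpN hs hsN hj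
    obtain ⟨h1, h2⟩ := betheRoot_ne hp hpN j1 j2 hC
    rw [add_comm] at h2
    exact norm_ne_zero_iff.2 (div_ne_zero h1 h2)
  rw [Real.log_mul (by positivity) (Finset.prod_ne_zero_iff.2 hne),
    Real.log_mul (by positivity) (by positivity), Real.log_pow, Real.log_exp,
    Real.log_prod hne] at hl
  have hterm : ∀ j ∈ choiceSet p s,
      Real.log ‖(betheRoot N p j C - 1) / (betheRoot N p j C + 1)‖
        = Real.log ‖C‖ / p - N / p * Real.log ‖1 + betheRoot N p j C‖ := by
    intro j hj
    obtain ⟨j1, j2⟩ := choiceSet_mem hpN hs hsN hj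
    obtain ⟨h1, h2⟩ := betheRoot_ne hp hpN j1 j2 hC
    have e := log_norm_betheRoot hp hpN j1 j2 hC
    rw [norm_div, add_comm (betheRoot N p j C), Real.log_div (norm_ne_zero_iff.2 h1)
      (norm_ne_zero_iff.2 h2), ← e]
    field_simp
    ring
  rw [Finset.sum_congr rfl hterm, Finset.sum_sub_distrib, Finset.sum_const, card_choiceSet hp hs,
    ← Finset.mul_sum, nsmul_eq_mul, mul_div_cancel₀ _ hp'.ne'] at hl
  rw [ModulusConsistency]
  have : (N : ℝ) / p * ∑ j ∈ choiceSet p s, Real.log ‖1 + betheRoot N p j C‖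
      = N / p * (p * (Real.log 2 + γ)) := by
    have : (N : ℝ) / p * (p * (Real.log 2 + γ)) = N * (Real.log 2 + γ) := by field_simp
    rw [this]; linarith
  exact mul_left_cancel₀ (by positivity) this

/-- If the modulus equation holds, then `‖1 + u_s(C)‖` is exponentially small, up to an arbitrarily
small loss in the exponent. -/
theorem log_norm_last_le {N p s m : ℕ} (hp : 0 < p) (hpN : p < N) (hm : 0 < m)
    (hs : p < s) (hsN : s ≤ N) {γ : ℝ} (hγ : γ < 0) {C : ℂ} (hC : C ≠ 0)
    (h : ModulusConsistency N p s γ C) :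
    Real.log ‖1 + betheRoot N p s C‖ ≤ p * γ + N * Real.log 2 / m
      + (Real.log (6 / (((N : ℝ) - p) / (2 * N))) + Real.log 6) := by
  have hp' : (0 : ℝ) < p := by exact_mod_cast hp
  have hq : (p : ℝ) < N := by exact_mod_cast hpN
  have hm' : (0 : ℝ) < m := by exact_mod_cast hm
  rw [ModulusConsistency] at h
  by_cases h4 : ‖C‖ ≤ 4 ^ N
  · have hprod := prod_norm_betheRoot_ge hp hpN hm hC h4
    have hη : 0 < 6 / (((N : ℝ) - p) / (2 * N)) :=
      div_pos (by norm_num) (div_pos (by linarith) (by linarith))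
    have hne : ∀ j ∈ Finset.Icc 1 p, ‖1 + betheRoot N p j C‖ ≠ 0 := fun j hj =>
      norm_ne_zero_iff.2 (betheRoot_ne hp hpN (Finset.mem_Icc.1 hj).1
        ((Finset.mem_Icc.1 hj).2.trans hpN.le) hC).2
    have hP : (∏ j ∈ Finset.Icc 1 p, ‖1 + betheRoot N p j C‖) ≠ 0 := Finset.prod_ne_zero_iff.2 hne
    have hl := Real.log_le_log (by positivity) hprod
    rw [Real.log_mul (by positivity) (pow_ne_zero _ (mul_ne_zero hη.ne' hP)), Real.log_pow,
      Real.log_pow, Real.log_pow, Real.log_mul hη.ne' hP, Real.log_prod hne, sum_Icc_pred hp] at hl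
    rw [sum_choiceSet hs] at h
    have h6 : Real.log ‖1 + betheRoot N p p C‖ ≤ Real.log 6 :=
      Real.log_le_log (norm_pos_iff.2 (betheRoot_ne hp hpN (by omega) hpN.le hC).2)
        (norm_betheRoot_add_le hp hpN (by omega) hpN.le hC h4)
    push_cast at hl
    have hl2 : p * Real.log 2 ≤ N * Real.log 2 / m + (Real.log (6 / (((N : ℝ) - p) / (2 * N))) +
        (∑ j ∈ Finset.Icc 1 (p - 1), Real.log ‖1 + betheRoot N p j C‖ +
          Real.log ‖1 + betheRoot N p p C‖)) := by
      rw [← sub_le_iff_le_add, le_div_iff₀ hm']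
      nlinarith
    linarith
  -- For `‖C‖ > 4^N` every `‖1 + u_j‖` exceeds `2`, so the sum is at least `p log 2`, which
  -- contradicts `γ < 0`.
  · push Not at h4
    exfalso
    have hgt : ∀ j ∈ choiceSet p s, Real.log 2 ≤ Real.log ‖1 + betheRoot N p j C‖ := by
      intro j hj
      obtain ⟨j1, j2⟩ := choiceSet_mem hpN hs hsN hj
      have := two_le_norm_root hpN (betheRoot_root hp hpN j1 j2 hC) h4
      rw [add_comm] at this
      exact Real.log_le_log (by norm_num) this.le
    have := Finset.sum_le_sum hgt
    rw [h, Finset.sum_const, card_choiceSet hp hs, nsmul_eq_mul] at this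
    nlinarith

theorem eventually_le_mul_nat {c : ℝ} (hc : 0 < c) (d : ℝ) : ∀ᶠ k : ℕ in atTop, d ≤ c * k :=
  (tendsto_natCast_atTop_atTop.const_mul_atTop hc).eventually_ge_atTop d

/-- Solutions of the modulus equation are super-exponentially small. -/
theorem eventually_log_norm_le {a b : ℕ} (ha : 0 < a) (hab : a < b) {γ : ℝ} (hγ : γ < 0) :
    ∀ᶠ k : ℕ in atTop, ∀ s, k * a < s → s ≤ k * b → ∀ C : ℂ, C ≠ 0 →
      ModulusConsistency (k * b) (k * a) s γ C →
        Real.log ‖C‖ ≤ a * ((b : ℝ) - a) * γ / 4 * k ^ 2 := by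
  have ha' : (0 : ℝ) < a := by exact_mod_cast ha
  have hb' : (a : ℝ) < b := by exact_mod_cast hab
  have hbp : (0 : ℝ) < b := by linarith
  -- The loss `2^{N/m}` must cost at most a quarter of `p|γ|`. The constants cost another quarter
  -- for large `k`, which leaves `log ‖1 + u_s‖ ≤ pγ/2`.
  obtain ⟨m, hm⟩ := exists_nat_gt (b * Real.log 2 / (a * (-γ) / 4))
  have hag : 0 < a * (-γ) / 4 := by nlinarith [mul_pos ha' (neg_pos.2 hγ)]
  have hm0 : (0 : ℝ) < m := lt_of_le_of_lt (div_nonneg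
    (mul_nonneg hbp.le (Real.log_nonneg (by norm_num))) hag.le) hm
  have hm0' : 0 < m := by exact_mod_cast hm0
  have hml : b * Real.log 2 / m ≤ a * (-γ) / 4 := by
    rw [div_le_iff₀ hm0]
    rw [div_lt_iff₀ hag] at hm
    linarith
  filter_upwards [eventually_gt_atTop 0,
    eventually_le_mul_nat hag (Real.log (6 / (((b : ℝ) - a) / (2 * b))) + Real.log 6),
    eventually_le_mul_nat (c := a * ((b : ℝ) - a) * (-γ) / 4)
      (by have := mul_pos (mul_pos ha' (sub_pos.2 hb')) (neg_pos.2 hγ); linarith)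
      (a * Real.log 3)] with k hk h1 h2 s hs hsN C hC hM
  have hk' : (0 : ℝ) < k := by exact_mod_cast hk
  have hp : 0 < k * a := Nat.mul_pos hk ha
  have hpN : k * a < k * b := Nat.mul_lt_mul_of_pos_left hab hk
  have key := log_norm_last_le hp hpN hm0' hs hsN hγ hC hM
  push_cast at key
  have e1 : ((k : ℝ) * b - k * a) / (2 * (k * b)) = (b - a) / (2 * b) := by
    field_simp
  rw [e1] at key
  have e2 : (k : ℝ) * b * Real.log 2 / m ≤ k * (a * (-γ) / 4) := by
    rw [mul_assoc, mul_div_assoc]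
    exact mul_le_mul_of_nonneg_left hml hk'.le
  have hlog : Real.log ‖1 + betheRoot (k * b) (k * a) s C‖ ≤ k * a * γ / 2 := by linarith
  have hneg : k * a * γ / 2 < 0 := by have := mul_pos (mul_pos hk' ha') (neg_pos.2 hγ); linarith
  obtain ⟨g1, g2⟩ := betheRoot_ne hp hpN (j := s) (by omega) hsN hC
  have hle1 : ‖1 + betheRoot (k * b) (k * a) s C‖ ≤ 1 := by
    by_contra hcon
    push Not at hcon
    have := Real.log_pos hcon
    linarith
  have hsub : Real.log ‖betheRoot (k * b) (k * a) s C - 1‖ ≤ Real.log 3 := by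
    refine Real.log_le_log (norm_pos_iff.2 g1) ?_
    have := norm_sub_le_norm_add (betheRoot (k * b) (k * a) s C)
    rw [add_comm _ (1 : ℂ)] at this
    linarith
  have hroot := log_norm_betheRoot hp hpN (j := s) (by omega) hsN hC
  push_cast at hroot
  rw [← hroot]
  have t1 : (k : ℝ) * a * Real.log ‖betheRoot (k * b) (k * a) s C - 1‖ ≤ k * (a * Real.log 3) := by
    rw [mul_assoc]
    exact mul_le_mul_of_nonneg_left (mul_le_mul_of_nonneg_left hsub ha'.le) hk'.le
  have t2 : ((k : ℝ) * b - k * a) * Real.log ‖1 + betheRoot (k * b) (k * a) s C‖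
      ≤ (k * b - k * a) * (k * a * γ / 2) :=
    mul_le_mul_of_nonneg_left hlog (by nlinarith)
  -- The factor `3^p` from `‖u_s - 1‖` is absorbed by half of the quadratic exponent, which turns
  -- `γ/2` into `γ/4`.
  have t3 : k * (a * Real.log 3) ≤ k * (a * ((b : ℝ) - a) * (-γ) / 4 * k) :=
    mul_le_mul_of_nonneg_left h2 hk'.le
  calc _ ≤ k * (a * ((b : ℝ) - a) * (-γ) / 4 * k) + (k * b - k * a) * (k * a * γ / 2) := by linarith
    _ = _ := by ring

/-! ### Local inverse branches -/

/-- The map `z ↦ z (1 + z/2)^κ`. -/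
def branchMap (κ : ℝ) (z : ℂ) : ℂ := z * Complex.exp (κ * Complex.log (1 + z / 2))

/-- A local inverse `ψ` of `z ↦ z (1 + z/2)^κ` at the origin, with the estimates used below. -/
structure InverseBranch (κ : ℝ) where
  ψ : ℂ → ℂ
  r : ℝ
  η : ℝ
  L : ℝ
  r_pos : 0 < r
  η_pos : 0 < η
  η_le : η ≤ 1
  L_pos : 0 < L
  norm_lt : ∀ w, ‖w‖ < r → ‖ψ w‖ < η
  map_eq : ∀ w, ‖w‖ < r → branchMap κ (ψ w) = w
  eq_of_map : ∀ w z, ‖w‖ < r → ‖z‖ < η → branchMap κ z = w → z = ψ w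
  lip : ∀ w w', ‖w‖ < r → ‖w'‖ < r →
    ‖Complex.log (1 + ψ w / 2) - Complex.log (1 + ψ w' / 2)‖ ≤ L * ‖w - w'‖
  cont : ∀ w, ‖w‖ < r → ContinuousAt ψ w
  quad : ∀ w, ‖w‖ < r → ‖ψ w - w‖ ≤ L * ‖w‖ ^ 2
  cubic : ∃ c₁ c₂ : ℂ, ∀ w, ‖w‖ < r → ‖ψ w - (c₁ * w + c₂ * w ^ 2)‖ ≤ L * ‖w‖ ^ 3
  cubic_log : ∃ c₁ c₂ : ℂ, ∀ w, ‖w‖ < r →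
    ‖Complex.log (1 + ψ w / 2) - (c₁ * w + c₂ * w ^ 2)‖ ≤ L * ‖w‖ ^ 3

theorem one_add_half_mem_slitPlane {z : ℂ} (hz : ‖z‖ ≤ 1) : 1 + z / 2 ∈ Complex.slitPlane := by
  rw [Complex.mem_slitPlane_iff]
  left
  have h1 := (abs_le.1 ((Complex.abs_re_le_norm z).trans hz)).1
  have : (1 + z / 2).re = 1 + z.re / 2 := by simp
  rw [this]; linarith

theorem hasStrictDerivAt_branchMap (κ : ℝ) {z : ℂ} (hz : ‖z‖ ≤ 1) :
    HasStrictDerivAt (branchMap κ) (Complex.exp (κ * Complex.log (1 + z / 2)) *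
      (1 + κ * z / (2 + z))) z := by
  have hs := one_add_half_mem_slitPlane hz
  have h0 : HasStrictDerivAt (fun z : ℂ => 1 + z / 2) (1 / 2) z :=
    ((hasStrictDerivAt_id z).div_const 2).const_add 1
  have h1 := ((h0.clog hs).const_mul (κ : ℂ)).cexp
  have h2 := (hasStrictDerivAt_id z).mul h1
  have hne : 2 + z ≠ 0 := by
    intro h
    have : 1 + z / 2 = 0 := by linear_combination h / 2
    rw [this] at hs; simp at hs
  refine h2.congr_deriv ?_
  have hne' : 1 + z / 2 ≠ 0 := Complex.slitPlane_ne_zero hs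
  have e : (1 : ℂ) / 2 / (1 + z / 2) = 1 / (2 + z) := by
    rw [div_div, div_eq_div_iff (by simpa using hne') hne]; ring
  rw [e]
  simp only [id]
  ring

theorem exists_cubic_bound {g : ℂ → ℂ} (hg : AnalyticAt ℂ g 0) (h0 : g 0 = 0) :
    ∃ c₁ c₂ : ℂ, (fun w => g w - (c₁ * w + c₂ * w ^ 2)) =O[𝓝 0] fun w => ‖w‖ ^ 3 := by
  obtain ⟨q, hq⟩ := hg
  refine ⟨q.coeff 1, q.coeff 2, (hq.isBigO_sub_partialSum_pow 3).congr_left fun w => ?_⟩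
  have hz : q.coeff 0 = 0 := by
    have := hq.coeff_zero (fun _ => 1)
    rw [FormalMultilinearSeries.coeff]
    rw [← h0, ← this]
    rfl
  simp [FormalMultilinearSeries.partialSum, Finset.sum_range_succ, hz]
  ring

/-- The derivative at `0` is `1`, so the inverse function theorem gives an analytic inverse. The
error bounds are its Taylor expansions and a local Lipschitz bound, with one radius and one constant
`L` for all of them. -/
theorem exists_inverseBranch (κ : ℝ) : Nonempty (InverseBranch κ) := by
  have hs0 := hasStrictDerivAt_branchMap κ (z := 0) (by simp)
  have hd0 : Complex.exp (κ * Complex.log (1 + (0 : ℂ) / 2)) * (1 + κ * 0 / (2 + 0)) ≠ 0 := by simp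
  have hs1 := hs0.hasStrictFDerivAt_equiv hd0
  set e := hs1.toOpenPartialHomeomorph (branchMap κ) with he
  have hcoe : (e : ℂ → ℂ) = branchMap κ := rfl
  have hmem : (0 : ℂ) ∈ e.source := hs1.mem_toOpenPartialHomeomorph_source
  have hb0 : branchMap κ 0 = 0 := by simp [branchMap]
  obtain ⟨η0, hη0, hsub0⟩ := Metric.isOpen_iff.1 e.open_source 0 hmem
  -- The second bound keeps the derivative away from `0`: a zero would give `2 + z = -κ z`, hence `2
  -- ≤ |κ|‖z‖ + ‖z‖ < 2`.
  set η := min η0 (1 / (1 + |κ|)) with hη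
  have hκ : 0 < 1 + |κ| := by positivity
  have hηpos : 0 < η := lt_min hη0 (by positivity)
  have hη1 : η ≤ 1 := (min_le_right _ _).trans (by rw [div_le_one hκ]; linarith [abs_nonneg κ])
  have hηκ : |κ| * η < 1 := by
    have : η ≤ 1 / (1 + |κ|) := min_le_right _ _
    rw [le_div_iff₀ hκ] at this
    nlinarith
  have hsymm0 : e.symm 0 = 0 := by
    have := e.left_inv hmem
    rw [hcoe, hb0] at this
    exact this
  have htar : (0 : ℂ) ∈ e.target := by
    have := e.map_source hmem
    rwa [hcoe, hb0] at this
  have hcont0 : ContinuousAt e.symm 0 := e.continuousAt_symm htar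
  have hev1 : ∀ᶠ w in 𝓝 (0 : ℂ), w ∈ e.target := e.open_target.mem_nhds htar
  have hev2 : ∀ᶠ w in 𝓝 (0 : ℂ), ‖e.symm w‖ < η := by
    have := hcont0.eventually (Metric.ball_mem_nhds _ hηpos)
    rw [hsymm0] at this
    simpa using this
  have hdiff : ∀ w ∈ e.target, ‖e.symm w‖ < η → DifferentiableAt ℂ e.symm w := by
    intro w hw hlt
    refine (e.hasDerivAt_symm hw ?_
      (hasStrictDerivAt_branchMap κ (hlt.le.trans hη1)).hasDerivAt).differentiableAt
    refine mul_ne_zero (Complex.exp_ne_zero _) fun h => ?_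
    set z := e.symm w
    have hne : 2 + z ≠ 0 := fun h' => by
      have : z = -2 := by linear_combination h'
      rw [this] at hlt; norm_num at hlt; linarith
    have h2 : 2 + z = -(κ * z) := by field_simp at h; linear_combination h
    have h3 : (2 : ℂ) = -(κ * z) - z := by linear_combination h2
    have h4 := congrArg norm h3
    have h5 := norm_sub_le (-(κ * z)) z
    rw [← h4, norm_neg, norm_mul, Complex.norm_real, Real.norm_eq_abs, Complex.norm_ofNat] at h5
    have : |κ| * ‖z‖ ≤ |κ| * η := mul_le_mul_of_nonneg_left hlt.le (abs_nonneg _)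
    linarith
  have hana : AnalyticAt ℂ e.symm 0 := by
    rw [Complex.analyticAt_iff_eventually_differentiableAt]
    filter_upwards [hev1, hev2] with w h1 h2 using hdiff w h1 h2
  have hanal : AnalyticAt ℂ (fun w => Complex.log (1 + e.symm w / 2)) 0 := by
    refine AnalyticAt.clog (analyticAt_const.add (hana.div analyticAt_const (by norm_num))) ?_
    rw [hsymm0]; simp
  obtain ⟨K, s, hs, hK⟩ := (hanal.contDiffAt (n := 1)).exists_lipschitzOnWith
  obtain ⟨c₁, c₂, hc⟩ := exists_cubic_bound hana hsymm0
  obtain ⟨d₁, d₂, hd⟩ := exists_cubic_bound hanal (by simp [hsymm0])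
  obtain ⟨M1, hM1⟩ := hc.bound
  obtain ⟨M2, hM2⟩ := hd.bound
  have hquad : (fun w => e.symm w - w) =O[𝓝 0] fun w => ‖w‖ ^ 2 := by
    have h1 : HasDerivAt e.symm (1 : ℂ)⁻¹ 0 := by
      refine e.hasDerivAt_symm htar one_ne_zero ?_
      rw [hsymm0]
      exact hs0.hasDerivAt.congr_deriv (by simp)
    obtain ⟨q, hq⟩ := hana
    refine (hq.isBigO_sub_partialSum_pow 2).congr_left fun w => ?_
    have hz : q.coeff 0 = 0 := by
      have := hq.coeff_zero (fun _ => 1)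
      rw [FormalMultilinearSeries.coeff]
      rw [← hsymm0, ← this]
      rfl
    have hone : q.coeff 1 = 1 := by
      have := hq.deriv
      rw [h1.deriv] at this
      rw [FormalMultilinearSeries.coeff]
      simpa using this.symm
    simp [FormalMultilinearSeries.partialSum, Finset.sum_range_succ, hz, hone]
  obtain ⟨M3, hM3⟩ := hquad.bound
  obtain ⟨r, hr, hball⟩ := Metric.eventually_nhds_iff_ball.1
    (hev1.and (hev2.and ((show ∀ᶠ w in 𝓝 (0 : ℂ), w ∈ s from hs).and (hM1.and (hM2.and hM3)))))
  have hb : ∀ w : ℂ, ‖w‖ < r → w ∈ Metric.ball (0 : ℂ) r := fun w hw => by simpa using hw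
  set L : ℝ := 1 + K + |M1| + |M2| + |M3| with hL
  have lK : (K : ℝ) ≤ L := by
    have := abs_nonneg M1; have := abs_nonneg M2; have := abs_nonneg M3; linarith
  have l1 : M1 ≤ L := by
    have := le_abs_self M1; have := abs_nonneg M2; have := abs_nonneg M3; have := K.2
    simp only [hL]; linarith [K.coe_nonneg]
  have l2 : M2 ≤ L := by
    have := le_abs_self M2; have := abs_nonneg M1; have := abs_nonneg M3
    simp only [hL]; linarith [K.coe_nonneg]
  have l3 : M3 ≤ L := by
    have := le_abs_self M3; have := abs_nonneg M2; have := abs_nonneg M1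
    simp only [hL]; linarith [K.coe_nonneg]
  refine ⟨⟨e.symm, r, η, L, hr, hηpos, hη1, by positivity, fun w hw => (hball w (hb w hw)).2.1,
    fun w hw => ?_, fun w z hw hz h => ?_, fun w w' hw hw' => ?_, fun w hw => ?_, fun w hw => ?_,
    ⟨c₁, c₂, fun w hw => ?_⟩, ⟨d₁, d₂, fun w hw => ?_⟩⟩⟩
  · rw [← hcoe]; exact e.right_inv (hball w (hb w hw)).1
  · have : z ∈ e.source := hsub0 (by
      simpa using lt_of_lt_of_le hz (min_le_left η0 (1 / (1 + |κ|))))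
    rw [← h, ← hcoe, e.left_inv this]
  · have := hK.dist_le_mul w (hball w (hb w hw)).2.2.1 w' (hball w' (hb w' hw')).2.2.1
    rw [dist_eq_norm, dist_eq_norm] at this
    exact this.trans (mul_le_mul_of_nonneg_right lK (norm_nonneg _))
  · exact e.continuousAt_symm (hball w (hb w hw)).1
  · have := (hball w (hb w hw)).2.2.2.2.2
    simp only [norm_pow, norm_norm] at this
    exact this.trans (mul_le_mul_of_nonneg_right l3 (by positivity))
  · have := (hball w (hb w hw)).2.2.2.1
    simp only [norm_pow, norm_norm] at this
    exact this.trans (mul_le_mul_of_nonneg_right l1 (by positivity))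
  · have := (hball w (hb w hw)).2.2.2.2.1
    simp only [norm_pow, norm_norm] at this
    exact this.trans (mul_le_mul_of_nonneg_right l2 (by positivity))

namespace InverseBranch

variable {κ : ℝ} (D : InverseBranch κ)

/-- The logarithm `log (1 + ψ/2)`. -/
def ell (w : ℂ) : ℂ := Complex.log (1 + D.ψ w / 2)

theorem ψ_zero : D.ψ 0 = 0 :=
  (D.eq_of_map 0 0 (by simpa using D.r_pos) (by simpa using D.η_pos) (by simp [branchMap])).symm

theorem norm_ell_le {w : ℂ} (hw : ‖w‖ < D.r) : ‖D.ell w‖ ≤ D.L * ‖w‖ := by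
  have := D.lip w 0 hw (by simpa using D.r_pos)
  rw [D.ψ_zero] at this
  simpa [ell] using this

theorem slit {w : ℂ} (hw : ‖w‖ < D.r) : 1 + D.ψ w / 2 ∈ Complex.slitPlane :=
  one_add_half_mem_slitPlane ((D.norm_lt w hw).le.trans D.η_le)

theorem exp_ell {w : ℂ} (hw : ‖w‖ < D.r) : Complex.exp (D.ell w) = 1 + D.ψ w / 2 :=
  Complex.exp_log (Complex.slitPlane_ne_zero (D.slit hw))

theorem ψ_eq {w : ℂ} (hw : ‖w‖ < D.r) : D.ψ w = w * Complex.exp (-(κ * D.ell w)) := by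
  have h := D.map_eq w hw
  rw [branchMap] at h
  rw [Complex.exp_neg, ← div_eq_mul_inv, eq_div_iff (Complex.exp_ne_zero _)]
  exact h

theorem ψ_conj {w : ℂ} (hw : ‖w‖ < D.r) :
    D.ψ ((starRingEnd ℂ) w) = (starRingEnd ℂ) (D.ψ w) := by
  refine (D.eq_of_map _ _ (by simpa using hw) (by simpa using D.norm_lt w hw) ?_).symm
  have h := congrArg (starRingEnd ℂ) (D.map_eq w hw)
  rw [← h, branchMap, branchMap, map_mul, ← Complex.exp_conj, map_mul, Complex.conj_ofReal,
    ← Complex.log_conj _ (Complex.slitPlane_arg_ne_pi (D.slit hw))]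
  simp [map_ofNat]

theorem ell_conj {w : ℂ} (hw : ‖w‖ < D.r) :
    D.ell ((starRingEnd ℂ) w) = (starRingEnd ℂ) (D.ell w) := by
  rw [ell, ell, ← Complex.log_conj _ (Complex.slitPlane_arg_ne_pi (D.slit hw)), D.ψ_conj hw]
  simp [map_ofNat]

end InverseBranch

/-! ### The roots for small `C` -/

theorem logPot_rootOffCut {N p j : ℕ} (hp : 0 < p) (hpN : p < N) {C : ℂ} (hC : OffCut C) {x : ℝ}
    (hx : labelF N p (rootOffCut N p j C) = x + phase C / Real.pi) :
    logPot N p (rootOffCut N p j C) = cutLog C + x * (Real.pi * Complex.I) := by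
  have hpi := Real.pi_pos.ne'
  apply Complex.ext
  · rw [logPot_re_rootOffCut j hp hpN hC, Complex.add_re, cutLog_re, Complex.re_ofReal_mul]
    simp
  · rw [logPot_im, hx, Complex.add_im, cutLog_im, Complex.im_ofReal_mul]
    simp
    field_simp
    ring

theorem log_one_add_eq {u : ℂ} (hu : ‖u - 1‖ ≤ 1) :
    Complex.log (u + 1) = Real.log 2 + Complex.log (1 + (u - 1) / 2) := by
  rw [← Complex.log_ofReal_mul (by norm_num)
    (Complex.slitPlane_ne_zero (one_add_half_mem_slitPlane hu))]
  congr 1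
  push_cast
  ring

theorem two_mul_exp (z : ℂ) : 2 * Complex.exp z = Complex.exp (Real.log 2 + z) := by
  rw [Complex.exp_add, ← Complex.ofReal_exp, Real.exp_log (by norm_num)]; norm_num

/-- The constant `C` is small enough for the inverse branches to describe the roots. -/
structure SmallFor {κ κ' : ℝ} (N p : ℕ) (D : InverseBranch κ) (D' : InverseBranch κ') (C : ℂ) :
    Prop where
  ne_zero : C ≠ 0
  right : ‖C‖ < D.η ^ p * (((N : ℝ) - p) / (2 * N)) ^ (N - p)
  left : ‖C‖ < D'.η ^ (N - p) * ((p : ℝ) / (2 * N)) ^ p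
  right_arg : 2 * Real.exp ((Real.log ‖C‖ - N * Real.log 2) / p) < D.r
  left_arg : 2 * Real.exp ((Real.log ‖C‖ - N * Real.log 2) / (N - p)) < D'.r

/-- The argument at which the inverse branch at `1` gives the root with label `j`. -/
def rightArg (N p j : ℕ) (z : ℂ) : ℂ :=
  2 * Complex.exp ((z - N * Real.log 2 + (-(p : ℝ) + 2 * ((j : ℝ) - 1) : ℝ)
    * (Real.pi * Complex.I)) / p)

/-- The argument at which the inverse branch at `-1` gives a root. -/
def leftArg (N p : ℕ) (z : ℂ) : ℂ :=
  2 * Complex.exp ((z - N * Real.log 2) / ((N : ℂ) - p))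

theorem norm_rightArg (N p j : ℕ) (z : ℂ) :
    ‖rightArg N p j z‖ = 2 * Real.exp ((z.re - N * Real.log 2) / p) := by
  rw [rightArg, norm_mul, Complex.norm_exp, Complex.norm_ofNat, Complex.div_natCast_re,
    Complex.add_re, Complex.re_ofReal_mul]
  generalize Real.log 2 = t
  simp

theorem norm_leftArg (N p : ℕ) (z : ℂ) :
    ‖leftArg N p z‖ = 2 * Real.exp ((z.re - N * Real.log 2) / (N - p)) := by
  have : ((N : ℂ) - p) = ((N - p : ℝ) : ℂ) := by push_cast; rfl
  rw [leftArg, norm_mul, Complex.norm_exp, Complex.norm_ofNat, this, Complex.div_ofReal_re]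
  generalize Real.log 2 = t
  simp

section
variable {κ κ' : ℝ} {N p : ℕ} {D : InverseBranch κ} {D' : InverseBranch κ'}

theorem SmallFor.rotate {C : ℂ} (h : SmallFor N p D D' C) (δ : ℝ) :
    SmallFor N p D D' (C * Complex.exp (δ * Complex.I)) :=
  ⟨mul_ne_zero h.ne_zero (Complex.exp_ne_zero _), by rw [norm_rotate]; exact h.right,
    by rw [norm_rotate]; exact h.left, by rw [norm_rotate]; exact h.right_arg,
    by rw [norm_rotate]; exact h.left_arg⟩

theorem SmallFor.norm_rightArg_lt {C : ℂ} (h : SmallFor N p D D' C) (j : ℕ) :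
    ‖rightArg N p j (cutLog C)‖ < D.r := by
  rw [norm_rightArg, cutLog_re]; exact h.right_arg

theorem SmallFor.norm_leftArg_lt {C : ℂ} (h : SmallFor N p D D' C) {z : ℂ}
    (hz : z.re = (cutLog C).re) : ‖-leftArg N p z‖ < D'.r := by
  rw [norm_neg, norm_leftArg, hz, cutLog_re]; exact h.left_arg

theorem lt_of_pow_mul_pow_lt {x y s t : ℝ} {m n : ℕ} (hx : 0 ≤ x) (ht : 0 < t) (hty : t ≤ y)
    (h : x ^ m * y ^ n < s ^ m * t ^ n) (hs : 0 ≤ s) : x < s := by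
  by_contra hcon
  push Not at hcon
  have h1 : s ^ m ≤ x ^ m := pow_le_pow_left₀ hs hcon m
  have h2 : t ^ n ≤ y ^ n := pow_le_pow_left₀ ht.le hty n
  have := mul_le_mul h1 h2 (by positivity) (by positivity)
  linarith

/-- Since `‖1 + u‖` is bounded below and `|C|` is tiny, `u` is close to `1`. Dividing the logarithm
of the root equation by `p` gives the branch equation, and the label fixes the choice of `p`-th
root. -/
theorem rootOffCut_right (hp : 0 < p) (hpN : p < N) (hκ : κ = ((N : ℝ) - p) / p) {C : ℂ}
    (hC : OffCut C) (h : SmallFor N p D D' C) {j : ℕ} (h1 : 1 ≤ j) (hj : j ≤ p) :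
    rootOffCut N p j C = 1 + D.ψ (rightArg N p j (cutLog C)) := by
  set u := rootOffCut N p j C with hu
  have hp' : (0 : ℝ) < p := by exact_mod_cast hp
  have hq : (p : ℝ) < N := by exact_mod_cast hpN
  have hpc : (p : ℂ) ≠ 0 := by exact_mod_cast hp.ne'
  have ho := rootOffCut_offSegment j hp hpN hC
  have hz : ‖u - 1‖ < D.η := by
    refine lt_of_pow_mul_pow_lt (m := p) (n := N - p) (norm_nonneg _)
      (div_pos (by linarith) (by linarith)) (norm_add_ge_of_le hp hpN hC h1 hj) ?_ D.η_pos.le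
    rw [add_comm (1 : ℂ), norm_root (rootOffCut_spec hp hpN hC).1]
    exact h.right
  have hF := labelF_rootOffCut_of_le hp hpN hC h1 hj
  have hpot := logPot_rootOffCut hp hpN hC hF
  rw [← hu, logPot, log_one_add_eq (hz.le.trans D.η_le)] at hpot
  have key : branchMap κ (u - 1) = rightArg N p j (cutLog C) := by
    rw [branchMap, rightArg]
    nth_rewrite 1 [← Complex.exp_log ho.sub_ne_zero]
    rw [← Complex.exp_add, two_mul_exp]
    congr 1
    have : cutLog C = p * Complex.log (u - 1) + ((N : ℂ) - p) * (Real.log 2 +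
      Complex.log (1 + (u - 1) / 2)) - (-(p : ℝ) + 2 * ((j : ℝ) - 1) : ℝ) *
        (Real.pi * Complex.I) := by linear_combination -hpot
    rw [this, hκ]
    push_cast
    field_simp
    ring
  have := D.eq_of_map _ _ (h.norm_rightArg_lt j) hz key
  linear_combination this

/-- The index of the last root and the momentum, for the largest and for the second
eigenvalue. -/
def IsChoice (N p s m : ℕ) : Prop := s = N ∧ m = 0 ∨ s = p + 1 ∧ m = 1

theorem IsChoice.mem {s m : ℕ} (h : IsChoice N p s m) (hpN : p < N) : p < s ∧ s ≤ N := by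
  rcases h with ⟨rfl, -⟩ | ⟨rfl, -⟩ <;> omega

/-- The roots `u_N` and `u_{p+1}` sit next to `-1` on opposite sides of the real axis, with `F`
equal to `-p - 2 + phase/π` and `p + phase/π`. Passing from `log (u - 1)` to `log (1 - u)` shifts by
`∓πi` and cancels the `∓p`, so only the shift `2π(1 - m)` is left. -/
theorem rootOffCut_left (hp : 0 < p) (hpN : p + 2 ≤ N) (hκ : κ' = (p : ℝ) / ((N : ℝ) - p)) {C : ℂ}
    (hC : OffCut C) (h : SmallFor N p D D' C) {s m : ℕ} (hs : IsChoice N p s m) :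
    rootOffCut N p s C =
      -1 - D'.ψ (-leftArg N p (cutLog C - 2 * Real.pi * (1 - m) * Complex.I)) := by
  have hlt : p < N := by omega
  set u := rootOffCut N p s C with hu
  have hp' : (0 : ℝ) < p := by exact_mod_cast hp
  have hq : (p : ℝ) + 2 ≤ N := by exact_mod_cast hpN
  have hqc : (N : ℂ) - p ≠ 0 := by
    have : ((N : ℝ) - p) ≠ 0 := by linarith
    exact_mod_cast this
  have hsm := hs.mem hlt
  have ho := rootOffCut_offSegment s hp hlt hC
  have hz : ‖-(u + 1)‖ < D'.η := by
    rw [norm_neg]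
    refine lt_of_pow_mul_pow_lt (m := N - p) (n := p) (norm_nonneg _)
      (div_pos (by linarith) (by linarith)) (norm_sub_ge_of_lt hp hlt hC hsm.1 hsm.2) ?_ D'.η_pos.le
    rw [mul_comm, norm_root (rootOffCut_spec hp hlt hC).1]
    exact h.left
  have f0 := phase_div_pi_pos C
  have f1 := hC.phase_div_pi_lt
  have hpot : p * Complex.log (1 - u) + ((N : ℂ) - p) * Complex.log (u + 1)
      = cutLog C - 2 * Real.pi * (1 - m) * Complex.I := by
    have hlogneg : u - 1 = -(1 - u) := by ring
    rcases hs with ⟨rfl, rfl⟩ | ⟨rfl, rfl⟩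
    · have hF := labelF_rootOffCut_of_mem (j := s) hp hlt hC 1 (by push_cast; linarith)
        (by push_cast; linarith)
      have hF' : labelF s p u = (-(p : ℝ) - 2 : ℝ) + phase C / Real.pi := by
        rw [hF]; push_cast; ring
      have him : u.im < 0 := (im_neg_iff_labelF_neg hp hlt ho).2 (by rw [← hu, hF']; linarith)
      have hpot := logPot_rootOffCut hp hlt hC hF'
      have hl : Complex.log (u - 1) = Complex.log (1 - u) - Real.pi * Complex.I := by
        rw [hlogneg, Complex.log, Complex.log, norm_neg,
          Complex.arg_neg_eq_arg_sub_pi_of_im_pos (by simpa using him)]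
        push_cast; ring
      rw [← hu, logPot, hl] at hpot
      push_cast at hpot ⊢
      linear_combination hpot
    · have hF := labelF_rootOffCut_of_mem (j := p + 1) hp hlt hC 0 (by push_cast; linarith)
        (by push_cast; linarith)
      have hF' : labelF N p u = (p : ℝ) + phase C / Real.pi := by
        rw [hF]; push_cast; ring
      have him : 0 < u.im := by
        have h1 : ¬ u.im < 0 := fun h => by
          have := (im_neg_iff_labelF_neg hp hlt ho).1 h
          rw [← hu] at this; linarith
        refine lt_of_le_of_ne (not_lt.1 h1) fun h0 => ?_
        rcases labelF_of_real (N := N) (p := p) ho h0.symm with ⟨-, h2⟩ | ⟨-, h2⟩ <;>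
          rw [← hu] at h2 <;> linarith
      have hpot := logPot_rootOffCut hp hlt hC hF'
      have hl : Complex.log (u - 1) = Complex.log (1 - u) + Real.pi * Complex.I := by
        rw [hlogneg, Complex.log, Complex.log, norm_neg,
          Complex.arg_neg_eq_arg_add_pi_of_im_neg (by simpa using him)]
        push_cast; ring
      rw [← hu, logPot, hl] at hpot
      push_cast at hpot ⊢
      linear_combination hpot
  have hl2 : Complex.log (1 - u) = Real.log 2 + Complex.log (1 + -(u + 1) / 2) := by
    rw [← Complex.log_ofReal_mul (by norm_num)
      (Complex.slitPlane_ne_zero (one_add_half_mem_slitPlane (hz.le.trans D'.η_le)))]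
    congr 1
    push_cast
    ring
  have key : branchMap κ' (-(u + 1)) =
      -leftArg N p (cutLog C - 2 * Real.pi * (1 - m) * Complex.I) := by
    rw [branchMap, leftArg, neg_mul, ← hpot]
    nth_rewrite 1 [← Complex.exp_log ho.add_ne_zero]
    rw [← hu, ← Complex.exp_add, two_mul_exp]
    congr 2
    rw [hl2, hκ]
    push_cast
    field_simp
    ring
  have := D'.eq_of_map _ _ (h.norm_leftArg_lt (by simp)) hz key
  linear_combination -this

/-- On the cut, both sides are limits from `Im C < 0`: the branch is continuous and `cutLog` follows
the rotation. -/
theorem betheRoot_right (hp : 0 < p) (hpN : p < N) (hκ : κ = ((N : ℝ) - p) / p) {C : ℂ}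
    (h : SmallFor N p D D' C) {j : ℕ} (h1 : 1 ≤ j) (hj : j ≤ p) :
    betheRoot N p j C = 1 + D.ψ (rightArg N p j (cutLog C)) := by
  by_cases hcut : OffCut C
  · rw [betheRoot_of_offCut hcut, rootOffCut_right hp hpN hκ hcut h h1 hj]
  · refine tendsto_nhds_unique (tendsto_betheRoot hp hpN h1 (hj.trans hpN.le) h.ne_zero hcut) ?_
    have hc : ContinuousAt (fun δ : ℝ => rightArg N p j (cutLog C + δ * Complex.I)) 0 := by
      unfold rightArg; fun_prop
    have hψ : ContinuousAt (fun δ : ℝ => 1 + D.ψ (rightArg N p j (cutLog C + δ * Complex.I))) 0 :=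
      continuousAt_const.add (ContinuousAt.comp (f := fun δ : ℝ =>
        rightArg N p j (cutLog C + δ * Complex.I))
        (D.cont _ (by simpa using h.norm_rightArg_lt j)) hc)
    have ht := hψ.tendsto.mono_left (nhdsWithin_le_nhds (s := Set.Iio 0))
    simp only [Complex.ofReal_zero, zero_mul, add_zero] at ht
    refine ht.congr' ?_
    filter_upwards [eventually_offCut_rotate h.ne_zero hcut] with δ hδ
    rw [rootOffCut_right hp hpN hκ hδ.2 (h.rotate δ) h1 hj,
      cutLog_rotate h.ne_zero hcut hδ.1.1 hδ.1.2.le]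

theorem betheRoot_left (hp : 0 < p) (hpN : p + 2 ≤ N) (hκ : κ' = (p : ℝ) / ((N : ℝ) - p)) {C : ℂ}
    (h : SmallFor N p D D' C) {s m : ℕ} (hs : IsChoice N p s m) :
    betheRoot N p s C =
      -1 - D'.ψ (-leftArg N p (cutLog C - 2 * Real.pi * (1 - m) * Complex.I)) := by
  by_cases hcut : OffCut C
  · rw [betheRoot_of_offCut hcut, rootOffCut_left hp hpN hκ hcut h hs]
  · have hsm := hs.mem (by omega)
    refine tendsto_nhds_unique (tendsto_betheRoot hp (by omega) (by omega) hsm.2 h.ne_zero hcut) ?_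
    have hc : ContinuousAt (fun δ : ℝ => -leftArg N p (cutLog C + δ * Complex.I
        - 2 * Real.pi * (1 - m) * Complex.I)) 0 := by
      unfold leftArg; fun_prop
    have hψ : ContinuousAt (fun δ : ℝ => -1 - D'.ψ (-leftArg N p (cutLog C + δ * Complex.I
        - 2 * Real.pi * (1 - m) * Complex.I))) 0 :=
      continuousAt_const.sub (ContinuousAt.comp (f := fun δ : ℝ =>
        -leftArg N p (cutLog C + δ * Complex.I - 2 * Real.pi * (1 - m) * Complex.I))
        (D'.cont _ (h.norm_leftArg_lt (by simp))) hc)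
    have ht := hψ.tendsto.mono_left (nhdsWithin_le_nhds (s := Set.Iio 0))
    simp only [Complex.ofReal_zero, zero_mul, add_zero] at ht
    refine ht.congr' ?_
    filter_upwards [eventually_offCut_rotate h.ne_zero hcut] with δ hδ
    rw [rootOffCut_left hp hpN hκ hδ.2 (h.rotate δ) hs,
      cutLog_rotate h.ne_zero hcut hδ.1.1 hδ.1.2.le]

end

/-! ### The consistency equation as a fixed point equation -/

/-- The leading order of the logarithm of the solution of the consistency equation with
momentum `m`. -/
def baseLog (N p m : ℕ) (γ : ℝ) : ℂ :=
  N * Real.log 2 + p * ((N : ℂ) - p) * γ + 2 * Real.pi * Complex.I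
    - 2 * Real.pi * m * p / N * Complex.I

/-- The argument of the inverse branch at `1` that gives the root with label `p`. -/
def wArg (N p m : ℕ) (γ : ℝ) (ε : ℂ) : ℂ :=
  -2 * Complex.exp (((N : ℂ) - p) * γ - 2 * Real.pi * m / N * Complex.I + ε / p)

/-- The argument of the inverse branch at `-1` that gives the last root, up to sign. -/
def yArg (N p m : ℕ) (γ : ℝ) (ε : ℂ) : ℂ :=
  2 * Complex.exp (p * γ + 2 * Real.pi * m / N * Complex.I + ε / ((N : ℂ) - p))

/-- A primitive `p`-th root of unity. -/
def zetaRoot (p : ℕ) : ℂ := Complex.exp (2 * Real.pi * Complex.I / p)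

theorem zetaRoot_primitive {p : ℕ} (hp : 0 < p) : IsPrimitiveRoot (zetaRoot p) p :=
  Complex.isPrimitiveRoot_exp p hp.ne'

theorem norm_zetaRoot {p : ℕ} (hp : 0 < p) : ‖zetaRoot p‖ = 1 :=
  (zetaRoot_primitive hp).norm'_eq_one hp.ne'

/-- The arguments for `j = 1, …, p` form a regular `p`-gon about the origin, with `j = p` giving `w`
itself. This is the source of the cancellations below. -/
theorem rightArg_baseLog {N p : ℕ} (hp : 0 < p) (hN : 0 < N) (m : ℕ) (γ : ℝ) (ε : ℂ) (j : ℕ) :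
    rightArg N p j (baseLog N p m γ + ε) = wArg N p m γ ε * zetaRoot p ^ j := by
  have hpc : (p : ℂ) ≠ 0 := by exact_mod_cast hp.ne'
  have hNc : (N : ℂ) ≠ 0 := by exact_mod_cast hN.ne'
  have e : Complex.exp (((N : ℂ) - p) * γ - 2 * Real.pi * m / N * Complex.I + ε / p)
      * zetaRoot p ^ j * Complex.exp (-(Real.pi * Complex.I))
      = Complex.exp ((baseLog N p m γ + ε - N * Real.log 2 + (-(p : ℝ) + 2 * ((j : ℝ) - 1) : ℝ)
        * (Real.pi * Complex.I)) / p) := by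
    rw [zetaRoot, ← Complex.exp_nat_mul, ← Complex.exp_add, ← Complex.exp_add]
    congr 1
    rw [baseLog]
    push_cast
    field_simp
    ring
  rw [rightArg, ← e, Complex.exp_neg, Complex.exp_pi_mul_I, wArg]
  ring

theorem leftArg_baseLog {N p : ℕ} (hp : 0 < p) (hpN : p < N) (m : ℕ) (γ : ℝ) (ε : ℂ) :
    leftArg N p (baseLog N p m γ + ε - 2 * Real.pi * (1 - m) * Complex.I) = yArg N p m γ ε := by
  have hNc : (N : ℂ) ≠ 0 := by exact_mod_cast (hp.trans hpN).ne'
  have hqc : (N : ℂ) - p ≠ 0 := by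
    have : ((N : ℝ) - p) ≠ 0 := by
      have : (p : ℝ) < N := by exact_mod_cast hpN
      linarith
    exact_mod_cast this
  rw [leftArg, yArg, baseLog]
  congr 2
  field_simp
  ring

section
variable {κ κ' : ℝ}

/-- The map whose fixed points are the solutions of the consistency equation. -/
def fixMap (D : InverseBranch κ) (D' : InverseBranch κ') (N p m : ℕ) (γ : ℝ) (ε : ℂ) : ℂ :=
  p * D'.ell (-yArg N p m γ ε) + ((N : ℂ) - p) * D.ell (wArg N p m γ ε)
    - ((N : ℂ) - p) * ∑ j ∈ Finset.Icc 1 p, D.ell (wArg N p m γ ε * zetaRoot p ^ j)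

/-- The deviation of the logarithm of `C` from its leading order. -/
def logDev (N p m : ℕ) (γ : ℝ) (C : ℂ) : ℂ := cutLog C - baseLog N p m γ

variable {N p : ℕ} {D : InverseBranch κ} {D' : InverseBranch κ'}

theorem SmallFor.wArg_lt {C : ℂ} (h : SmallFor N p D D' C) (hp : 0 < p) (hN : 0 < N) (m : ℕ)
    (γ : ℝ) (j : ℕ) : ‖wArg N p m γ (logDev N p m γ C) * zetaRoot p ^ j‖ < D.r := by
  rw [← rightArg_baseLog hp hN, logDev, add_sub_cancel]
  exact h.norm_rightArg_lt j

theorem SmallFor.wArg_lt' {C : ℂ} (h : SmallFor N p D D' C) (hp : 0 < p) (hN : 0 < N) (m : ℕ)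
    (γ : ℝ) : ‖wArg N p m γ (logDev N p m γ C)‖ < D.r := by
  simpa using h.wArg_lt hp hN m γ 0

theorem SmallFor.yArg_lt {C : ℂ} (h : SmallFor N p D D' C) (hp : 0 < p) (hpN : p < N) (m : ℕ)
    (γ : ℝ) : ‖-yArg N p m γ (logDev N p m γ C)‖ < D'.r := by
  rw [← leftArg_baseLog hp hpN, logDev, add_sub_cancel]
  exact h.norm_leftArg_lt (by simp)

theorem SmallFor.root_right {C : ℂ} (h : SmallFor N p D D' C) (hp : 0 < p) (hpN : p < N)
    (hκ : κ = ((N : ℝ) - p) / p) (m : ℕ) (γ : ℝ) {j : ℕ} (h1 : 1 ≤ j) (hj : j ≤ p) :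
    betheRoot N p j C = 1 + D.ψ (wArg N p m γ (logDev N p m γ C) * zetaRoot p ^ j) := by
  rw [betheRoot_right hp hpN hκ h h1 hj, ← rightArg_baseLog hp (hp.trans hpN), logDev,
    add_sub_cancel]

theorem SmallFor.root_p {C : ℂ} (h : SmallFor N p D D' C) (hp : 0 < p) (hpN : p < N)
    (hκ : κ = ((N : ℝ) - p) / p) (m : ℕ) (γ : ℝ) :
    betheRoot N p p C = 1 + D.ψ (wArg N p m γ (logDev N p m γ C)) := by
  rw [h.root_right hp hpN hκ m γ hp le_rfl, (zetaRoot_primitive hp).pow_eq_one, mul_one]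

theorem SmallFor.root_left {C : ℂ} (h : SmallFor N p D D' C) (hp : 0 < p) (hpN : p + 2 ≤ N)
    (hκ' : κ' = (p : ℝ) / ((N : ℝ) - p)) {s m : ℕ} (hs : IsChoice N p s m) (γ : ℝ) :
    betheRoot N p s C = -1 - D'.ψ (-yArg N p m γ (logDev N p m γ C)) := by
  rw [betheRoot_left hp hpN hκ' h hs, ← leftArg_baseLog hp (by omega), logDev, add_sub_cancel]

theorem ratio_cast (hκ' : κ' = (p : ℝ) / ((N : ℝ) - p)) : (κ' : ℂ) = (p : ℂ) / ((N : ℂ) - p) := by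
  rw [hκ']; push_cast; rfl

theorem betheRoot_last_add_one {C : ℂ} (h : SmallFor N p D D' C) (hp : 0 < p) (hpN : p + 2 ≤ N)
    (hκ' : κ' = (p : ℝ) / ((N : ℝ) - p)) {s m : ℕ} (hs : IsChoice N p s m) (γ : ℝ) :
    betheRoot N p s C + 1 = 2 * Complex.exp (p * γ + 2 * Real.pi * m / N * Complex.I
      + logDev N p m γ C / ((N : ℂ) - p) - κ' * D'.ell (-yArg N p m γ (logDev N p m γ C))) := by
  rw [h.root_left hp hpN hκ' hs γ, D'.ψ_eq (h.yArg_lt hp (by omega) m γ), sub_eq_add_neg _ ((κ' : ℂ) * _),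
    Complex.exp_add, ← mul_assoc, ← yArg]
  ring

/-- In the exponential form of the branches every logarithm is explicit: `γ` and the momentum cancel
by the choice of `baseLog`, and solving the remaining linear relation for `ε` gives `fixMap`. The
bound on the imaginary part keeps the logarithm of the ratio on the principal branch. -/
theorem logConsistency_iff {C : ℂ} (h : SmallFor N p D D' C) (hp : 0 < p) (hpN : p + 2 ≤ N)
    (hκ : κ = ((N : ℝ) - p) / p) (hκ' : κ' = (p : ℝ) / ((N : ℝ) - p)) {s m : ℕ}
    (hs : IsChoice N p s m) (γ : ℝ)
    (him : |(p * γ + 2 * Real.pi * m / N * Complex.I + logDev N p m γ C / ((N : ℂ) - p)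
      - κ' * D'.ell (-yArg N p m γ (logDev N p m γ C))
      - D.ell (wArg N p m γ (logDev N p m γ C))).im| < Real.pi) :
    LogConsistency N p s m γ C ↔
      logDev N p m γ C = fixMap D D' N p m γ (logDev N p m γ C) := by
  have hlt : p < N := by omega
  have hpc : (p : ℂ) ≠ 0 := by exact_mod_cast hp.ne'
  have hNc : (N : ℂ) ≠ 0 := by exact_mod_cast (hp.trans hlt).ne'
  have hqc : (N : ℂ) - p ≠ 0 := by
    have : ((N : ℝ) - p) ≠ 0 := by
      have : (p : ℝ) < N := by exact_mod_cast hlt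
      linarith
    exact_mod_cast this
  have hratio : Complex.log ((betheRoot N p s C + 1) / (betheRoot N p p C + 1))
      = p * γ + 2 * Real.pi * m / N * Complex.I + logDev N p m γ C / ((N : ℂ) - p)
      - κ' * D'.ell (-yArg N p m γ (logDev N p m γ C))
      - D.ell (wArg N p m γ (logDev N p m γ C)) := by
    have hw := h.wArg_lt' hp (hp.trans hlt) m γ
    rw [betheRoot_last_add_one h hp hpN hκ' hs γ]
    have e : betheRoot N p p C + 1 = 2 * Complex.exp (D.ell (wArg N p m γ (logDev N p m γ C))) := by
      rw [D.exp_ell hw, h.root_p hp hlt hκ m γ]; ring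
    rw [e, mul_div_mul_left _ _ two_ne_zero, ← Complex.exp_sub, Complex.log_exp]
    · exact (abs_lt.1 him).1
    · exact (abs_lt.1 him).2.le
  have hG : bigG N p C = 1 / p * ∑ j ∈ Finset.Icc 1 p,
      D.ell (wArg N p m γ (logDev N p m γ C) * zetaRoot p ^ j) := by
    have hterm : ∀ j ∈ Finset.Icc 1 p, Complex.log (1 + betheRoot N p j C)
        = Real.log 2 + D.ell (wArg N p m γ (logDev N p m γ C) * zetaRoot p ^ j) := by
      intro j hj
      rw [Finset.mem_Icc] at hj
      have hw := h.wArg_lt hp (hp.trans hlt) m γ j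
      rw [h.root_right hp hlt hκ m γ hj.1 hj.2, add_comm, log_one_add_eq, add_sub_cancel_left,
        InverseBranch.ell]
      rw [add_sub_cancel_left]
      exact (D.norm_lt _ hw).le.trans D.η_le
    rw [bigG, Finset.sum_congr rfl hterm, Finset.sum_add_distrib, Finset.sum_const]
    simp only [Nat.card_Icc, add_tsub_cancel_right, nsmul_eq_mul]
    field_simp
    ring
  rw [LogConsistency, and_iff_right h.ne_zero, hratio, hG, fixMap, ratio_cast hκ']
  generalize ∑ j ∈ Finset.Icc 1 p, D.ell (wArg N p m γ (logDev N p m γ C) * zetaRoot p ^ j) = S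
  generalize D.ell (wArg N p m γ (logDev N p m γ C)) = A
  generalize D'.ell (-yArg N p m γ (logDev N p m γ C)) = B
  generalize logDev N p m γ C = ε
  constructor
  · intro heq
    field_simp at heq
    have h2 : (N : ℂ) * (ε - (p * B + (N - p) * A - (N - p) * S)) = 0 := by
      linear_combination heq
    exact sub_eq_zero.1 ((mul_eq_zero.1 h2).resolve_left hNc)
  · intro heq
    field_simp
    linear_combination N * heq

theorem prod_zetaRoot {p : ℕ} (hp : 0 < p) :
    ∏ j ∈ Finset.Icc 1 p, zetaRoot p ^ j = (-1) ^ (p + 1) := by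
  have hpc : (p : ℂ) ≠ 0 := by exact_mod_cast hp.ne'
  rw [Finset.prod_pow_eq_pow_sum, zetaRoot, ← Complex.exp_nat_mul, ← Complex.exp_pi_mul_I,
    ← Complex.exp_nat_mul]
  congr 1
  have h2 : (∑ j ∈ Finset.Icc 1 p, j) * 2 = p * (p + 1) := by
    have := Finset.sum_range_id_mul_two (p + 1)
    rw [Finset.sum_range_succ', add_zero] at this
    rw [show Finset.Icc 1 p = Finset.Ico (0 + 1) (p + 1) from rfl,
      ← Finset.sum_Ico_add' (fun j => j) 0 p 1, ← Finset.range_eq_Ico, this]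
    simp; ring
  have h3 : ((∑ j ∈ Finset.Icc 1 p, j : ℕ) : ℂ) * 2 = p * (p + 1) := by exact_mod_cast h2
  push_cast at h3 ⊢
  field_simp
  linear_combination h3

theorem prod_choiceSet {M : Type*} [CommGroupWithZero M] {p s : ℕ} (hp : 0 < p) (hs : p < s)
    (f : ℕ → M) (hf : f p ≠ 0) :
    ∏ j ∈ choiceSet p s, f j = (∏ j ∈ Finset.Icc 1 p, f j) * f s / f p := by
  rw [choiceSet, Finset.prod_insert (by simp only [Finset.mem_Icc]; omega)]
  obtain ⟨n, rfl⟩ := Nat.exists_eq_succ_of_ne_zero hp.ne'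
  simp only [Nat.succ_eq_add_one, add_tsub_cancel_right] at hf ⊢
  rw [Finset.prod_Icc_succ_top (by omega)]
  field_simp

/-- The product equation is the exponential of the logarithmic one, so it determines the equation
only modulo `2πi`. Solving for `ε` scales this period by `p(N - p)/N`. -/
theorem exists_int_of_prod {C : ℂ} (h : SmallFor N p D D' C) (hp : 0 < p) (hpN : p + 2 ≤ N)
    (hκ : κ = ((N : ℝ) - p) / p) (hκ' : κ' = (p : ℝ) / ((N : ℝ) - p)) {s m : ℕ}
    (hs : IsChoice N p s m) (γ : ℝ)
    (hprod : 2 ^ N * (Real.exp (γ * N) : ℂ) * ∏ j ∈ choiceSet p s,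
      ((betheRoot N p j C - 1) / (betheRoot N p j C + 1)) + C = 0) :
    ∃ n : ℤ, fixMap D D' N p m γ (logDev N p m γ C) - logDev N p m γ C
      = (n * (2 * Real.pi * (p * ((N : ℝ) - p) / N)) : ℝ) * Complex.I := by
  have hlt : p < N := by omega
  have hpc : (p : ℂ) ≠ 0 := by exact_mod_cast hp.ne'
  have hNc : (N : ℂ) ≠ 0 := by exact_mod_cast (hp.trans hlt).ne'
  have hqc : (N : ℂ) - p ≠ 0 := by
    have : ((N : ℝ) - p) ≠ 0 := by
      have : (p : ℝ) < N := by exact_mod_cast hlt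
      linarith
    exact_mod_cast this
  have hκc : (κ : ℂ) = ((N : ℂ) - p) / p := by rw [hκ]; push_cast; rfl
  have hsm := hs.mem hlt
  set ε := logDev N p m γ C with hε
  set w := wArg N p m γ ε with hwdef
  set V : ℂ := ((N : ℂ) - p) * γ - 2 * Real.pi * m / N * Complex.I + ε / p with hV
  have hwV : w = -2 * Complex.exp V := rfl
  set X : ℂ := p * γ + 2 * Real.pi * m / N * Complex.I + ε / ((N : ℂ) - p)
    - κ' * D'.ell (-yArg N p m γ ε) with hX
  set B := D'.ell (-yArg N p m γ ε) with hB
  have hright : ∀ j ∈ Finset.Icc 1 p, (betheRoot N p j C - 1) / (betheRoot N p j C + 1)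
      = -Complex.exp V * zetaRoot p ^ j * Complex.exp (-(N / p * D.ell (w * zetaRoot p ^ j))) := by
    intro j hj
    rw [Finset.mem_Icc] at hj
    have hw := h.wArg_lt hp (hp.trans hlt) m γ j
    rw [← hε, ← hwdef] at hw
    have e1 : betheRoot N p j C - 1 = w * zetaRoot p ^ j *
        Complex.exp (-(κ * D.ell (w * zetaRoot p ^ j))) := by
      rw [← D.ψ_eq hw, h.root_right hp hlt hκ m γ hj.1 hj.2]; ring
    have e2 : betheRoot N p j C + 1 = 2 * Complex.exp (D.ell (w * zetaRoot p ^ j)) := by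
      rw [D.exp_ell hw, h.root_right hp hlt hκ m γ hj.1 hj.2, ← hε, ← hwdef]; ring
    have e3 : Complex.exp (-(κ * D.ell (w * zetaRoot p ^ j)))
        = Complex.exp (-(N / p * D.ell (w * zetaRoot p ^ j))) *
          Complex.exp (D.ell (w * zetaRoot p ^ j)) := by
      rw [← Complex.exp_add]
      congr 1
      rw [hκc]; field_simp; ring
    rw [e1, e2, e3, hwV, div_eq_iff (mul_ne_zero two_ne_zero (Complex.exp_ne_zero _))]
    ring
  have hp1 : (betheRoot N p p C - 1) / (betheRoot N p p C + 1)
      = -Complex.exp (V - N / p * D.ell w) := by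
    rw [hright p (Finset.mem_Icc.2 ⟨hp, le_rfl⟩), (zetaRoot_primitive hp).pow_eq_one, mul_one,
      mul_one, neg_mul, ← Complex.exp_add, sub_eq_add_neg]
  have hs1 : (betheRoot N p s C - 1) / (betheRoot N p s C + 1) = -Complex.exp (B - X) := by
    have hy := h.yArg_lt hp hlt m γ
    have e1 : betheRoot N p s C - 1 = -2 * Complex.exp B := by
      rw [hB, D'.exp_ell hy, h.root_left hp hpN hκ' hs γ]; ring
    rw [e1, betheRoot_last_add_one h hp hpN hκ' hs γ, ← hε, ← hB, ← hX, Complex.exp_sub B X]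
    rw [neg_mul, neg_div, mul_div_mul_left _ _ two_ne_zero]
  set S := ∑ j ∈ Finset.Icc 1 p, D.ell (w * zetaRoot p ^ j) with hS
  have hall : ∏ j ∈ Finset.Icc 1 p, ((betheRoot N p j C - 1) / (betheRoot N p j C + 1))
      = -Complex.exp (p * V - N / p * S) := by
    rw [Finset.prod_congr rfl hright, Finset.prod_mul_distrib, Finset.prod_mul_distrib,
      Finset.prod_const, prod_zetaRoot hp, ← Complex.exp_sum, Finset.sum_neg_distrib,
      ← Finset.mul_sum, ← hS, Nat.card_Icc, add_tsub_cancel_right, neg_pow, ← Complex.exp_nat_mul,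
      sub_eq_add_neg, Complex.exp_add]
    have : ((-1 : ℂ) ^ p) * (-1) ^ p = 1 := by rw [← mul_pow]; simp
    rw [pow_succ]
    linear_combination (-(Complex.exp (p * V) * Complex.exp (-(N / p * S)))) * this
  have hCe : C = 2 ^ N * Complex.exp (p * V) := by
    have e1 : cutLog C = baseLog N p m γ + ε := by rw [hε, logDev]; ring
    have e2 : baseLog N p m γ + ε = N * Real.log 2 + (p * V + 2 * Real.pi * Complex.I) := by
      rw [baseLog, hV]; field_simp; ring
    rw [← exp_cutLog h.ne_zero, e1, e2, Complex.exp_add, Complex.exp_add, Complex.exp_two_pi_mul_I,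
      mul_one, Complex.exp_nat_mul, ← Complex.ofReal_exp, Real.exp_log (by norm_num)]
    norm_num
  rw [prod_choiceSet hp hsm.1 _ (by rw [hp1]; exact neg_ne_zero.2 (Complex.exp_ne_zero _)), hall,
    hs1, hp1] at hprod
  -- The factor `C` cancels against `2^N e^{pV}`, where `V` is the exponent in `w = -2 e^V`; all
  -- signs cancel as well.
  have hone : Complex.exp (γ * N - N / p * S + (B - X) - (V - N / p * D.ell w)) = 1 := by
    have e1 : Complex.exp (γ * N - N / p * S + (B - X) - (V - N / p * D.ell w))
        * Complex.exp (p * V) = Complex.exp (γ * N) * (Complex.exp (p * V - N / p * S) *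
          Complex.exp (B - X) / Complex.exp (V - N / p * D.ell w)) := by
      rw [← Complex.exp_add, ← Complex.exp_add, ← Complex.exp_sub, ← Complex.exp_add]
      congr 1; ring
    have e2 : (2 : ℂ) ^ N * (Complex.exp (γ * N) * (Complex.exp (p * V - N / p * S) *
          Complex.exp (B - X) / Complex.exp (V - N / p * D.ell w)))
        = 2 ^ N * Complex.exp (p * V) := by
      have hd : -Complex.exp (p * V - N / p * S) * -Complex.exp (B - X) /
          -Complex.exp (V - N / p * D.ell w) = -(Complex.exp (p * V - N / p * S) *
          Complex.exp (B - X) / Complex.exp (V - N / p * D.ell w)) := by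
        rw [neg_mul_neg, div_neg]
      rw [hd, hCe] at hprod
      push_cast at hprod
      linear_combination -hprod
    have e3 := mul_left_cancel₀ (pow_ne_zero N two_ne_zero) e2
    rw [← e1] at e3
    exact mul_right_cancel₀ (Complex.exp_ne_zero (p * V)) (by rw [e3, one_mul])
  obtain ⟨n, hn⟩ := Complex.exp_eq_one_iff.1 hone
  refine ⟨n, ?_⟩
  rw [fixMap, ← hwdef, ← hS, ← hB]
  push_cast
  rw [hX, hV, ratio_cast hκ'] at hn
  rw [← sub_eq_zero] at hn ⊢
  field_simp at hn ⊢
  refine mul_left_cancel₀ hNc ?_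
  linear_combination hn

theorem betheEigenvalue_eq {C : ℂ} (h : SmallFor N p D D' C) (hp : 0 < p) (hpN : p + 2 ≤ N)
    (hκ : κ = ((N : ℝ) - p) / p) (hκ' : κ' = (p : ℝ) / ((N : ℝ) - p)) {s m : ℕ}
    (hs : IsChoice N p s m) (γ : ℝ) :
    betheEigenvalue N p (choiceSet p s) C = 1 / 2 *
      (∑ j ∈ Finset.Icc 1 p, D.ψ (wArg N p m γ (logDev N p m γ C) * zetaRoot p ^ j)
        - D.ψ (wArg N p m γ (logDev N p m γ C)) - 2
        - D'.ψ (-yArg N p m γ (logDev N p m γ C))) := by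
  have hlt : p < N := by omega
  have h1 : ∑ j ∈ Finset.Icc 1 p, (betheRoot N p j C - 1) =
      ∑ j ∈ Finset.Icc 1 p, D.ψ (wArg N p m γ (logDev N p m γ C) * zetaRoot p ^ j) := by
    refine Finset.sum_congr rfl fun j hj => ?_
    rw [Finset.mem_Icc] at hj
    rw [h.root_right hp hlt hκ m γ hj.1 hj.2]; ring
  rw [betheEigenvalue, sum_choiceSet (hs.mem hlt).1, ← h1, sum_Icc_pred hp,
    h.root_left hp hpN hκ' hs γ, h.root_p hp hlt hκ m γ]
  ring

end

/-! ### Contraction, cancellation and conjugation symmetry of the fixed point map -/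

theorem exists_fixedPoint_unitBall {f : ℂ → ℂ} (hmap : ∀ z, ‖z‖ ≤ 1 → ‖f z‖ ≤ 1)
    (hlip : ∀ z z', ‖z‖ ≤ 1 → ‖z'‖ ≤ 1 → ‖f z - f z'‖ ≤ 1 / 2 * ‖z - z'‖) :
    ∃ z, ‖z‖ ≤ 1 ∧ f z = z ∧ ∀ z', ‖z'‖ ≤ 1 → f z' = z' → z' = z := by
  let B := Metric.closedBall (0 : ℂ) 1
  have hB : ∀ z : B, ‖(z : ℂ)‖ ≤ 1 := fun z => mem_closedBall_zero_iff.1 z.2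
  let g : B → B := fun z => ⟨f z, by simpa [B] using hmap z (hB z)⟩
  have : CompleteSpace B := Metric.isClosed_closedBall.completeSpace_coe
  have : Nonempty B := ⟨⟨0, by simp [B]⟩⟩
  have hg : ContractingWith (1 / 2 : NNReal) g := by
    refine ⟨by rw [← NNReal.coe_lt_coe]; push_cast; norm_num, LipschitzWith.of_dist_le_mul ?_⟩
    intro z z'
    rw [Subtype.dist_eq, Subtype.dist_eq, dist_eq_norm, dist_eq_norm]
    simpa using hlip z z' (hB z) (hB z')
  have hfix := hg.fixedPoint_isFixedPt
  refine ⟨hg.fixedPoint, hB _, congrArg Subtype.val hfix, fun z' hz' hf => ?_⟩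
  have := hg.fixedPoint_unique (x := ⟨z', by simpa [B] using hz'⟩) (Subtype.ext hf)
  exact congrArg Subtype.val this

theorem norm_exp_sub_exp_le {z z' : ℂ} (hz : ‖z‖ ≤ 1) (hz' : ‖z'‖ ≤ 1) :
    ‖Complex.exp z - Complex.exp z'‖ ≤ 3 * ‖z - z'‖ := by
  refine (convex_closedBall (0 : ℂ) 1).norm_image_sub_le_of_norm_deriv_le (𝕜 := ℂ)
    (fun x _ => Complex.differentiable_exp x) (fun x hx => ?_) (by simpa using hz')
    (by simpa using hz)
  rw [Complex.deriv_exp, Complex.norm_exp]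
  have h1 : x.re ≤ 1 := (Complex.re_le_norm x).trans (by simpa using hx)
  exact (Real.exp_le_exp.2 h1).trans Real.exp_one_lt_three.le

theorem norm_wArg (N p m : ℕ) (γ : ℝ) (ε : ℂ) :
    ‖wArg N p m γ ε‖ = 2 * Real.exp (((N : ℝ) - p) * γ + ε.re / p) := by
  have e : ((N : ℂ) - p) * γ - 2 * Real.pi * m / N * Complex.I + ε / p
      = ((((N : ℝ) - p) * γ : ℝ) : ℂ) - ((2 * Real.pi * m / N : ℝ) : ℂ) * Complex.I + ε / p := by
    push_cast; rfl
  rw [wArg, norm_mul, Complex.norm_exp, e, Complex.add_re, Complex.sub_re, Complex.ofReal_re,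
    Complex.re_ofReal_mul, Complex.I_re, mul_zero, sub_zero, Complex.div_natCast_re]
  simp

theorem norm_yArg (N p m : ℕ) (γ : ℝ) (ε : ℂ) :
    ‖yArg N p m γ ε‖ = 2 * Real.exp (p * γ + ε.re / ((N : ℝ) - p)) := by
  have e : (p : ℂ) * γ + 2 * Real.pi * m / N * Complex.I + ε / ((N : ℂ) - p)
      = ((p * γ : ℝ) : ℂ) + ((2 * Real.pi * m / N : ℝ) : ℂ) * Complex.I
        + ε / (((N : ℝ) - p : ℝ) : ℂ) := by
    push_cast; rfl
  rw [yArg, norm_mul, Complex.norm_exp, e, Complex.add_re, Complex.add_re, Complex.ofReal_re,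
    Complex.re_ofReal_mul, Complex.I_re, mul_zero, add_zero, Complex.div_ofReal_re]
  simp

theorem wArg_eq (N p m : ℕ) (γ : ℝ) (ε : ℂ) :
    wArg N p m γ ε = wArg N p m γ 0 * Complex.exp (ε / p) := by
  rw [wArg, wArg, zero_div, add_zero, Complex.exp_add, ← mul_assoc]

theorem yArg_eq (N p m : ℕ) (γ : ℝ) (ε : ℂ) :
    yArg N p m γ ε = yArg N p m γ 0 * Complex.exp (ε / ((N : ℂ) - p)) := by
  rw [yArg, yArg, zero_div, add_zero, Complex.exp_add, ← mul_assoc]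

theorem norm_sub_natCast {N p : ℕ} (hpN : p ≤ N) : ‖(N : ℂ) - p‖ = (N : ℝ) - p := by
  have : ((N : ℂ) - p) = ((N - p : ℝ) : ℂ) := by push_cast; rfl
  rw [this, Complex.norm_real, Real.norm_eq_abs, abs_of_nonneg]
  have : (p : ℝ) ≤ N := by exact_mod_cast hpN
  linarith

theorem norm_div_natCast_le {p : ℕ} (hp : 0 < p) (ε : ℂ) : ‖ε / p‖ ≤ ‖ε‖ := by
  rw [norm_div, Complex.norm_natCast]
  exact div_le_self (norm_nonneg _) (by exact_mod_cast hp)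

theorem norm_div_sub_le {N p : ℕ} (hpN : p < N) (ε : ℂ) : ‖ε / ((N : ℂ) - p)‖ ≤ ‖ε‖ := by
  rw [norm_div, norm_sub_natCast hpN.le]
  have : (p : ℝ) + 1 ≤ N := by exact_mod_cast hpN
  exact div_le_self (norm_nonneg _) (by linarith)

theorem norm_exp_le_three {z : ℂ} (hz : ‖z‖ ≤ 1) : ‖Complex.exp z‖ ≤ 3 := by
  rw [Complex.norm_exp]
  exact (Real.exp_le_exp.2 ((Complex.re_le_norm z).trans hz)).trans Real.exp_one_lt_three.le

section
variable {N p : ℕ} {γ : ℝ}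

theorem norm_wArg_zero (N p m : ℕ) (γ : ℝ) :
    ‖wArg N p m γ 0‖ = 2 * Real.exp (((N : ℝ) - p) * γ) := by simp [norm_wArg]

theorem norm_yArg_zero (N p m : ℕ) (γ : ℝ) : ‖yArg N p m γ 0‖ = 2 * Real.exp (p * γ) := by
  simp [norm_yArg]

theorem norm_wArg_le (hp : 0 < p) (m : ℕ) {ε : ℂ} (hε : ‖ε‖ ≤ 1) :
    ‖wArg N p m γ ε‖ ≤ 6 * Real.exp (((N : ℝ) - p) * γ) := by
  rw [wArg_eq, norm_mul, norm_wArg_zero]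
  have := norm_exp_le_three ((norm_div_natCast_le hp ε).trans hε)
  nlinarith [Real.exp_pos (((N : ℝ) - p) * γ)]

theorem norm_yArg_le (hpN : p < N) (m : ℕ) {ε : ℂ} (hε : ‖ε‖ ≤ 1) :
    ‖yArg N p m γ ε‖ ≤ 6 * Real.exp (p * γ) := by
  rw [yArg_eq, norm_mul, norm_yArg_zero]
  have := norm_exp_le_three ((norm_div_sub_le hpN ε).trans hε)
  nlinarith [Real.exp_pos (p * γ)]

theorem norm_wArg_sub_le (hp : 0 < p) (m : ℕ) {ε ε' : ℂ} (hε : ‖ε‖ ≤ 1) (hε' : ‖ε'‖ ≤ 1) :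
    ‖wArg N p m γ ε - wArg N p m γ ε'‖ ≤ 6 * Real.exp (((N : ℝ) - p) * γ) * (‖ε - ε'‖ / p) := by
  rw [wArg_eq _ _ _ _ ε, wArg_eq _ _ _ _ ε', ← mul_sub, norm_mul, norm_wArg_zero]
  have := norm_exp_sub_exp_le ((norm_div_natCast_le hp ε).trans hε)
    ((norm_div_natCast_le hp ε').trans hε')
  rw [← sub_div, norm_div, Complex.norm_natCast] at this
  nlinarith [Real.exp_pos (((N : ℝ) - p) * γ)]

theorem norm_yArg_sub_le (hpN : p < N) (m : ℕ) {ε ε' : ℂ} (hε : ‖ε‖ ≤ 1) (hε' : ‖ε'‖ ≤ 1) :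
    ‖yArg N p m γ ε - yArg N p m γ ε'‖ ≤ 6 * Real.exp (p * γ) * (‖ε - ε'‖ / ((N : ℝ) - p)) := by
  rw [yArg_eq _ _ _ _ ε, yArg_eq _ _ _ _ ε', ← mul_sub, norm_mul, norm_yArg_zero]
  have := norm_exp_sub_exp_le ((norm_div_sub_le hpN ε).trans hε)
    ((norm_div_sub_le hpN ε').trans hε')
  rw [← sub_div, norm_div, norm_sub_natCast hpN.le] at this
  nlinarith [Real.exp_pos (p * γ)]

theorem sum_zetaRoot {p : ℕ} (hp : 1 < p) : ∑ j ∈ Finset.Icc 1 p, zetaRoot p ^ j = 0 := by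
  have h := (zetaRoot_primitive (by omega)).geom_sum_eq_zero hp
  have h1 : ∑ j ∈ Finset.range p, zetaRoot p ^ j * zetaRoot p = 0 := by
    rw [← Finset.sum_mul, h, zero_mul]
  rw [show Finset.Icc 1 p = Finset.Ico (0 + 1) (p + 1) from rfl,
    ← Finset.sum_Ico_add' (fun j => zetaRoot p ^ j) 0 p 1, ← Finset.range_eq_Ico]
  simpa only [pow_succ] using h1

theorem sum_zetaRoot_sq {p : ℕ} (hp : 2 < p) :
    ∑ j ∈ Finset.Icc 1 p, (zetaRoot p ^ j) ^ 2 = 0 := by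
  have hprim := zetaRoot_primitive (p := p) (by omega)
  have hne : zetaRoot p ^ 2 - 1 ≠ 0 := by
    intro h
    have h2 := hprim.dvd_of_pow_eq_one 2 (sub_eq_zero.1 h)
    exact absurd (Nat.le_of_dvd (by norm_num) h2) (by omega)
  have hg := mul_geom_sum (zetaRoot p ^ 2) p
  rw [← pow_mul, mul_comm 2 p, pow_mul, hprim.pow_eq_one, one_pow, sub_self] at hg
  have h := (mul_eq_zero.1 hg).resolve_left hne
  have h1 : ∑ j ∈ Finset.range p, (zetaRoot p ^ 2) ^ j * zetaRoot p ^ 2 = 0 := by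
    rw [← Finset.sum_mul, h, zero_mul]
  rw [show Finset.Icc 1 p = Finset.Ico (0 + 1) (p + 1) from rfl,
    ← Finset.sum_Ico_add' (fun j => (zetaRoot p ^ j) ^ 2) 0 p 1, ← Finset.range_eq_Ico]
  rw [← h1]
  refine Finset.sum_congr rfl fun j _ => ?_
  ring

/-- The first two powers cancel in a sum over the roots of unity. -/
theorem norm_sum_zetaRoot_le {p : ℕ} (hp : 2 < p) {f : ℂ → ℂ} {c₁ c₂ : ℂ} {L r : ℝ}
    (hf : ∀ w, ‖w‖ < r → ‖f w - (c₁ * w + c₂ * w ^ 2)‖ ≤ L * ‖w‖ ^ 3) {w : ℂ} (hw : ‖w‖ < r) :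
    ‖∑ j ∈ Finset.Icc 1 p, f (w * zetaRoot p ^ j)‖ ≤ p * (L * ‖w‖ ^ 3) := by
  have hn : ∀ j, ‖w * zetaRoot p ^ j‖ = ‖w‖ := fun j => by
    rw [norm_mul, norm_pow, norm_zetaRoot (by omega), one_pow, mul_one]
  -- Subtracting the linear and quadratic terms is free: their sums over the roots of unity vanish,
  -- the second because `p > 2`.
  have e : ∑ j ∈ Finset.Icc 1 p, f (w * zetaRoot p ^ j) = ∑ j ∈ Finset.Icc 1 p,
      (f (w * zetaRoot p ^ j) - (c₁ * (w * zetaRoot p ^ j) + c₂ * (w * zetaRoot p ^ j) ^ 2)) := by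
    simp only [mul_pow, ← mul_assoc]
    rw [Finset.sum_sub_distrib, Finset.sum_add_distrib, ← Finset.mul_sum, ← Finset.mul_sum,
      sum_zetaRoot (by omega), sum_zetaRoot_sq hp]
    ring
  rw [e]
  refine (norm_sum_le_of_le _ fun j _ => ?_).trans (b := ∑ j ∈ Finset.Icc 1 p, L * ‖w‖ ^ 3) ?_
  · have := hf (w * zetaRoot p ^ j) (by rw [hn]; exact hw)
    rwa [hn] at this
  · rw [Finset.sum_const, Nat.card_Icc, add_tsub_cancel_right, nsmul_eq_mul]

end

section
variable {κ κ' : ℝ} {D : InverseBranch κ} {D' : InverseBranch κ'} {N p : ℕ} {γ : ℝ}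

theorem norm_fixMap_le_of_sum (hpN : p < N) {m : ℕ} {ε : ℂ} {x y M : ℝ}
    (hw : ‖wArg N p m γ ε‖ ≤ x) (hx : x < D.r) (hy : ‖yArg N p m γ ε‖ ≤ y) (hyr : y < D'.r)
    (hM : ‖∑ j ∈ Finset.Icc 1 p, D.ell (wArg N p m γ ε * zetaRoot p ^ j)‖ ≤ M) :
    ‖fixMap D D' N p m γ ε‖ ≤ p * (D'.L * y) + ((N : ℝ) - p) * (D.L * x)
      + ((N : ℝ) - p) * M := by
  have hq : (0 : ℝ) < (N : ℝ) - p := by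
    have : (p : ℝ) < N := by exact_mod_cast hpN
    linarith
  have hL := D.L_pos
  have hL' := D'.L_pos
  have h1 : ‖D'.ell (-yArg N p m γ ε)‖ ≤ D'.L * y :=
    (D'.norm_ell_le (by rw [norm_neg]; linarith)).trans (by rw [norm_neg]; gcongr)
  have h2 : ‖D.ell (wArg N p m γ ε)‖ ≤ D.L * x :=
    (D.norm_ell_le (by linarith)).trans (by gcongr)
  rw [fixMap]
  refine (norm_sub_le _ _).trans (add_le_add ((norm_add_le _ _).trans (add_le_add ?_ ?_)) ?_)
  · rw [norm_mul, Complex.norm_natCast]; gcongr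
  · rw [norm_mul, norm_sub_natCast hpN.le]; gcongr
  · rw [norm_mul, norm_sub_natCast hpN.le]; gcongr

/-- A crude bound for the fixed point map. -/
theorem norm_fixMap_le (hp : 0 < p) (hpN : p < N) {m : ℕ} {ε : ℂ} {x y : ℝ}
    (hw : ‖wArg N p m γ ε‖ ≤ x) (hx : x < D.r) (hy : ‖yArg N p m γ ε‖ ≤ y) (hyr : y < D'.r) :
    ‖fixMap D D' N p m γ ε‖ ≤ p * (D'.L * y) + ((N : ℝ) - p) * (D.L * x)
      + ((N : ℝ) - p) * (p * (D.L * x)) := by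
  have hL := D.L_pos
  refine norm_fixMap_le_of_sum hpN hw hx hy hyr ?_
  refine (norm_sum_le_of_le _ fun j _ => ?_).trans (b := ∑ j ∈ Finset.Icc 1 p, D.L * x) ?_
  · have hn : ‖wArg N p m γ ε * zetaRoot p ^ j‖ = ‖wArg N p m γ ε‖ := by
      rw [norm_mul, norm_pow, norm_zetaRoot hp, one_pow, mul_one]
    exact (D.norm_ell_le (by rw [hn]; linarith)).trans (by rw [hn]; gcongr)
  · rw [Finset.sum_const, Nat.card_Icc, add_tsub_cancel_right, nsmul_eq_mul]

/-- The bound for the fixed point map that uses the cancellation among roots of unity. -/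
theorem norm_fixMap_le_of_cancel (hp : 2 < p) (hpN : p < N) {m : ℕ} {ε : ℂ} {x y : ℝ}
    (hw : ‖wArg N p m γ ε‖ ≤ x) (hx : x < D.r) (hy : ‖yArg N p m γ ε‖ ≤ y) (hyr : y < D'.r) :
    ‖fixMap D D' N p m γ ε‖ ≤ p * (D'.L * y) + ((N : ℝ) - p) * (D.L * x)
      + ((N : ℝ) - p) * (p * (D.L * x ^ 3)) := by
  have hL := D.L_pos
  refine norm_fixMap_le_of_sum hpN hw hx hy hyr ?_
  obtain ⟨c₁, c₂, hc⟩ := D.cubic_log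
  exact (norm_sum_zetaRoot_le hp (f := D.ell) hc (by linarith)).trans (by gcongr)

/-- No cancellation is needed for the contraction: the Lipschitz constant is polynomial in `N` times
exponentially small factors. -/
theorem norm_fixMap_sub_le (hp : 0 < p) (hpN : p < N) {m : ℕ} {ε ε' : ℂ} (hε : ‖ε‖ ≤ 1)
    (hε' : ‖ε'‖ ≤ 1) (hx : 6 * Real.exp (((N : ℝ) - p) * γ) < D.r)
    (hyr : 6 * Real.exp (p * γ) < D'.r) :
    ‖fixMap D D' N p m γ ε - fixMap D D' N p m γ ε'‖ ≤
      (p * (D'.L * (6 * Real.exp (p * γ)))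
        + ((N : ℝ) - p) * (D.L * (6 * Real.exp (((N : ℝ) - p) * γ)))
        + ((N : ℝ) - p) * (p * (D.L * (6 * Real.exp (((N : ℝ) - p) * γ))))) * ‖ε - ε'‖ := by
  have hq : (1 : ℝ) ≤ (N : ℝ) - p := by
    have : (p : ℝ) + 1 ≤ N := by exact_mod_cast hpN
    linarith
  have hp1 : (1 : ℝ) ≤ p := by exact_mod_cast hp
  have hL := D.L_pos
  have hL' := D'.L_pos
  have hyd : ‖yArg N p m γ ε - yArg N p m γ ε'‖ ≤ 6 * Real.exp (p * γ) * ‖ε - ε'‖ :=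
    (norm_yArg_sub_le hpN m hε hε').trans
      (mul_le_mul_of_nonneg_left (div_le_self (norm_nonneg _) hq) (by positivity))
  have hwd : ‖wArg N p m γ ε - wArg N p m γ ε'‖ ≤
      6 * Real.exp (((N : ℝ) - p) * γ) * ‖ε - ε'‖ :=
    (norm_wArg_sub_le hp m hε hε').trans
      (mul_le_mul_of_nonneg_left (div_le_self (norm_nonneg _) hp1) (by positivity))
  have hwl := (norm_wArg_le (N := N) (γ := γ) hp m hε).trans_lt hx
  have hwl' := (norm_wArg_le (N := N) (γ := γ) hp m hε').trans_lt hx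
  have hyl := (norm_yArg_le (γ := γ) hpN m hε).trans_lt hyr
  have hyl' := (norm_yArg_le (γ := γ) hpN m hε').trans_lt hyr
  have h1 : ‖D'.ell (-yArg N p m γ ε) - D'.ell (-yArg N p m γ ε')‖
      ≤ D'.L * (6 * Real.exp (p * γ) * ‖ε - ε'‖) := by
    refine (D'.lip _ _ (by rwa [norm_neg]) (by rwa [norm_neg])).trans ?_
    rw [neg_sub_neg, norm_sub_rev]; gcongr
  have h2 : ‖D.ell (wArg N p m γ ε) - D.ell (wArg N p m γ ε')‖
      ≤ D.L * (6 * Real.exp (((N : ℝ) - p) * γ) * ‖ε - ε'‖) :=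
    (D.lip _ _ hwl hwl').trans (by gcongr)
  have h3 : ‖∑ j ∈ Finset.Icc 1 p, (D.ell (wArg N p m γ ε * zetaRoot p ^ j)
      - D.ell (wArg N p m γ ε' * zetaRoot p ^ j))‖
      ≤ p * (D.L * (6 * Real.exp (((N : ℝ) - p) * γ) * ‖ε - ε'‖)) := by
    refine (norm_sum_le_of_le _ fun j _ => ?_).trans (b := ∑ j ∈ Finset.Icc 1 p,
      D.L * (6 * Real.exp (((N : ℝ) - p) * γ) * ‖ε - ε'‖)) ?_
    · have hn : ∀ w : ℂ, ‖w * zetaRoot p ^ j‖ = ‖w‖ := fun w => by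
        rw [norm_mul, norm_pow, norm_zetaRoot hp, one_pow, mul_one]
      refine (D.lip _ _ (by rwa [hn]) (by rwa [hn])).trans ?_
      rw [← sub_mul, hn]; gcongr
    · rw [Finset.sum_const, Nat.card_Icc, add_tsub_cancel_right, nsmul_eq_mul]
  rw [Finset.sum_sub_distrib] at h3
  have e : fixMap D D' N p m γ ε - fixMap D D' N p m γ ε' =
      p * (D'.ell (-yArg N p m γ ε) - D'.ell (-yArg N p m γ ε'))
      + ((N : ℂ) - p) * (D.ell (wArg N p m γ ε) - D.ell (wArg N p m γ ε'))
      - ((N : ℂ) - p) * (∑ j ∈ Finset.Icc 1 p, D.ell (wArg N p m γ ε * zetaRoot p ^ j)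
        - ∑ j ∈ Finset.Icc 1 p, D.ell (wArg N p m γ ε' * zetaRoot p ^ j)) := by
    rw [fixMap, fixMap]; ring
  rw [e]
  have g1 : ‖(p : ℂ) * (D'.ell (-yArg N p m γ ε) - D'.ell (-yArg N p m γ ε'))‖
      ≤ p * (D'.L * (6 * Real.exp (p * γ) * ‖ε - ε'‖)) := by
    rw [norm_mul, Complex.norm_natCast]; gcongr
  have g2 : ‖((N : ℂ) - p) * (D.ell (wArg N p m γ ε) - D.ell (wArg N p m γ ε'))‖
      ≤ ((N : ℝ) - p) * (D.L * (6 * Real.exp (((N : ℝ) - p) * γ) * ‖ε - ε'‖)) := by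
    rw [norm_mul, norm_sub_natCast hpN.le]; gcongr
  have g3 : ‖((N : ℂ) - p) * (∑ j ∈ Finset.Icc 1 p, D.ell (wArg N p m γ ε * zetaRoot p ^ j)
        - ∑ j ∈ Finset.Icc 1 p, D.ell (wArg N p m γ ε' * zetaRoot p ^ j))‖
      ≤ ((N : ℝ) - p) * (p * (D.L * (6 * Real.exp (((N : ℝ) - p) * γ) * ‖ε - ε'‖))) := by
    rw [norm_mul, norm_sub_natCast hpN.le]; gcongr
  refine (norm_sub_le _ _).trans ((add_le_add ((norm_add_le _ _).trans (add_le_add g1 g2))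
    g3).trans_eq (by ring))

/-- At momentum `0` the branches and their arguments have real coefficients, and conjugation
permutes the roots of unity. It follows that the fixed point is real. -/
theorem fixMap_conj (hp : 0 < p) {ε : ℂ} (hw : ‖wArg N p 0 γ ε‖ < D.r)
    (hy : ‖yArg N p 0 γ ε‖ < D'.r) :
    fixMap D D' N p 0 γ (starRingEnd ℂ ε) = starRingEnd ℂ (fixMap D D' N p 0 γ ε) := by
  have hwc : wArg N p 0 γ (starRingEnd ℂ ε) = starRingEnd ℂ (wArg N p 0 γ ε) := by
    simp [wArg, ← Complex.exp_conj, Complex.conj_ofReal, map_ofNat]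
  have hyc : yArg N p 0 γ (starRingEnd ℂ ε) = starRingEnd ℂ (yArg N p 0 γ ε) := by
    simp [yArg, ← Complex.exp_conj, Complex.conj_ofReal, map_ofNat]
  have hzc : starRingEnd ℂ (zetaRoot p) = (zetaRoot p)⁻¹ := by
    rw [Complex.inv_def, Complex.normSq_eq_norm_sq, norm_zetaRoot hp]; simp
  have hn : ∀ j, ‖wArg N p 0 γ ε * zetaRoot p ^ j‖ < D.r := fun j => by
    rwa [norm_mul, norm_pow, norm_zetaRoot hp, one_pow, mul_one]
  have hsum : ∑ j ∈ Finset.Icc 1 p, D.ell (starRingEnd ℂ (wArg N p 0 γ ε) * zetaRoot p ^ j)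
      = starRingEnd ℂ (∑ j ∈ Finset.Icc 1 p, D.ell (wArg N p 0 γ ε * zetaRoot p ^ j)) := by
    rw [map_sum]
    have e0 : ∑ j ∈ Finset.Icc 1 p, starRingEnd ℂ (D.ell (wArg N p 0 γ ε * zetaRoot p ^ j))
        = ∑ j ∈ Finset.range p, starRingEnd ℂ (D.ell (wArg N p 0 γ ε * zetaRoot p ^ j)) := by
      rw [show Finset.Icc 1 p = Finset.Ico (0 + 1) (p + 1) from rfl, Finset.sum_Ico_succ_top hp,
        (zetaRoot_primitive hp).pow_eq_one, Finset.range_eq_Ico, Finset.sum_eq_sum_Ico_succ_bot hp,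
        pow_zero, add_comm]
    rw [e0]
    -- Conjugation sends `ζ^j` to `ζ^{p-j}`; the range `1, …, p` on one side and `0, …, p - 1` on
    -- the other makes this an exact reflection.
    refine Finset.sum_nbij' (fun j => p - j) (fun j => p - j) ?_ ?_ ?_ ?_ ?_
    · intro j hj; rw [Finset.mem_Icc] at hj; rw [Finset.mem_range]; omega
    · intro j hj; rw [Finset.mem_range] at hj; rw [Finset.mem_Icc]; omega
    · intro j hj; rw [Finset.mem_Icc] at hj; omega
    · intro j hj; rw [Finset.mem_range] at hj; omega
    · intro j hj
      rw [Finset.mem_Icc] at hj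
      rw [← D.ell_conj (hn _)]
      congr 1
      rw [map_mul, map_pow, hzc]
      congr 1
      rw [inv_pow]
      refine eq_inv_of_mul_eq_one_left ?_
      rw [← pow_add, Nat.add_sub_cancel' hj.2, (zetaRoot_primitive hp).pow_eq_one]
  rw [fixMap, fixMap, hwc, hyc, hsum, ← map_neg, D'.ell_conj (by rwa [norm_neg]), D.ell_conj hw]
  simp

end

/-! ### Estimates along `N = k b`, `p = k a` -/

theorem tendsto_pow_mul_exp_neg (n : ℕ) {t : ℝ} (ht : 0 < t) :
    Tendsto (fun k : ℕ => (k : ℝ) ^ n * Real.exp (-(t * k))) atTop (𝓝 0) := by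
  have h := tendsto_pow_const_mul_const_pow_of_abs_lt_one n (r := Real.exp (-t))
    (by rw [abs_of_pos (Real.exp_pos _), Real.exp_lt_one_iff]; linarith)
  refine h.congr fun k => ?_
  rw [← Real.exp_nat_mul]
  congr 2; ring

theorem tendsto_const_mul_exp_neg (X : ℝ) {t : ℝ} (ht : 0 < t) :
    Tendsto (fun k : ℕ => X * Real.exp (-(t * k))) atTop (𝓝 0) := by
  simpa using (tendsto_pow_mul_exp_neg 0 ht).const_mul X

theorem tendsto_fixMap_bound (A B L L' X Y : ℝ) {s t : ℝ} (hs : 0 < s) (ht : 0 < t) :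
    Tendsto (fun k : ℕ => k * A * (L' * (Y * Real.exp (-(t * k))))
      + k * B * (L * (X * Real.exp (-(s * k))))
      + k * B * (k * A * (L * (X * Real.exp (-(s * k)))))) atTop (𝓝 0) := by
  have h1 := (tendsto_pow_mul_exp_neg 1 ht).const_mul (A * L' * Y)
  have h2 := (tendsto_pow_mul_exp_neg 1 hs).const_mul (B * L * X)
  have h3 := (tendsto_pow_mul_exp_neg 2 hs).const_mul (B * A * L * X)
  have h := (h1.add h2).add h3
  simp only [mul_zero, add_zero] at h
  exact h.congr fun k => by ring

theorem eventually_exp_lt_pow {c R : ℝ} (hc : 0 < c) (hR : 0 < R) :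
    ∀ᶠ k : ℕ in atTop, Real.exp (-(c * k ^ 2)) < R ^ k := by
  filter_upwards [eventually_le_mul_nat hc (1 - Real.log R), eventually_ge_atTop 1] with k h1 hk
  have hk' : (1 : ℝ) ≤ k := by exact_mod_cast hk
  rw [← Real.exp_log (pow_pos hR k), Real.log_pow, Real.exp_lt_exp]
  nlinarith

theorem log_div_le {c t x : ℝ} (ht : 0 < t) {k b : ℕ} (hk : 0 < k) (hx : x ≤ -(c * k ^ 2)) :
    (x - (k * b : ℝ) * Real.log 2) / (k * t) ≤ -(c / t * k) := by
  have hk' : (0 : ℝ) < k := by exact_mod_cast hk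
  have h0 : 0 ≤ (k * b : ℝ) * Real.log 2 := by
    have := Real.log_pos one_lt_two
    positivity
  rw [div_le_iff₀ (by positivity)]
  have : -(c / t * k) * (k * t) = -(c * k ^ 2) := by field_simp
  linarith

theorem abs_logDev_im_le {N p s m : ℕ} (hp : 0 < p) (hpN : p < N) (hs : IsChoice N p s m) (γ : ℝ)
    (C : ℂ) : |(logDev N p m γ C).im| ≤ 2 * Real.pi := by
  have hpi := Real.pi_pos
  have hN : (0 : ℝ) < N := by exact_mod_cast hp.trans hpN
  have e : baseLog N p m γ = ((N * Real.log 2 + p * ((N : ℝ) - p) * γ : ℝ) : ℂ)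
      + ((2 * Real.pi - 2 * Real.pi * m * p / N : ℝ) : ℂ) * Complex.I := by
    rw [baseLog]; push_cast; ring
  have him : (logDev N p m γ C).im = phase C - 2 * Real.pi + 2 * Real.pi * (m * p / N) := by
    rw [logDev, Complex.sub_im, cutLog_im, e, Complex.add_im, Complex.ofReal_im,
      Complex.im_ofReal_mul, Complex.I_im]
    ring
  have h1 := phase_pos C
  have h2 := phase_le C
  have h3 : (m * p / N : ℝ) ≤ 1 := by
    rw [div_le_one hN]
    have : (p : ℝ) ≤ N := by exact_mod_cast hpN.le
    rcases hs with ⟨-, rfl⟩ | ⟨-, rfl⟩ <;> push_cast <;> linarith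
  have h4 : (0 : ℝ) ≤ m * p / N := by positivity
  rw [him, abs_le]
  constructor <;> nlinarith

section
variable {a b : ℕ} {γ : ℝ} {D : InverseBranch (((b : ℝ) - a) / a)}
  {D' : InverseBranch ((a : ℝ) / ((b : ℝ) - a))}

theorem ratio_scale (ha : 0 < a) {k : ℕ} (hk : 0 < k) :
    ((b : ℝ) - a) / a = (((k * b : ℕ) : ℝ) - (k * a : ℕ)) / (k * a : ℕ) := by
  have : (0 : ℝ) < k := by exact_mod_cast hk
  have : (0 : ℝ) < a := by exact_mod_cast ha
  push_cast
  field_simp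

theorem ratio_scale' {k : ℕ} (hk : 0 < k) :
    (a : ℝ) / ((b : ℝ) - a) = (k * a : ℕ) / (((k * b : ℕ) : ℝ) - (k * a : ℕ)) := by
  have : (0 : ℝ) < k := by exact_mod_cast hk
  push_cast
  rw [← mul_sub, mul_div_mul_left _ _ this.ne']

/-- The thresholds on `‖C‖` are of the form `R^k`, while `‖C‖ ≤ e^{-ck²}`. After division of `log
‖C‖` by `p` or `N - p` the branch arguments still decay like `e^{-c'k}`. -/
theorem eventually_smallFor (ha : 0 < a) (hab : a < b) (D : InverseBranch (((b : ℝ) - a) / a))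
    (D' : InverseBranch ((a : ℝ) / ((b : ℝ) - a))) {c : ℝ} (hc : 0 < c) :
    ∀ᶠ k : ℕ in atTop, ∀ C : ℂ, C ≠ 0 → Real.log ‖C‖ ≤ -(c * k ^ 2) →
      SmallFor (k * b) (k * a) D D' C := by
  have ha' : (0 : ℝ) < a := by exact_mod_cast ha
  have hb' : (0 : ℝ) < (b : ℝ) - a := by
    have : (a : ℝ) < b := by exact_mod_cast hab
    linarith
  have hbp : (0 : ℝ) < b := by linarith
  have hη := D.η_pos
  have hη' := D'.η_pos
  have h1 := eventually_exp_lt_pow hc (R := D.η ^ a * (((b : ℝ) - a) / (2 * b)) ^ (b - a))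
    (by positivity)
  have h2 := eventually_exp_lt_pow hc (R := D'.η ^ (b - a) * ((a : ℝ) / (2 * b)) ^ a)
    (by positivity)
  have h3 := (tendsto_const_mul_exp_neg 2 (div_pos hc ha')).eventually_lt_const D.r_pos
  have h4 := (tendsto_const_mul_exp_neg 2 (div_pos hc hb')).eventually_lt_const D'.r_pos
  filter_upwards [h1, h2, h3, h4, eventually_ge_atTop 1] with k h1 h2 h3 h4 hk C hC hdeep
  have hk' : (0 : ℝ) < k := by exact_mod_cast hk
  have hCexp : ‖C‖ ≤ Real.exp (-(c * k ^ 2)) := by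
    rw [← Real.exp_log (norm_pos_iff.2 hC)]; exact Real.exp_le_exp.2 hdeep
  refine ⟨hC, hCexp.trans_lt (h1.trans_eq ?_), hCexp.trans_lt (h2.trans_eq ?_), ?_, ?_⟩
  · rw [← Nat.mul_sub, mul_pow, ← pow_mul, ← pow_mul, mul_comm a, mul_comm (b - a)]
    congr 2
    push_cast
    rw [← mul_sub, mul_left_comm, mul_div_mul_left _ _ hk'.ne']
  · rw [← Nat.mul_sub, mul_pow, ← pow_mul, ← pow_mul, mul_comm a, mul_comm (b - a)]
    congr 2
    push_cast
    rw [mul_left_comm, mul_div_mul_left _ _ hk'.ne']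
  · refine lt_of_le_of_lt ?_ h3
    push_cast
    gcongr
    exact log_div_le ha' hk hdeep
  · refine lt_of_le_of_lt ?_ h4
    push_cast
    rw [← mul_sub]
    gcongr
    exact log_div_le hb' hk hdeep

theorem norm_wArg_logDev_le (ha : 0 < a) (hab : a < b) {c : ℝ} {k : ℕ} (hk : 0 < k) {C : ℂ}
    (hC : Real.log ‖C‖ ≤ -(c * k ^ 2)) (m : ℕ) :
    ‖wArg (k * b) (k * a) m γ (logDev (k * b) (k * a) m γ C)‖
      ≤ 2 * Real.exp (-(c / a * k)) := by
  have ha' : (0 : ℝ) < a := by exact_mod_cast ha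
  have h := rightArg_baseLog (Nat.mul_pos hk ha) (Nat.mul_pos hk (ha.trans hab)) m γ
    (logDev (k * b) (k * a) m γ C) 0
  rw [pow_zero, mul_one] at h
  rw [← h, norm_rightArg, logDev, add_sub_cancel, cutLog_re]
  push_cast
  gcongr
  exact log_div_le ha' hk hC

theorem norm_yArg_logDev_le (ha : 0 < a) (hab : a < b) {c : ℝ} {k : ℕ} (hk : 0 < k) {C : ℂ}
    (hC : Real.log ‖C‖ ≤ -(c * k ^ 2)) (m : ℕ) :
    ‖yArg (k * b) (k * a) m γ (logDev (k * b) (k * a) m γ C)‖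
      ≤ 2 * Real.exp (-(c / ((b : ℝ) - a) * k)) := by
  have hb' : (0 : ℝ) < (b : ℝ) - a := by
    have : (a : ℝ) < b := by exact_mod_cast hab
    linarith
  have h := leftArg_baseLog (Nat.mul_pos hk ha) (Nat.mul_lt_mul_of_pos_left hab hk) m γ
    (logDev (k * b) (k * a) m γ C)
  rw [← h, norm_leftArg, logDev, add_sub_cancel]
  have e : (cutLog C - 2 * Real.pi * (1 - m) * Complex.I).re = Real.log ‖C‖ := by
    rw [Complex.sub_re, cutLog_re]; simp
  rw [e]
  push_cast
  rw [← mul_sub]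
  gcongr
  exact log_div_le hb' hk hC

/-- Estimates for super-exponentially small `C`. -/
theorem eventually_deep (ha : 0 < a) (hab : a < b) (D : InverseBranch (((b : ℝ) - a) / a))
    (D' : InverseBranch ((a : ℝ) / ((b : ℝ) - a))) (γ : ℝ) {c : ℝ} (hc : 0 < c) :
    ∀ᶠ k : ℕ in atTop, ∀ s m, IsChoice (k * b) (k * a) s m → ∀ C : ℂ, C ≠ 0 →
      Real.log ‖C‖ ≤ -(c * k ^ 2) →
      ‖fixMap D D' (k * b) (k * a) m γ (logDev (k * b) (k * a) m γ C)‖ ≤ 1 ∧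
      (LogConsistency (k * b) (k * a) s m γ C ↔ logDev (k * b) (k * a) m γ C =
        fixMap D D' (k * b) (k * a) m γ (logDev (k * b) (k * a) m γ C)) := by
  have ha' : (0 : ℝ) < a := by exact_mod_cast ha
  have hb' : (0 : ℝ) < (b : ℝ) - a := by
    have : (a : ℝ) < b := by exact_mod_cast hab
    linarith
  have hbp : (0 : ℝ) < b := by linarith
  have hL := D.L_pos
  have hL' := D'.L_pos
  have h3 := (tendsto_const_mul_exp_neg 2 (div_pos hc ha')).eventually_lt_const D.r_pos
  have h4 := (tendsto_const_mul_exp_neg 2 (div_pos hc hb')).eventually_lt_const D'.r_pos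
  have h5 := (tendsto_fixMap_bound a ((b : ℝ) - a) D.L D'.L 2 2 (div_pos hc ha')
    (div_pos hc hb')).eventually_le_const one_pos
  have h6 := (tendsto_const_mul_exp_neg (a / ((b : ℝ) - a) * D'.L * 2)
    (div_pos hc hb')).eventually_le_const (show (0 : ℝ) < 1 / 4 by norm_num)
  have h7 := (tendsto_const_mul_exp_neg (D.L * 2) (div_pos hc ha')).eventually_le_const
    (show (0 : ℝ) < 1 / 4 by norm_num)
  filter_upwards [h3, h4, h5, h6, h7, eventually_smallFor ha hab D D' hc, eventually_ge_atTop 8,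
    eventually_le_mul_nat hb' 8] with k h3 h4 h5 h6 h7 hsmall hk hk8 s m hs C hC hdeep
  have hk0 : 0 < k := by omega
  have hk' : (8 : ℝ) ≤ k := by exact_mod_cast hk
  have hp : 0 < k * a := Nat.mul_pos hk0 ha
  have hpN : k * a < k * b := Nat.mul_lt_mul_of_pos_left hab hk0
  have hpN2 : k * a + 2 ≤ k * b := by nlinarith
  have hw := norm_wArg_logDev_le (γ := γ) ha hab hk0 hdeep m
  have hy := norm_yArg_logDev_le (γ := γ) ha hab hk0 hdeep m
  have hq : ((k * b : ℕ) : ℝ) - (k * a : ℕ) = k * ((b : ℝ) - a) := by push_cast; ring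
  refine ⟨?_, logConsistency_iff (hsmall C hC hdeep) hp hpN2 (ratio_scale ha hk0)
    (ratio_scale' hk0) hs γ ?_⟩
  · refine (norm_fixMap_le hp hpN hw h3 hy h4).trans ?_
    rw [hq]
    push_cast
    exact h5
  -- The imaginary part is at most `1 + 1 + 1/4 + 1/4 < 3 < π`, from `ε/(N - p)`, the momentum and
  -- the two branch logarithms.
  · set ε := logDev (k * b) (k * a) m γ C with hε
    have hpi := Real.pi_gt_three
    have hpi4 := Real.pi_lt_four
    have hεim : |ε.im| ≤ 2 * Real.pi := abs_logDev_im_le hp hpN hs γ C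
    have g1 : |(ε / (((k * b : ℕ) : ℂ) - (k * a : ℕ))).im| ≤ 1 := by
      have : (((k * b : ℕ) : ℂ) - (k * a : ℕ)) = ((k * ((b : ℝ) - a) : ℝ) : ℂ) := by
        push_cast; ring
      rw [this, Complex.div_ofReal_im, abs_div, abs_of_pos (a := k * ((b : ℝ) - a)) (by linarith),
        div_le_one (by linarith)]
      linarith
    have g2 : |(2 * Real.pi * m / (k * b : ℕ) * Complex.I).im| ≤ 1 := by
      have e : (2 * Real.pi * m / (k * b : ℕ) * Complex.I)
          = ((2 * Real.pi * m / (k * b : ℕ) : ℝ) : ℂ) * Complex.I := by push_cast; rfl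
      have hm : (m : ℝ) ≤ 1 := by
        rcases hs with ⟨-, rfl⟩ | ⟨-, rfl⟩ <;> simp
      have hb1 : (1 : ℝ) ≤ b := by exact_mod_cast (by omega : 1 ≤ b)
      rw [e, Complex.im_ofReal_mul, Complex.I_im, mul_one, abs_of_nonneg (by positivity)]
      push_cast
      rw [div_le_one (by positivity)]
      nlinarith [(Nat.cast_nonneg m : (0 : ℝ) ≤ m)]
    have g3 : |((((a : ℝ) / ((b : ℝ) - a) : ℝ) : ℂ) *
        D'.ell (-yArg (k * b) (k * a) m γ ε)).im| ≤ 1 / 4 := by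
      refine (Complex.abs_im_le_norm _).trans ?_
      rw [norm_mul, Complex.norm_real, Real.norm_eq_abs, abs_of_pos (by positivity)]
      refine le_trans ?_ h6
      rw [mul_assoc, mul_assoc]
      refine mul_le_mul_of_nonneg_left ((D'.norm_ell_le (by rw [norm_neg]; linarith)).trans ?_)
        (by positivity)
      rw [norm_neg]
      gcongr
    have g4 : |(D.ell (wArg (k * b) (k * a) m γ ε)).im| ≤ 1 / 4 := by
      refine (Complex.abs_im_le_norm _).trans (le_trans ?_ h7)
      rw [mul_assoc]
      exact (D.norm_ell_le (by linarith)).trans (by gcongr)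
    have g5 : (((k * a : ℕ) : ℂ) * γ).im = 0 := by
      rw [← Complex.ofReal_natCast, ← Complex.ofReal_mul, Complex.ofReal_im]
    rw [Complex.sub_im, Complex.sub_im, Complex.add_im, Complex.add_im, g5, zero_add]
    rw [abs_le] at g1 g2 g3 g4
    rw [abs_lt]
    constructor <;> linarith [g1.1, g1.2, g2.1, g2.2, g3.1, g3.2, g4.1, g4.2]

/-- `C` solves the logarithmic consistency equation or the product equation for the index set
`{1, …, p - 1, s}`. -/
def IsSolution (N p s m : ℕ) (γ : ℝ) (C : ℂ) : Prop :=
  LogConsistency N p s m γ C ∨ C ≠ 0 ∧ 2 ^ N * (Real.exp (γ * N) : ℂ) *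
    ∏ j ∈ choiceSet p s, ((betheRoot N p j C - 1) / (betheRoot N p j C + 1)) + C = 0

/-- The a priori bound puts every solution in the regime where the branches apply, and there
`‖fixMap‖ ≤ 1` bounds the solution itself. Thus all solutions lie in the disc on which `fixMap`
contracts. -/
theorem eventually_isFixed (ha : 0 < a) (hab : a < b) (D : InverseBranch (((b : ℝ) - a) / a))
    (D' : InverseBranch ((a : ℝ) / ((b : ℝ) - a))) (hγ : γ < 0) :
    ∀ᶠ k : ℕ in atTop, ∀ s m, IsChoice (k * b) (k * a) s m → ∀ C : ℂ,
      IsSolution (k * b) (k * a) s m γ C → C ≠ 0 ∧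
      logDev (k * b) (k * a) m γ C =
        fixMap D D' (k * b) (k * a) m γ (logDev (k * b) (k * a) m γ C) ∧
      ‖logDev (k * b) (k * a) m γ C‖ ≤ 1 := by
  have ha' : (0 : ℝ) < a := by exact_mod_cast ha
  have hb' : (0 : ℝ) < (b : ℝ) - a := by
    have : (a : ℝ) < b := by exact_mod_cast hab
    linarith
  have hbp : (0 : ℝ) < b := by linarith
  have hc : 0 < a * ((b : ℝ) - a) * (-γ) / 4 := by
    have := neg_pos.2 hγ
    positivity
  filter_upwards [eventually_log_norm_le ha hab hγ, eventually_deep ha hab D D' γ hc,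
    eventually_smallFor ha hab D D' hc, eventually_ge_atTop 2,
    eventually_le_mul_nat (c := a * ((b : ℝ) - a) / b) (by positivity) 2]
    with k hlog hdeep hsmall hk hk2 s m hs C hsol
  have hk0 : 0 < k := by omega
  have hp : 0 < k * a := Nat.mul_pos hk0 ha
  have hpN : k * a < k * b := Nat.mul_lt_mul_of_pos_left hab hk0
  have hpN2 : k * a + 2 ≤ k * b := by nlinarith
  have hsm := hs.mem hpN
  have hC : C ≠ 0 := hsol.elim (fun h => h.1) fun h => h.1
  have hmod : ModulusConsistency (k * b) (k * a) s γ C :=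
    hsol.elim (modulusConsistency_of_logConsistency hp hpN hsm.1 hsm.2)
      fun h => modulusConsistency_of_prod hp hpN hsm.1 hsm.2 hC h.2
  have hd : Real.log ‖C‖ ≤ -(a * ((b : ℝ) - a) * (-γ) / 4 * k ^ 2) :=
    (hlog s hsm.1 hsm.2 C hC hmod).trans_eq (by ring)
  obtain ⟨hle, hiff⟩ := hdeep s m hs C hC hd
  suffices hfix : logDev (k * b) (k * a) m γ C =
      fixMap D D' (k * b) (k * a) m γ (logDev (k * b) (k * a) m γ C) by
    refine ⟨hC, hfix, ?_⟩
    rw [hfix]; exact hle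
  rcases hsol with h | h
  · exact hiff.1 h
  obtain ⟨n, hn⟩ := exists_int_of_prod (hsmall C hC hd) hp hpN2 (ratio_scale ha hk0)
    (ratio_scale' hk0) hs γ h.2
  have hpi := Real.pi_gt_three
  have him := congrArg Complex.im hn
  rw [Complex.sub_im, Complex.im_ofReal_mul, Complex.I_im, mul_one] at him
  have e : (((k * a : ℕ) : ℝ) * (((k * b : ℕ) : ℝ) - (k * a : ℕ)) / (k * b : ℕ))
      = a * ((b : ℝ) - a) / b * k := by
    have : (0 : ℝ) < k := by exact_mod_cast hk0
    push_cast; field_simp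
  rw [e] at him
  -- A nonzero `n` would give an imaginary part of at least `4π` once `k` is large, but it is at
  -- most `1 + 2π`.
  have hn0 : n = 0 := by
    by_contra hne
    have h1 : (1 : ℝ) ≤ |(n : ℝ)| := by exact_mod_cast Int.one_le_abs hne
    have h2 : |(n : ℝ) * (2 * Real.pi * (a * ((b : ℝ) - a) / b * k))| ≤ 1 + 2 * Real.pi := by
      rw [← him]
      exact (abs_sub _ _).trans (add_le_add ((Complex.abs_im_le_norm _).trans hle)
        (abs_logDev_im_le hp hpN hs γ C))
    rw [abs_mul, abs_of_pos (a := 2 * Real.pi * (a * ((b : ℝ) - a) / b * k)) (by positivity)] at h2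
    have h3 : 2 * Real.pi * 2 ≤ 2 * Real.pi * (a * ((b : ℝ) - a) / b * k) := by gcongr
    have h4 := le_mul_of_one_le_left ((by positivity : (0 : ℝ) ≤ 2 * Real.pi * 2).trans h3) h1
    linarith
  rw [hn0] at hn
  simp only [Int.cast_zero, zero_mul, Complex.ofReal_zero] at hn
  exact (sub_eq_zero.1 hn).symm

end

/-! ### The unique solution -/

/-- The exponentially small scale `e^{tγk}`. -/
def decay (t γ : ℝ) (k : ℕ) : ℝ := Real.exp (-(t * -γ * k))

theorem decay_pos (t γ : ℝ) (k : ℕ) : 0 < decay t γ k := Real.exp_pos _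

theorem decay_le_one {t γ : ℝ} (ht : 0 < t) (hγ : γ < 0) (k : ℕ) : decay t γ k ≤ 1 := by
  rw [decay, Real.exp_le_one_iff]
  have : 0 ≤ t * -γ * k := by
    have := neg_pos.2 hγ
    positivity
  linarith

theorem exp_natCast_mul (a k : ℕ) (γ : ℝ) : Real.exp ((k * a : ℕ) * γ) = decay a γ k := by
  rw [decay]; push_cast; congr 1; ring

theorem exp_sub_mul (a b k : ℕ) (γ : ℝ) :
    Real.exp ((((k * b : ℕ) : ℝ) - (k * a : ℕ)) * γ) = decay ((b : ℝ) - a) γ k := by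
  rw [decay]; push_cast; congr 1; ring

theorem tendsto_pow_mul_decay (n : ℕ) {t γ : ℝ} (ht : 0 < t) (hγ : γ < 0) :
    Tendsto (fun k : ℕ => (k : ℝ) ^ n * decay t γ k) atTop (𝓝 0) :=
  tendsto_pow_mul_exp_neg n (mul_pos ht (neg_pos.2 hγ))

theorem tendsto_mul_decay_add {s t γ : ℝ} (hs : 0 < s) (ht : 0 < t) (hγ : γ < 0) (K : ℝ) :
    Tendsto (fun k : ℕ => K * k * (decay t γ k + decay s γ k)) atTop (𝓝 0) := by
  have h := ((tendsto_pow_mul_decay 1 ht hγ).add (tendsto_pow_mul_decay 1 hs hγ)).const_mul K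
  simp only [mul_zero, add_zero] at h
  exact h.congr fun k => by ring

theorem baseLog_eq (N p m : ℕ) (γ : ℝ) :
    baseLog N p m γ = ((N * Real.log 2 + p * ((N : ℝ) - p) * γ : ℝ) : ℂ)
      + ((2 * Real.pi - 2 * Real.pi * (m * p / N) : ℝ) : ℂ) * Complex.I := by
  rw [baseLog]; push_cast; ring

theorem baseLog_re (N p m : ℕ) (γ : ℝ) :
    (baseLog N p m γ).re = N * Real.log 2 + p * ((N : ℝ) - p) * γ := by
  rw [baseLog_eq, Complex.add_re, Complex.ofReal_re, Complex.re_ofReal_mul, Complex.I_re, mul_zero,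
    add_zero]

theorem baseLog_im (N p m : ℕ) (γ : ℝ) :
    (baseLog N p m γ).im = 2 * Real.pi - 2 * Real.pi * (m * p / N) := by
  rw [baseLog_eq, Complex.add_im, Complex.ofReal_im, Complex.im_ofReal_mul, Complex.I_im, mul_one,
    zero_add]

section
variable {a b : ℕ} {γ : ℝ}

-- Banach's theorem produces `ε` and `C = exp (baseLog + ε)` is the candidate. It solves the
-- equation only if `baseLog + ε` is the logarithm with imaginary part in `(0, 2π]`, so that `logDev
-- C = ε`. Uniqueness for both forms of the equation follows from uniqueness of the fixed point.
set_option maxHeartbeats 800000 in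
theorem eventually_exists_solution (ha : 0 < a) (hab : a < b)
    (D : InverseBranch (((b : ℝ) - a) / a)) (D' : InverseBranch ((a : ℝ) / ((b : ℝ) - a)))
    (hγ : γ < 0) :
    ∃ K : ℝ, 0 < K ∧ ∀ᶠ k : ℕ in atTop, ∀ s m, IsChoice (k * b) (k * a) s m → ∃ C : ℂ,
      SmallFor (k * b) (k * a) D D' C ∧
      ‖logDev (k * b) (k * a) m γ C‖ ≤ K * k * (decay a γ k + decay ((b : ℝ) - a) γ k) ∧
      LogConsistency (k * b) (k * a) s m γ C ∧
      ∀ C', IsSolution (k * b) (k * a) s m γ C' → C' = C := by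
  have ha' : (0 : ℝ) < a := by exact_mod_cast ha
  have hb' : (0 : ℝ) < (b : ℝ) - a := by
    have : (a : ℝ) < b := by exact_mod_cast hab
    linarith
  have hbp : (0 : ℝ) < b := by linarith
  have hL := D.L_pos
  have hL' := D'.L_pos
  have hγ' := neg_pos.2 hγ
  have hpi := Real.pi_pos
  -- The three terms bound those of `fixMap` for arguments at most `6W` and `6Y`. Here `216 = 6³`
  -- comes from the cubic remainder, whose extra factor `k` is absorbed by `k W² ≤ 1`.
  set K : ℝ := 6 * a * D'.L + 6 * (b - a) * D.L + 216 * a * (b - a) * D.L with hK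
  have hc : 0 < a * ((b : ℝ) - a) * (-γ) / 4 := by positivity
  have h3 : ∀ᶠ k : ℕ in atTop, 6 * decay ((b : ℝ) - a) γ k < D.r :=
    (tendsto_const_mul_exp_neg 6 (mul_pos hb' hγ')).eventually_lt_const D.r_pos
  have h4 : ∀ᶠ k : ℕ in atTop, 6 * decay a γ k < D'.r :=
    (tendsto_const_mul_exp_neg 6 (mul_pos ha' hγ')).eventually_lt_const D'.r_pos
  have h5 := (tendsto_fixMap_bound a ((b : ℝ) - a) D.L D'.L 6 6 (mul_pos hb' hγ')
    (mul_pos ha' hγ')).eventually_le_const (show (0 : ℝ) < 1 / 2 by norm_num)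
  have h6 := (tendsto_pow_mul_decay 1 hb' hγ).eventually_le_const one_pos
  have h7 := (tendsto_mul_decay_add hb' ha' hγ K).eventually_lt_const
    (show 0 < 2 * Real.pi * (1 - a / b) by
      have : (a : ℝ) / b < 1 := by rw [div_lt_one hbp]; linarith
      have : 0 < 1 - (a : ℝ) / b := by linarith
      positivity)
  have h8 := (tendsto_mul_decay_add hb' ha' hγ K).eventually_lt_const
    (show 0 < 2 * Real.pi * (a / b) by positivity)
  refine ⟨K, by positivity, ?_⟩
  filter_upwards [h3, h4, h5, h6, h7, h8, eventually_smallFor ha hab D D' hc,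
    eventually_deep ha hab D D' γ hc, eventually_isFixed ha hab D D' hγ, eventually_ge_atTop 3,
    eventually_le_mul_nat (c := 3 * (a * ((b : ℝ) - a) * (-γ) / 4)) (by positivity)
      (b * Real.log 2 + 1)]
    with k h3 h4 h5 h6 h7 h8 hsmall hdeep hfixed hk hklog s m hs
  have hk0 : 0 < k := by omega
  have hk' : (1 : ℝ) ≤ k := by exact_mod_cast hk0
  have hp : 0 < k * a := Nat.mul_pos hk0 ha
  have hp2 : 2 < k * a := by nlinarith
  have hpN : k * a < k * b := Nat.mul_lt_mul_of_pos_left hab hk0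
  have hpN2 : k * a + 2 ≤ k * b := by nlinarith
  have hq : ((k * b : ℕ) : ℝ) - (k * a : ℕ) = k * ((b : ℝ) - a) := by push_cast; ring
  have hY := exp_natCast_mul a k γ
  have hW := exp_sub_mul a b k γ
  set Y := decay a γ k with hYdef
  set W := decay ((b : ℝ) - a) γ k with hWdef
  have hY0 : 0 < Y := decay_pos _ _ _
  have hW0 : 0 < W := decay_pos _ _ _
  have hW1 : W ≤ 1 := decay_le_one hb' hγ k
  have h5' : ((k * a : ℕ) : ℝ) * (D'.L * (6 * Y)) + (((k * b : ℕ) : ℝ) - (k * a : ℕ))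
      * (D.L * (6 * W)) + (((k * b : ℕ) : ℝ) - (k * a : ℕ)) * ((k * a : ℕ) * (D.L * (6 * W)))
      ≤ 1 / 2 := by
    rw [hq]; push_cast; exact h5
  have hwle : ∀ {ε : ℂ}, ‖ε‖ ≤ 1 → ‖wArg (k * b) (k * a) m γ ε‖ ≤ 6 * W := fun hε => by
    rw [← hW]; exact norm_wArg_le hp m hε
  have hyle : ∀ {ε : ℂ}, ‖ε‖ ≤ 1 → ‖yArg (k * b) (k * a) m γ ε‖ ≤ 6 * Y := fun hε => by
    rw [← hY]; exact norm_yArg_le hpN m hε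
  obtain ⟨ε, hε1, hεfix, hεuniq⟩ := exists_fixedPoint_unitBall
    (f := fixMap D D' (k * b) (k * a) m γ)
    (fun ε hε => ((norm_fixMap_le hp hpN (hwle hε) h3 (hyle hε) h4).trans h5').trans (by norm_num))
    (fun ε ε' hε hε' => by
      have := norm_fixMap_sub_le (m := m) (D := D) (D' := D') (γ := γ) hp hpN hε hε'
        (by rw [hW]; exact h3) (by rw [hY]; exact h4)
      rw [hW, hY] at this
      exact this.trans (by gcongr))
  have hεK : ‖ε‖ ≤ K * k * (Y + W) := by
    have h := norm_fixMap_le_of_cancel hp2 hpN (hwle hε1) h3 (hyle hε1) h4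
    rw [hεfix, hq] at h
    push_cast at h
    refine h.trans ?_
    have hkW : k * W ^ 2 ≤ 1 := by
      rw [pow_one] at h6
      rw [sq, ← mul_assoc]
      exact mul_le_one₀ h6 hW0.le hW1
    have e1 : (k : ℝ) * (b - a) * (k * a * (D.L * (6 * W) ^ 3))
        = 216 * a * (b - a) * D.L * k * W * (k * W ^ 2) := by ring
    have e2 : 216 * a * (b - a) * D.L * k * W * (k * W ^ 2)
        ≤ 216 * a * (b - a) * D.L * k * W * 1 := by gcongr
    have e3 : 0 ≤ (6 * (b - a) * D.L + 216 * a * (b - a) * D.L) * k * Y := by positivity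
    have e4 : 0 ≤ 6 * a * D'.L * k * W := by positivity
    rw [e1, hK]
    linarith
  have hεim : |ε.im| ≤ K * k * (Y + W) := (Complex.abs_im_le_norm ε).trans hεK
  rw [abs_le] at hεim
  have hratio : ((1 : ℕ) * (k * a : ℕ) / (k * b : ℕ) : ℝ) = a / b := by
    push_cast; field_simp
  have him : 0 < (baseLog (k * b) (k * a) m γ + ε).im ∧
      (baseLog (k * b) (k * a) m γ + ε).im ≤ 2 * Real.pi := by
    rw [Complex.add_im, baseLog_im]
    rcases hs with ⟨-, rfl⟩ | ⟨-, rfl⟩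
    -- At momentum `0` the imaginary part of `baseLog` is exactly `2π`, the closed end of the range,
    -- so smallness of `ε` is not enough and `ε` must be real.
    · have hconj : starRingEnd ℂ ε = ε := by
        refine hεuniq _ (by simpa using hε1) ?_
        rw [fixMap_conj hp ((hwle hε1).trans_lt h3) ((hyle hε1).trans_lt h4), hεfix]
      rw [Complex.conj_eq_iff_im.1 hconj]
      simp [hpi]
    -- At momentum `1` the imaginary part of `baseLog` is `2π(1 - a/b)`, in the interior of the
    -- range.
    · rw [hratio]
      constructor <;> linarith
  set C := Complex.exp (baseLog (k * b) (k * a) m γ + ε) with hCdef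
  have hC : C ≠ 0 := Complex.exp_ne_zero _
  have hcut : cutLog C = baseLog (k * b) (k * a) m γ + ε := cutLog_exp him.1 him.2
  have hdev : logDev (k * b) (k * a) m γ C = ε := by rw [logDev, hcut, add_sub_cancel_left]
  have hd : Real.log ‖C‖ ≤ -(a * ((b : ℝ) - a) * (-γ) / 4 * k ^ 2) := by
    rw [← cutLog_re, hcut, Complex.add_re, baseLog_re, hq]
    have h1 : ε.re ≤ 1 := (Complex.re_le_norm ε).trans hε1
    have h2 := mul_le_mul_of_nonneg_right hklog (zero_le_one.trans hk')
    push_cast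
    linarith
  refine ⟨C, hsmall C hC hd, by rw [hdev]; exact hεK, ?_, fun C' hC' => ?_⟩
  · rw [(hdeep s m hs C hC hd).2, hdev, hεfix]
  · obtain ⟨hC0, hfix', hle'⟩ := hfixed s m hs C' hC'
    have h1 := hεuniq _ hle' hfix'.symm
    rw [← hdev, logDev, logDev, sub_left_inj] at h1
    rw [← exp_cutLog hC0, h1, exp_cutLog hC]

end

/-! ### Expansion of the eigenvalues and of the gap -/

section
variable {a b : ℕ} {γ : ℝ}

/-- The leading part of the Bethe eigenvalue with momentum `m`. -/
def leadingEigenvalue (a b m : ℕ) (γ : ℝ) (k : ℕ) : ℂ :=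
  -1 + decay ((b : ℝ) - a) γ k * Complex.exp (-(2 * Real.pi * m / (k * b : ℕ) * Complex.I))
    + decay a γ k * Complex.exp (2 * Real.pi * m / (k * b : ℕ) * Complex.I)

theorem wArg_zero_eq (a b k m : ℕ) (γ : ℝ) : wArg (k * b) (k * a) m γ 0 =
    -2 * (decay ((b : ℝ) - a) γ k *
      Complex.exp (-(2 * Real.pi * m / (k * b : ℕ) * Complex.I))) := by
  rw [wArg, ← exp_sub_mul a b k γ, Complex.ofReal_exp, ← Complex.exp_add, zero_div, add_zero,
    sub_eq_add_neg]
  push_cast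
  rfl

theorem yArg_zero_eq (a b k m : ℕ) (γ : ℝ) : yArg (k * b) (k * a) m γ 0 =
    2 * (decay a γ k * Complex.exp (2 * Real.pi * m / (k * b : ℕ) * Complex.I)) := by
  rw [yArg, ← exp_natCast_mul a k γ, Complex.ofReal_exp, ← Complex.exp_add, zero_div, add_zero]
  push_cast
  rfl

/-- The sum over all roots near `1` is cubic in `W` by cancellation, so the eigenvalue is `-1 - w/2
+ y/2` up to quadratic errors. The deviation `ε = O(k(Y + W))` enters only through `ε/p` and `ε/(N -
p)`, which removes the factor `k`; multiplied by `W` or `Y` its effect is `O(Y² + W²)`. -/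
theorem eventually_eigenvalue (ha : 0 < a) (hab : a < b)
    (D : InverseBranch (((b : ℝ) - a) / a)) (D' : InverseBranch ((a : ℝ) / ((b : ℝ) - a)))
    (hγ : γ < 0) {K : ℝ} (hK : 0 < K) :
    ∃ K' : ℝ, ∀ᶠ k : ℕ in atTop, ∀ s m, IsChoice (k * b) (k * a) s m → ∀ C : ℂ,
      SmallFor (k * b) (k * a) D D' C →
      ‖logDev (k * b) (k * a) m γ C‖ ≤ K * k * (decay a γ k + decay ((b : ℝ) - a) γ k) →
      ‖betheEigenvalue (k * b) (k * a) (choiceSet (k * a) s) C - leadingEigenvalue a b m γ k‖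
        ≤ K' * (decay a γ k ^ 2 + decay ((b : ℝ) - a) γ k ^ 2) := by
  have ha' : (0 : ℝ) < a := by exact_mod_cast ha
  have hb' : (0 : ℝ) < (b : ℝ) - a := by
    have : (a : ℝ) < b := by exact_mod_cast hab
    linarith
  have hL := D.L_pos
  have hL' := D'.L_pos
  have h3 : ∀ᶠ k : ℕ in atTop, 6 * decay ((b : ℝ) - a) γ k < D.r :=
    (tendsto_const_mul_exp_neg 6 (mul_pos hb' (neg_pos.2 hγ))).eventually_lt_const D.r_pos
  have h4 : ∀ᶠ k : ℕ in atTop, 6 * decay a γ k < D'.r :=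
    (tendsto_const_mul_exp_neg 6 (mul_pos ha' (neg_pos.2 hγ))).eventually_lt_const D'.r_pos
  refine ⟨216 * a * D.L + 36 * D.L + 36 * D'.L + 12 * K / a + 12 * K / (b - a), ?_⟩
  filter_upwards [h3, h4, (tendsto_pow_mul_decay 1 hb' hγ).eventually_le_const one_pos,
    (tendsto_mul_decay_add hb' ha' hγ K).eventually_le_const one_pos, eventually_ge_atTop 3]
    with k h3 h4 hkW hK1 hk s m hs C hC hε
  have hk0 : 0 < k := by omega
  have hk' : (0 : ℝ) < k := by exact_mod_cast hk0
  have hp : 0 < k * a := Nat.mul_pos hk0 ha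
  have hp2 : 2 < k * a := by nlinarith
  have hpN : k * a < k * b := Nat.mul_lt_mul_of_pos_left hab hk0
  have hpN2 : k * a + 2 ≤ k * b := by nlinarith
  have hq : ((k * b : ℕ) : ℝ) - (k * a : ℕ) = k * ((b : ℝ) - a) := by push_cast; ring
  have hY := exp_natCast_mul a k γ
  have hW := exp_sub_mul a b k γ
  rw [betheEigenvalue_eq hC hp hpN2 (ratio_scale ha hk0) (ratio_scale' hk0) hs γ]
  have hw0 := wArg_zero_eq a b k m γ
  have hy0 := yArg_zero_eq a b k m γ
  rw [leadingEigenvalue]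
  set ε := logDev (k * b) (k * a) m γ C with hεdef
  set Y := decay a γ k with hYdef
  set W := decay ((b : ℝ) - a) γ k with hWdef
  have hY0 : 0 < Y := decay_pos _ _ _
  have hW0 : 0 < W := decay_pos _ _ _
  have hε1 : ‖ε‖ ≤ 1 := hε.trans hK1
  have hw : ‖wArg (k * b) (k * a) m γ ε‖ ≤ 6 * W := by rw [← hW]; exact norm_wArg_le hp m hε1
  have hy : ‖yArg (k * b) (k * a) m γ ε‖ ≤ 6 * Y := by rw [← hY]; exact norm_yArg_le hpN m hε1
  have hdw : ‖wArg (k * b) (k * a) m γ ε - wArg (k * b) (k * a) m γ 0‖ ≤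
      12 * K / a * (Y ^ 2 + W ^ 2) := by
    refine (norm_wArg_sub_le hp m hε1 (by simp)).trans ?_
    rw [hW, sub_zero]
    push_cast
    calc 6 * W * (‖ε‖ / (k * a)) ≤ 6 * W * (K * k * (Y + W) / (k * a)) := by gcongr
      _ = 6 * K / a * (W * (Y + W)) := by field_simp
      _ ≤ 6 * K / a * (2 * (Y ^ 2 + W ^ 2)) := by
        refine mul_le_mul_of_nonneg_left ?_ (by positivity)
        nlinarith [sq_nonneg (Y - W), sq_nonneg Y, sq_nonneg W]
      _ = 12 * K / a * (Y ^ 2 + W ^ 2) := by ring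
  have hdy : ‖yArg (k * b) (k * a) m γ ε - yArg (k * b) (k * a) m γ 0‖ ≤
      12 * K / (b - a) * (Y ^ 2 + W ^ 2) := by
    refine (norm_yArg_sub_le hpN m hε1 (by simp)).trans ?_
    rw [hY, sub_zero, hq]
    calc 6 * Y * (‖ε‖ / (k * (b - a))) ≤ 6 * Y * (K * k * (Y + W) / (k * (b - a))) := by gcongr
      _ = 6 * K / (b - a) * (Y * (Y + W)) := by field_simp
      _ ≤ 6 * K / (b - a) * (2 * (Y ^ 2 + W ^ 2)) := by
        refine mul_le_mul_of_nonneg_left ?_ (by positivity)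
        nlinarith [sq_nonneg (Y - W), sq_nonneg Y, sq_nonneg W]
      _ = 12 * K / (b - a) * (Y ^ 2 + W ^ 2) := by ring
  have hψ : ‖D.ψ (wArg (k * b) (k * a) m γ ε) - wArg (k * b) (k * a) m γ ε‖
      ≤ 36 * D.L * W ^ 2 := by
    refine (D.quad _ (hw.trans_lt h3)).trans ?_
    calc D.L * ‖wArg (k * b) (k * a) m γ ε‖ ^ 2 ≤ D.L * (6 * W) ^ 2 := by gcongr
      _ = 36 * D.L * W ^ 2 := by ring
  have hψ' : ‖D'.ψ (-yArg (k * b) (k * a) m γ ε) - -yArg (k * b) (k * a) m γ ε‖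
      ≤ 36 * D'.L * Y ^ 2 := by
    refine (D'.quad _ (by rw [norm_neg]; exact hy.trans_lt h4)).trans ?_
    rw [norm_neg]
    calc D'.L * ‖yArg (k * b) (k * a) m γ ε‖ ^ 2 ≤ D'.L * (6 * Y) ^ 2 := by gcongr
      _ = 36 * D'.L * Y ^ 2 := by ring
  have hS : ‖∑ j ∈ Finset.Icc 1 (k * a), D.ψ (wArg (k * b) (k * a) m γ ε * zetaRoot (k * a) ^ j)‖
      ≤ 216 * a * D.L * W ^ 2 := by
    obtain ⟨c₁, c₂, hc⟩ := D.cubic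
    refine (norm_sum_zetaRoot_le hp2 hc (hw.trans_lt h3)).trans ?_
    push_cast
    calc k * a * (D.L * ‖wArg (k * b) (k * a) m γ ε‖ ^ 3) ≤ k * a * (D.L * (6 * W) ^ 3) := by gcongr
      _ = 216 * a * D.L * W ^ 2 * (k ^ 1 * W) := by ring
      _ ≤ 216 * a * D.L * W ^ 2 * 1 := by gcongr
      _ = 216 * a * D.L * W ^ 2 := by ring
  generalize ∑ j ∈ Finset.Icc 1 (k * a), D.ψ (wArg (k * b) (k * a) m γ ε * zetaRoot (k * a) ^ j) = S
    at hS ⊢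
  generalize D.ψ (wArg (k * b) (k * a) m γ ε) = A at hψ ⊢
  generalize D'.ψ (-yArg (k * b) (k * a) m γ ε) = B at hψ' ⊢
  generalize wArg (k * b) (k * a) m γ ε = w at *
  generalize yArg (k * b) (k * a) m γ ε = y at *
  rw [hw0] at hdw
  rw [hy0] at hdy
  generalize Complex.exp (-(2 * Real.pi * m / (k * b : ℕ) * Complex.I)) = E₁ at hdw ⊢
  generalize Complex.exp (2 * Real.pi * m / (k * b : ℕ) * Complex.I) = E₂ at hdy ⊢
  have e : 1 / 2 * (S - A - 2 - B) - (-1 + W * E₁ + Y * E₂)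
      = 1 / 2 * (S - (A - w) - (w - -2 * (W * E₁)) - (B - -y) + (y - 2 * (Y * E₂))) := by ring
  rw [e, norm_mul]
  have hhalf : ‖(1 / 2 : ℂ)‖ ≤ 1 := by rw [norm_div]; norm_num
  refine (mul_le_of_le_one_left (norm_nonneg _) hhalf).trans ?_
  refine (norm_add_le _ _).trans ((add_le_add ((norm_sub_le _ _).trans (add_le_add
    ((norm_sub_le _ _).trans (add_le_add ((norm_sub_le _ _).trans (add_le_add hS hψ)) hdw)) hψ'))
    hdy).trans ?_)
  have z1 : 0 ≤ 216 * a * D.L * Y ^ 2 := by positivity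
  have z2 : 0 ≤ 36 * D.L * Y ^ 2 := by positivity
  have z3 : 0 ≤ 36 * D'.L * W ^ 2 := by positivity
  linarith

theorem norm_exp_sub_one_sub_le {x : ℝ} (hx : |x| ≤ 1) :
    ‖Complex.exp (x * Complex.I) - 1 - x * Complex.I‖ ≤ x ^ 2 := by
  have hn : ‖(x * Complex.I : ℂ)‖ = |x| := by simp
  have := Complex.norm_exp_sub_one_sub_id_le (x := x * Complex.I) (by rw [hn]; exact hx)
  rwa [hn, sq_abs] at this

/-- For the second expansion, `e^{ix} - 1 - ix = O(x²)` with `x = ±2π/N` produces the `N⁻²`, and the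
quadratic error fits because eventually `N² Y ≤ 1` and `N² W ≤ 1`. -/
theorem hasGapExpansion_of_bound (ha : 0 < a) (hab : a < b) (hγ : γ < 0) {K : ℝ} {gap : ℕ → ℂ}
    (h : ∀ᶠ k : ℕ in atTop, ‖gap k - (leadingEigenvalue a b 0 γ k - leadingEigenvalue a b 1 γ k)‖
      ≤ K * (decay a γ k ^ 2 + decay ((b : ℝ) - a) γ k ^ 2)) :
    HasGapExpansion (fun k => k * b) ((a : ℝ) / b) γ gap := by
  have ha' : (0 : ℝ) < a := by exact_mod_cast ha
  have hb' : (0 : ℝ) < (b : ℝ) - a := by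
    have : (a : ℝ) < b := by exact_mod_cast hab
    linarith
  have hbp : (0 : ℝ) < b := by linarith
  have eY : ∀ k : ℕ, Real.exp ((k * b : ℕ) * γ * (a / b)) = decay a γ k := fun k => by
    rw [decay]; push_cast; congr 1; field_simp
  have eW : ∀ k : ℕ, Real.exp ((k * b : ℕ) * γ * (1 - a / b)) = decay ((b : ℝ) - a) γ k :=
    fun k => by rw [decay]; push_cast; congr 1; field_simp
  have eY2 : ∀ k : ℕ, Real.exp (2 * (k * b : ℕ) * γ * (a / b)) = decay a γ k ^ 2 := fun k => by
    rw [← eY, ← Real.exp_nat_mul]; push_cast; congr 1; ring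
  have eW2 : ∀ k : ℕ, Real.exp (2 * (k * b : ℕ) * γ * (1 - a / b)) = decay ((b : ℝ) - a) γ k ^ 2 :=
    fun k => by rw [← eW, ← Real.exp_nat_mul]; push_cast; congr 1; ring
  have elead : ∀ k : ℕ, leadingEigenvalue a b 0 γ k - leadingEigenvalue a b 1 γ k
      = (decay a γ k : ℂ) * (1 - Complex.exp (2 * Real.pi * Complex.I / (k * b : ℕ)))
        + (decay ((b : ℝ) - a) γ k : ℂ)
          * (1 - Complex.exp (-(2 * Real.pi * Complex.I / (k * b : ℕ)))) := fun k => by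
    have e1 : (2 * Real.pi * (1 : ℕ) / (k * b : ℕ) * Complex.I : ℂ)
        = 2 * Real.pi * Complex.I / (k * b : ℕ) := by push_cast; ring
    rw [leadingEigenvalue, leadingEigenvalue, e1]
    simp
    ring
  refine ⟨?_, ?_⟩
  · refine IsBigO.of_bound K ?_
    filter_upwards [h] with k hk
    simp only [eY, eW, eY2, eW2]
    rw [← elead, Real.norm_of_nonneg (by positivity)]
    exact hk
  · refine IsBigO.of_bound (|K| + 4 * Real.pi ^ 2) ?_
    have t1 := ((tendsto_pow_mul_decay 2 ha' hγ).const_mul ((b : ℝ) ^ 2)).eventually_le_const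
      (u := 1) (by simp)
    have t2 := ((tendsto_pow_mul_decay 2 hb' hγ).const_mul ((b : ℝ) ^ 2)).eventually_le_const
      (u := 1) (by simp)
    filter_upwards [h, t1, t2, eventually_ge_atTop 8] with k hk t1 t2 hk8
    have hk' : (8 : ℝ) ≤ k := by exact_mod_cast hk8
    have hN : (8 : ℝ) ≤ (k * b : ℕ) := by
      have : (1 : ℝ) ≤ b := by exact_mod_cast (by omega : 1 ≤ b)
      push_cast; nlinarith
    have hNsq : (b : ℝ) ^ 2 * k ^ 2 = ((k * b : ℕ) : ℝ) ^ 2 := by push_cast; ring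
    rw [← mul_assoc, hNsq] at t1 t2
    simp only [eY, eW]
    rw [elead] at hk
    set Y := decay a γ k with hYdef
    set W := decay ((b : ℝ) - a) γ k with hWdef
    have hY0 : 0 < Y := decay_pos _ _ _
    have hW0 : 0 < W := decay_pos _ _ _
    generalize k * b = n at *
    have hn0 : (0 : ℝ) < n := by linarith
    set x : ℝ := 2 * Real.pi / n with hx
    have hx0 : 0 ≤ x := by have := Real.pi_pos; positivity
    have hx1 : |x| ≤ 1 := by
      rw [abs_of_nonneg hx0, hx, div_le_one hn0]
      linarith [Real.pi_lt_four]
    have ex : (2 * Real.pi * Complex.I / n : ℂ) = x * Complex.I := by rw [hx]; push_cast; ring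
    have ex' : (-(2 * Real.pi * Complex.I / n) : ℂ) = ((-x : ℝ) : ℂ) * Complex.I := by
      rw [ex]; push_cast; ring
    rw [ex', ex] at hk
    rw [ex]
    have b1 := norm_exp_sub_one_sub_le hx1
    have b2 := norm_exp_sub_one_sub_le (x := -x) (by rwa [abs_neg])
    rw [neg_sq] at b2
    rw [Real.norm_of_nonneg (by positivity)]
    have e : gap k - x * Complex.I * (W - Y) =
        (gap k - (Y * (1 - Complex.exp (x * Complex.I))
          + W * (1 - Complex.exp (((-x : ℝ) : ℂ) * Complex.I))))
        - Y * (Complex.exp (x * Complex.I) - 1 - x * Complex.I)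
        - W * (Complex.exp (((-x : ℝ) : ℂ) * Complex.I) - 1 - ((-x : ℝ) : ℂ) * Complex.I) := by
      push_cast; ring
    rw [e]
    have c1 : ‖(Y : ℂ) * (Complex.exp (x * Complex.I) - 1 - x * Complex.I)‖ ≤ Y * x ^ 2 := by
      rw [norm_mul, Complex.norm_real, Real.norm_of_nonneg hY0.le]; gcongr
    have c2 : ‖(W : ℂ) * (Complex.exp (((-x : ℝ) : ℂ) * Complex.I) - 1
        - ((-x : ℝ) : ℂ) * Complex.I)‖ ≤ W * x ^ 2 := by
      rw [norm_mul, Complex.norm_real, Real.norm_of_nonneg hW0.le]; gcongr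
    have d1 : Y ^ 2 ≤ ((n : ℝ) ^ 2)⁻¹ * Y := by
      rw [inv_mul_eq_div, le_div_iff₀ (by positivity)]
      nlinarith
    have d2 : W ^ 2 ≤ ((n : ℝ) ^ 2)⁻¹ * W := by
      rw [inv_mul_eq_div, le_div_iff₀ (by positivity)]
      nlinarith
    have hxx : x ^ 2 = 4 * Real.pi ^ 2 * ((n : ℝ) ^ 2)⁻¹ := by rw [hx]; field_simp; norm_num
    refine (norm_sub_le _ _).trans ((add_le_add ((norm_sub_le _ _).trans
      (add_le_add (hk.trans ?_) c1)) c2).trans (b := |K| * (((n : ℝ) ^ 2)⁻¹ * (Y + W)) + Y * x ^ 2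
        + W * x ^ 2) ?_)
    · refine (mul_le_mul_of_nonneg_right (le_abs_self K) (by positivity)).trans ?_
      refine mul_le_mul_of_nonneg_left ?_ (abs_nonneg K)
      linarith
    · rw [hxx]
      exact le_of_eq (by ring)

/-- The ratio is exactly `exp (Re (logDev C))`. -/
theorem tendsto_norm_div_leadingModulus (ha : 0 < a) (hab : a < b) (hγ : γ < 0) {m : ℕ} {K : ℝ}
    {C : ℕ → ℂ} (h : ∀ᶠ k : ℕ in atTop, C k ≠ 0 ∧ ‖logDev (k * b) (k * a) m γ (C k)‖
      ≤ K * k * (decay a γ k + decay ((b : ℝ) - a) γ k)) :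
    Tendsto (fun k : ℕ => ‖C k‖ / leadingModulus (k * b) ((a : ℝ) / b) γ) atTop (𝓝 1) := by
  have ha' : (0 : ℝ) < a := by exact_mod_cast ha
  have hb' : (0 : ℝ) < (b : ℝ) - a := by
    have : (a : ℝ) < b := by exact_mod_cast hab
    linarith
  have hbp : (0 : ℝ) < b := by linarith
  have h0 : Tendsto (fun k : ℕ => (logDev (k * b) (k * a) m γ (C k)).re) atTop (𝓝 0) := by
    refine squeeze_zero_norm' ?_ (tendsto_mul_decay_add hb' ha' hγ K)
    filter_upwards [h] with k hk
    exact (Complex.abs_re_le_norm _).trans hk.2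
  have h1 := (Real.continuous_exp.tendsto 0).comp h0
  rw [Real.exp_zero] at h1
  refine h1.congr' ?_
  filter_upwards [h, eventually_ge_atTop 1] with k hk hk1
  have hk' : (0 : ℝ) < k := by exact_mod_cast hk1
  rw [Function.comp, logDev, Complex.sub_re, cutLog_re, baseLog_re, Real.exp_sub,
    Real.exp_log (norm_pos_iff.2 hk.1), leadingModulus, Real.exp_add, Real.exp_nat_mul,
    Real.exp_log two_pos]
  congr 3
  push_cast
  field_simp

/-- At momentum `1`, `θ + 2π/N` is exactly `Im (logDev C) / p`, and `1/p = (b/a)/N`. -/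
theorem focalAngle_isLittleO (ha : 0 < a) (hab : a < b) (hγ : γ < 0) {K : ℝ}
    {C : ℕ → ℂ} (h : ∀ᶠ k : ℕ in atTop, ‖logDev (k * b) (k * a) 1 γ (C k)‖
      ≤ K * k * (decay a γ k + decay ((b : ℝ) - a) γ k)) :
    (fun k : ℕ => focalAngle (k * a) (C k) - (-(2 * Real.pi / (k * b : ℕ))))
      =o[atTop] (fun k : ℕ => (((k * b : ℕ) : ℝ))⁻¹) := by
  have ha' : (0 : ℝ) < a := by exact_mod_cast ha
  have hb' : (0 : ℝ) < (b : ℝ) - a := by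
    have : (a : ℝ) < b := by exact_mod_cast hab
    linarith
  have hbp : (0 : ℝ) < b := by linarith
  have h0 : Tendsto (fun k : ℕ => (logDev (k * b) (k * a) 1 γ (C k)).im) atTop (𝓝 0) := by
    refine squeeze_zero_norm' ?_ (tendsto_mul_decay_add hb' ha' hγ K)
    filter_upwards [h] with k hk
    exact (Complex.abs_im_le_norm _).trans hk
  have h1 : (fun k : ℕ => (logDev (k * b) (k * a) 1 γ (C k)).im * (b / a))
      =o[atTop] (fun _ => (1 : ℝ)) := by
    rw [isLittleO_one_iff]
    simpa using h0.mul_const ((b : ℝ) / a)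
  have h2 := h1.mul_isBigO (isBigO_refl (fun k : ℕ => (((k * b : ℕ) : ℝ))⁻¹) atTop)
  simp only [one_mul] at h2
  refine h2.congr' ?_ EventuallyEq.rfl
  filter_upwards [eventually_ge_atTop 1] with k hk1
  have hk' : (0 : ℝ) < k := by exact_mod_cast hk1
  rw [logDev, Complex.sub_im, cutLog_im, baseLog_im, phase, focalAngle]
  push_cast
  field_simp
  ring

end

end TASEP

end

/-! ### Assembly of the theorem -/

open TASEP in
/-- The thermodynamic limit at the density `ρ = a/b ∈ (0, 1)` is `N = k b`, `p = k a`, `k → ∞`.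
`Cs` and `Ct` are the solutions of the consistency equations of the largest eigenvalue
(index set `{1, …, p - 1, N}`, momentum `0`) and of the second one
(index set `{1, …, p - 1, p + 1}`, momentum `1`). -/
theorem mainTheorem4 (a b : ℕ) (ha : 0 < a) (hab : a < b) (γ ρ : ℝ) (hγ : γ < 0)
    (hρ : ρ = (a : ℝ) / b) (N p : ℕ → ℕ) (hN : ∀ k, N k = k * b) (hp : ∀ k, p k = k * a) :
    ∃ Cs Ct : ℕ → ℂ,
      (∀ᶠ k in atTop, IsUniqueSolution (N k) (p k) (N k) 0 γ (Cs k)) ∧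
      (∀ᶠ k in atTop, IsUniqueSolution (N k) (p k) (p k + 1) 1 γ (Ct k)) ∧
      Tendsto (fun k => ‖Cs k‖ / leadingModulus (N k) ρ γ) atTop (𝓝 1) ∧
      Tendsto (fun k => ‖Ct k‖ / leadingModulus (N k) ρ γ) atTop (𝓝 1) ∧
      (fun k => focalAngle (p k) (Ct k) - (-(2 * Real.pi / N k)))
        =o[atTop] (fun k => ((N k : ℝ))⁻¹) ∧
      HasGapExpansion N ρ γ (fun k =>
        betheEigenvalue (N k) (p k) (choiceSet (p k) (N k)) (Cs k)
          - betheEigenvalue (N k) (p k) (choiceSet (p k) (p k + 1)) (Ct k)) ∧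
      ∀ lam₁ lam₂ : ℕ → ℂ,
        (∀ᶠ k in atTop, IsLargestEigenvalue (N k) (p k) γ (lam₁ k) ∧
          IsAchievedBy (N k) (p k) γ (choiceSet (p k) (N k)) (lam₁ k)) →
        (∀ᶠ k in atTop, IsSecondEigenvalue (N k) (p k) γ (lam₁ k) (lam₂ k) ∧
          IsAchievedBy (N k) (p k) γ (choiceSet (p k) (p k + 1)) (lam₂ k)) →
        HasGapExpansion N ρ γ (fun k => lam₁ k - lam₂ k) := by
  obtain rfl : N = fun k => k * b := funext hN
  obtain rfl : p = fun k => k * a := funext hp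
  subst hρ
  obtain ⟨D⟩ := exists_inverseBranch (((b : ℝ) - a) / a)
  obtain ⟨D'⟩ := exists_inverseBranch ((a : ℝ) / ((b : ℝ) - a))
  obtain ⟨K, hK, hex⟩ := eventually_exists_solution ha hab D D' hγ
  obtain ⟨K', hK'⟩ := eventually_eigenvalue ha hab D D' hγ hK
  obtain ⟨Cs, hCs⟩ := (hex.mono fun k hk => hk (k * b) 0 (Or.inl ⟨rfl, rfl⟩)).choice
  obtain ⟨Ct, hCt⟩ := (hex.mono fun k hk => hk (k * a + 1) 1 (Or.inr ⟨rfl, rfl⟩)).choice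
  have hgap : ∀ᶠ k : ℕ in atTop, ‖(betheEigenvalue (k * b) (k * a) (choiceSet (k * a) (k * b)) (Cs k)
      - betheEigenvalue (k * b) (k * a) (choiceSet (k * a) (k * a + 1)) (Ct k))
      - (leadingEigenvalue a b 0 γ k - leadingEigenvalue a b 1 γ k)‖
      ≤ 2 * K' * (decay a γ k ^ 2 + decay ((b : ℝ) - a) γ k ^ 2) := by
    filter_upwards [hK', hCs, hCt] with k hk hs ht
    have h1 := hk _ 0 (Or.inl ⟨rfl, rfl⟩) _ hs.1 hs.2.1
    have h2 := hk _ 1 (Or.inr ⟨rfl, rfl⟩) _ ht.1 ht.2.1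
    rw [sub_sub_sub_comm]
    exact (norm_sub_le _ _).trans ((add_le_add h1 h2).trans_eq (by ring))
  refine ⟨Cs, Ct, ?_, ?_, ?_, ?_, ?_, hasGapExpansion_of_bound ha hab hγ hgap, ?_⟩
  · exact hCs.mono fun k h => ⟨h.2.2.1, fun C' hC' => h.2.2.2 C' (Or.inl hC')⟩
  · exact hCt.mono fun k h => ⟨h.2.2.1, fun C' hC' => h.2.2.2 C' (Or.inl hC')⟩
  · exact tendsto_norm_div_leadingModulus ha hab hγ (hCs.mono fun k h => ⟨h.1.ne_zero, h.2.1⟩)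
  · exact tendsto_norm_div_leadingModulus ha hab hγ (hCt.mono fun k h => ⟨h.1.ne_zero, h.2.1⟩)
  · exact focalAngle_isLittleO ha hab hγ (hCt.mono fun k h => h.2.1)
  · intro lam₁ lam₂ h₁ h₂
    refine hasGapExpansion_of_bound ha hab hγ (K := 2 * K') ?_
    filter_upwards [hgap, h₁, h₂, hCs, hCt] with k hk h₁ h₂ hs ht
    obtain ⟨C₁, hC₁, hprod₁, hlam₁⟩ := h₁.2
    obtain ⟨C₂, hC₂, hprod₂, hlam₂⟩ := h₂.2
    -- Solutions of the product equation coincide with the solutions of the consistency equations,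
    -- so the two eigenvalues are the Bethe eigenvalues at `Cs` and `Ct`.
    rw [hlam₁, hlam₂, hs.2.2.2 C₁ (Or.inr ⟨hC₁, hprod₁⟩), ht.2.2.2 C₂ (Or.inr ⟨hC₂, hprod₂⟩)]
    exact hk
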